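/- Let $d\ge 3$, and let $V\ge 0$ be a locally integrable function on $\mathbb R^d$ which is not almost everywhere zero and belongs to the reverse Hölder class $RH_s(\mathbb R^d)$ for some $s\in[d/2,\infty]$, that is, for some constant $C>0$, $\big(\frac1{|B|}\int_B V^s\big)^{1/s}\le \frac{C}{|B|}\int_B V$ for all balls $B$ (with the essential supremum of $V$ over $B$ on the left if $s=\infty$). Let $$\rho(x)=\sup\Big\{r>0:\ \frac1{r^{d-2}}\int_{B(x,r)}V(y)\,dy\le 1\Big\}$$ be the critical radius function. $Q(x_0,r)$ denotes the cube with center $x_0$, side length $r$ and sides parallel to the axes, and $B(x_0,r)$ the ball with center $x_0$ and radius $r$ ($x_0\in\mathbb R^d$, $0<r<\infty$). For a real measurable function $f$ and a cube or ball $S$ put $f_S^-(x)=f(x)-\operatorname{ess\,inf}_{y\in S}f(y)$ (equal to $+\infty$ if $f$ is not essentially bounded below on $S$). Function spaces. For $\theta>0$, $f\in \mathrm{BLO}_{\rho,\theta}$ means that $f\in L^1_{\rm loc}(\mathbb R^d)$ and, for some $C>0$, $\frac1{|Q|}\int_Q f_Q^-\,dx\le C\,(1+r/\rho(x_0))^{\theta}$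 for all cubes $Q=Q(x_0,r)$; for $0<\beta<1$, $f\in\mathcal C^{\beta,*}_{\rho,\theta}$ means that $f\in L^1_{\rm loc}(\mathbb R^d)$ and, for some $C>0$, $\frac1{|B|^{1+\beta/d}}\int_B f_B^-\,dx\le C\,(1+r/\rho(x_0))^{\theta}$ for all balls $B=B(x_0,r)$. Put $\mathrm{BLO}_{\rho,\infty}=\bigcup_{\theta>0}\mathrm{BLO}_{\rho,\theta}$ and $\mathcal C^{\beta,*}_{\rho,\infty}=\bigcup_{\theta>0}\mathcal C^{\beta,*}_{\rho,\theta}$. Weights. Let $1\le p<q<\infty$ and $p'=p/(p-1)$. For a non-negative locally integrable $\omega$ and a ball $B$ put $$[\omega]_{p,q;B}=\Big(\frac1{|B|}\int_B\omega^q\Big)^{1/q}\Big(\frac1{|B|}\int_B\omega^{-p'}\Big)^{1/p'}\ (p>1),\qquad [\omega]_{1,q;B}=\Big(\frac1{|B|}\int_B\omega^q\Big)^{1/q}\Big(\operatorname{ess\,inf}_B\omega\Big)^{-1}\ (p=1).$$ Then $\omega\in A^{\rho,\theta}_{p,q}$ means that, for some $C>0$, $[\omega]_{p,q;B}\le C\,(1+r/\rho(x_0))^{\theta}$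 for all balls $B=B(x_0,r)$; $A^{\rho,\infty}_{p,q}=\bigcup_{\theta>0}A^{\rho,\theta}_{p,q}$; $[\omega]_{A^{\rho,\theta}_{p,q}}=\sup_{B}(1+r/\rho(x_0))^{-\theta}[\omega]_{p,q;B}$; and $[\omega]_{A^{\rho,\infty}_{p,q}}=[\omega]_{A^{\rho,\theta^{**}}_{p,q}}\in(0,\infty]$ with $\theta^{**}=\inf\{\theta>0:\omega\in A^{\rho,\theta}_{p,q}\}$. Write $\omega^\gamma(E)=\int_E\omega(x)^\gamma dx$. **Corollary.** Let $\omega\in A^{\rho,\infty}_{p,q}$ with $\omega$ not almost everywhere zero, and let $f$ be a real-valued measurable function on $\mathbb R^d$. Let $\kappa=1$ or, in case $[\omega]_{A^{\rho,\infty}_{p,q}}<\infty$, alternatively $\kappa=[\omega]_{A^{\rho,\infty}_{p,q}}$. (1) The following three statements are equivalent: (a) $f\in\mathrm{BLO}_{\rho,\infty}$; (b) there are $C>0$ and $\mathcal N>0$ such that for all cubes $Q=Q(x_0,r)$ $$\Big(\frac1{\omega^q(Q)}\int_Q [f_Q^-(x)]^q\,\omega(x)^q\,dx\Big)^{1/q}\le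 C\,\kappa\Big(1+\frac r{\rho(x_0)}\Big)^{\mathcal N};$$ (c) there are $C>0$ and $\mathcal N>0$ such that for all cubes $Q=Q(x_0,r)$ $$\frac{|Q|^{1/p-1/q}}{[\omega^p(Q)]^{1/p}}\Big(\int_Q [f_Q^-(x)]^q\,\omega(x)^q\,dx\Big)^{1/q}\le C\,\kappa\Big(1+\frac r{\rho(x_0)}\Big)^{\mathcal N}.$$ (2) For every $0<\beta<1$, the following three statements are equivalent: (a) $f\in\mathcal C^{\beta,*}_{\rho,\infty}$; (b) there are $C>0$ and $\mathcal N'>0$ such that for all balls $B=B(x_0,r)$ $$\frac1{|B|^{\beta/d}}\Big(\frac1{\omega^q(B)}\int_B [f_B^-(x)]^q\,\omega(x)^q\,dx\Big)^{1/q}\le C\,\kappa\Big(1+\frac r{\rho(x_0)}\Big)^{\mathcal N'};$$ (c) there are $C>0$ and $\mathcal N'>0$ such that for all balls $B=B(x_0,r)$ $$\frac{|B|^{1/p-1/q-\beta/d}}{[\omega^p(B)]^{1/p}}\Big(\int_B [f_B^-(x)]^q\,\omega(x)^q\,dx\Big)^{1/q}\le C\,\kappa\Big(1+\frac r{\rho(x_0)}\Big)^{\mathcal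 N'}.$$ -/

import Mathlib

open MeasureTheory Set Metric
open scoped ENNReal

/-- The critical radius function
`ρ(x) = sup {r > 0 : r^{-(d-2)} ∫_{B(x,r)} V ≤ 1}` of a potential `V` on `ℝ^d` (`d ≥ 3`). -/
noncomputable def criticalRadius {d : ℕ} (V : EuclideanSpace ℝ (Fin d) → ℝ)
    (x : EuclideanSpace ℝ (Fin d)) : ℝ :=
  sSup {r : ℝ | 0 < r ∧ 1 / r ^ (d - 2) * ∫ y in ball x r, V y ≤ 1}

/-- The reverse Hölder class `RH_s`, `s ∈ (1, ∞]`: the `L^s` norm of `V` on a ball, with respect to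
normalized Lebesgue measure on that ball (an essential supremum for `s = ∞`), is at most a constant
times the mean of `V` over the ball. -/
def ReverseHolder {d : ℕ} (s : ℝ≥0∞) (V : EuclideanSpace ℝ (Fin d) → ℝ) : Prop :=
  ∃ C : ℝ, 0 < C ∧ ∀ (x : EuclideanSpace ℝ (Fin d)) (r : ℝ), 0 < r →
    eLpNorm V s ((volume (ball x r))⁻¹ • volume.restrict (ball x r)) ≤
      ENNReal.ofReal C * ((volume (ball x r))⁻¹ * ∫⁻ y in ball x r, ENNReal.ofReal (V y))

/-- The cube `Q(x₀, r)` with center `x₀`, side length `r` and sides parallel to the axes. -/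
def cube {d : ℕ} (x₀ : EuclideanSpace ℝ (Fin d)) (r : ℝ) : Set (EuclideanSpace ℝ (Fin d)) :=
  {y | ∀ i, |y i - x₀ i| < r / 2}

/-- `f(x) - ess inf_{y ∈ S} f(y)` as an element of `[0, ∞]`. The essential infimum is computed in
the extended reals, so the value is `∞` when `f` is not essentially bounded below on `S`. -/
noncomputable def lowerOsc {d : ℕ} (f : EuclideanSpace ℝ (Fin d) → ℝ)
    (S : Set (EuclideanSpace ℝ (Fin d))) (x : EuclideanSpace ℝ (Fin d)) : ℝ≥0∞ :=
  ((f x : EReal) - essInf (fun y => (f y : EReal)) (volume.restrict S)).toENNReal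

/-- The space `BLO_{ρ,θ}`. -/
def MemBLO {d : ℕ} (ρ : EuclideanSpace ℝ (Fin d) → ℝ) (θ : ℝ)
    (f : EuclideanSpace ℝ (Fin d) → ℝ) : Prop :=
  LocallyIntegrable f volume ∧
  ∃ C : ℝ, 0 < C ∧ ∀ (x₀ : EuclideanSpace ℝ (Fin d)) (r : ℝ), 0 < r →
    (volume (cube x₀ r))⁻¹ * ∫⁻ x in cube x₀ r, lowerOsc f (cube x₀ r) x ≤
      ENNReal.ofReal (C * (1 + r / ρ x₀) ^ θ)

/-- The space `BLO_{ρ,∞} = ⋃_{θ > 0} BLO_{ρ,θ}`. -/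
def MemBLOInfty {d : ℕ} (ρ : EuclideanSpace ℝ (Fin d) → ℝ)
    (f : EuclideanSpace ℝ (Fin d) → ℝ) : Prop :=
  ∃ θ : ℝ, 0 < θ ∧ MemBLO ρ θ f

/-- The space `C^{β,*}_{ρ,θ}`. -/
def MemCampanatoStar {d : ℕ} (ρ : EuclideanSpace ℝ (Fin d) → ℝ) (β θ : ℝ)
    (f : EuclideanSpace ℝ (Fin d) → ℝ) : Prop :=
  LocallyIntegrable f volume ∧
  ∃ C : ℝ, 0 < C ∧ ∀ (x₀ : EuclideanSpace ℝ (Fin d)) (r : ℝ), 0 < r →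
    (volume (ball x₀ r) ^ (1 + β / d))⁻¹ * ∫⁻ x in ball x₀ r, lowerOsc f (ball x₀ r) x ≤
      ENNReal.ofReal (C * (1 + r / ρ x₀) ^ θ)

/-- The space `C^{β,*}_{ρ,∞} = ⋃_{θ > 0} C^{β,*}_{ρ,θ}`. -/
def MemCampanatoStarInfty {d : ℕ} (ρ : EuclideanSpace ℝ (Fin d) → ℝ) (β : ℝ)
    (f : EuclideanSpace ℝ (Fin d) → ℝ) : Prop :=
  ∃ θ : ℝ, 0 < θ ∧ MemCampanatoStar ρ β θ f

/-- A weight: a non-negative locally integrable function. -/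
def IsWeight {d : ℕ} (ω : EuclideanSpace ℝ (Fin d) → ℝ) : Prop :=
  (∀ x, 0 ≤ ω x) ∧ LocallyIntegrable ω volume

/-- The weighted measure `ω^γ(E) = ∫_E ω(x)^γ dx`, with values in `[0, ∞]`. -/
noncomputable def weightPow {d : ℕ} (ω : EuclideanSpace ℝ (Fin d) → ℝ) (γ : ℝ)
    (E : Set (EuclideanSpace ℝ (Fin d))) : ℝ≥0∞ :=
  ∫⁻ x in E, ENNReal.ofReal (ω x) ^ γ

open Classical in
/-- The local `A_{p,q}` quantity of `ω` on a set `B`: for `p > 1`, with `p' = p / (p - 1)`,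
`(|B|⁻¹ ∫_B ω^q)^{1/q} (|B|⁻¹ ∫_B ω^{-p'})^{1/p'}`; for `p = 1`,
`(|B|⁻¹ ∫_B ω^q)^{1/q} (ess inf_B ω)⁻¹`. Everything is computed in `[0, ∞]`. -/
noncomputable def apqLocal {d : ℕ} (p q : ℝ) (ω : EuclideanSpace ℝ (Fin d) → ℝ)
    (B : Set (EuclideanSpace ℝ (Fin d))) : ℝ≥0∞ :=
  ((volume B)⁻¹ * weightPow ω q B) ^ (1 / q) *
    if p = 1 then (essInf (fun x => ENNReal.ofReal (ω x)) (volume.restrict B))⁻¹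
    else ((volume B)⁻¹ * weightPow ω (-(p / (p - 1))) B) ^ (1 / (p / (p - 1)))

/-- The class `A_{p,q}^{ρ,θ}`. -/
def MemApq {d : ℕ} (ρ : EuclideanSpace ℝ (Fin d) → ℝ) (p q θ : ℝ)
    (ω : EuclideanSpace ℝ (Fin d) → ℝ) : Prop :=
  IsWeight ω ∧
  ∃ C : ℝ, 0 < C ∧ ∀ (x₀ : EuclideanSpace ℝ (Fin d)) (r : ℝ), 0 < r →
    apqLocal p q ω (ball x₀ r) ≤ ENNReal.ofReal (C * (1 + r / ρ x₀) ^ θ)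

/-- The class `A_{p,q}^{ρ,∞} = ⋃_{θ > 0} A_{p,q}^{ρ,θ}`. -/
def MemApqInfty {d : ℕ} (ρ : EuclideanSpace ℝ (Fin d) → ℝ) (p q : ℝ)
    (ω : EuclideanSpace ℝ (Fin d) → ℝ) : Prop :=
  ∃ θ : ℝ, 0 < θ ∧ MemApq ρ p q θ ω

/-- The characteristic constant `[ω]_{A_{p,q}^{ρ,θ}}`, with values in `[0, ∞]`. -/
noncomputable def apqConst {d : ℕ} (ρ : EuclideanSpace ℝ (Fin d) → ℝ) (p q θ : ℝ)
    (ω : EuclideanSpace ℝ (Fin d) → ℝ) : ℝ≥0∞ :=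
  ⨆ (x₀ : EuclideanSpace ℝ (Fin d)) (r : ℝ) (_ : 0 < r),
    ENNReal.ofReal ((1 + r / ρ x₀) ^ (-θ)) * apqLocal p q ω (ball x₀ r)

/-- The characteristic constant `[ω]_{A_{p,q}^{ρ,∞}} = [ω]_{A_{p,q}^{ρ,θ}}` at
`θ = inf {θ > 0 : ω ∈ A_{p,q}^{ρ,θ}}`. It may be infinite, as the infimum need not be attained. -/
noncomputable def apqConstInfty {d : ℕ} (ρ : EuclideanSpace ℝ (Fin d) → ℝ) (p q : ℝ)
    (ω : EuclideanSpace ℝ (Fin d) → ℝ) : ℝ≥0∞ :=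
  apqConst ρ p q (sInf {θ : ℝ | 0 < θ ∧ MemApq ρ p q θ ω}) ω

/-- A quantity `Φ(x₀, r)` grows at most polynomially in `1 + r/ρ(x₀)`: for some `C, N > 0`,
`Φ(x₀, r) ≤ C κ (1 + r/ρ(x₀))^N` for all `x₀` and all `r > 0`. -/
def PolyBounded {d : ℕ} (ρ : EuclideanSpace ℝ (Fin d) → ℝ) (κ : ℝ≥0∞)
    (Φ : EuclideanSpace ℝ (Fin d) → ℝ → ℝ≥0∞) : Prop :=
  ∃ C : ℝ, 0 < C ∧ ∃ N : ℝ, 0 < N ∧ ∀ (x₀ : EuclideanSpace ℝ (Fin d)) (r : ℝ), 0 < r →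
    Φ x₀ r ≤ ENNReal.ofReal C * κ * ENNReal.ofReal ((1 + r / ρ x₀) ^ N)

open Filter Topology

/-! ### Doubling functions of a radius -/

/-! Every constant in the argument is allowed to grow like a power of `1 + r / ρ(x₀)`. The classical
unweighted and weighted estimates are therefore run inside one fixed cube or ball, with care that
the output depends polynomially on the input constants.

Localization rests on `criticalRadius_growth`: moving the center by at most a multiple of `r`
changes `1 + r / ρ` at most polynomially. By `PolyBounded.uniform`, a bound at all scales becomes a
single constant valid for all smaller cubes or balls near a given one. The growth of `ρ` comes from
`potential_growth`. With the exponent `d/2`, Hölder and reverse Hölder make `r^{2-d} ∫_B V`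
comparable to `(∫_B V^{d/2})^{2/d}`. The measure `V^{d/2} dx` is doubling, hence reverse doubling,
so the endpoint exponent needs no self-improvement.

From weighted to unweighted means one uses Hölder's inequality for `f⁻ω · ω⁻¹`, followed by Jensen
from `p` to `q` (`WeightGood.average_le`). The two weighted normalizations differ by a factor
between `1` and the local `A_{p,q}` quantity (`normalized_le`, `le_normalized`).

From unweighted to weighted means on cubes one uses a John–Nirenberg argument for the measure `ω^q
dx` (`lintegral_lowerOsc_rpow_le`). A Calderón–Zygmund decomposition at twice the mean oscillation
leaves at least half of the cube outside the bad cubes, and the `A_{p,q}` condition turns this into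
a fixed proportion of weighted measure. The supremum of the weighted `L^q` means is then bounded by
a constant plus a proper fraction of itself. Absorbing that fraction gives a bound linear in the
oscillation constant and in the weight constant, so polynomial growth survives.

For `β > 0` no such argument is needed: at Lebesgue points the lower oscillation telescopes over
concentric dyadic balls into a geometric series (`ae_lowerOsc_le_of_average_le`). The resulting
pointwise bound can be integrated against any admissible weight. The factor `κ` is finite and
nonzero, so it is absorbed into `C`. -/

theorem le_rpow_of_doubling {φ : ℝ → ℝ} {D : ℝ} (hD : 1 ≤ D) (h0 : ∀ r, 0 ≤ φ r)
    (hmono : Monotone φ) (hdbl : ∀ r, 0 < r → φ (2 * r) ≤ D * φ r) {t R : ℝ} (ht : 0 < t)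
    (htR : t ≤ R) : φ R ≤ D * (R / t) ^ Real.logb 2 D * φ t := by
  have hiter : ∀ n : ℕ, φ (2 ^ n * t) ≤ D ^ n * φ t := by
    intro n
    induction n with
    | zero => simp
    | succ n ih =>
      calc φ (2 ^ (n + 1) * t) = φ (2 * (2 ^ n * t)) := by ring_nf
        _ ≤ D * φ (2 ^ n * t) := hdbl _ (by positivity)
        _ ≤ D * (D ^ n * φ t) := by gcongr
        _ = _ := by ring
  have hRt : 1 ≤ R / t := (one_le_div ht).2 htR
  have hlog : 0 ≤ Real.logb 2 (R / t) := Real.logb_nonneg (by norm_num) hRt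
  set n := ⌈Real.logb 2 (R / t)⌉₊
  have hn1 : Real.logb 2 (R / t) ≤ n := Nat.le_ceil _
  have hn2 : (n : ℝ) ≤ 1 + Real.logb 2 (R / t) := by
    have := Nat.ceil_lt_add_one hlog
    linarith
  have hR : R ≤ 2 ^ n * t := by
    rw [← div_le_iff₀ ht]
    calc R / t = 2 ^ Real.logb 2 (R / t) :=
          (Real.rpow_logb (by norm_num) (by norm_num) (by positivity)).symm
      _ ≤ 2 ^ (n : ℝ) := Real.rpow_le_rpow_of_exponent_le (by norm_num) hn1
      _ = 2 ^ n := Real.rpow_natCast _ _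
  have hDn : D ^ n ≤ D * (R / t) ^ Real.logb 2 D := by
    calc D ^ n = D ^ (n : ℝ) := (Real.rpow_natCast _ _).symm
      _ ≤ D ^ (1 + Real.logb 2 (R / t)) := Real.rpow_le_rpow_of_exponent_le hD hn2
      _ = D * D ^ Real.logb 2 (R / t) := by
          rw [Real.rpow_add (by positivity), Real.rpow_one]
      _ = D * (R / t) ^ Real.logb 2 D := by
          congr 1
          rw [Real.rpow_def_of_pos (by positivity), Real.rpow_def_of_pos (by positivity),
            Real.logb, Real.logb]
          ring_nf
  calc φ R ≤ φ (2 ^ n * t) := hmono hR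
    _ ≤ D ^ n * φ t := hiter n
    _ ≤ _ := by gcongr; exact h0 t

/-- Iterate while `2 ^ n * t` stays below `R`. Taking the floor of `log₂ (R / t)` loses at most one
step, which is the factor `θ⁻¹`. -/
theorem le_rpow_of_reverse_doubling {φ : ℝ → ℝ} {θ : ℝ} (hθ0 : 0 < θ) (hθ1 : θ < 1)
    (h0 : ∀ r, 0 ≤ φ r)
    (hmono : Monotone φ) (hdbl : ∀ r, 0 < r → φ r ≤ θ * φ (2 * r)) {t R : ℝ} (ht : 0 < t)
    (htR : t ≤ R) : φ t ≤ θ⁻¹ * (t / R) ^ Real.logb 2 θ⁻¹ * φ R := by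
  have hR0 : 0 < R := ht.trans_le htR
  have hiter : ∀ n : ℕ, φ t ≤ θ ^ n * φ (2 ^ n * t) := by
    intro n
    induction n with
    | zero => simp
    | succ n ih =>
      calc φ t ≤ θ ^ n * φ (2 ^ n * t) := ih
        _ ≤ θ ^ n * (θ * φ (2 * (2 ^ n * t))) := by gcongr; exact hdbl _ (by positivity)
        _ = _ := by ring_nf
  have hRt : 1 ≤ R / t := (one_le_div ht).2 htR
  have hlog : 0 ≤ Real.logb 2 (R / t) := Real.logb_nonneg (by norm_num) hRt
  set n := ⌊Real.logb 2 (R / t)⌋₊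
  have hn1 : (n : ℝ) ≤ Real.logb 2 (R / t) := Nat.floor_le hlog
  have hn2 : Real.logb 2 (R / t) - 1 ≤ n := by
    have := Nat.lt_floor_add_one (Real.logb 2 (R / t))
    linarith
  have hR : 2 ^ n * t ≤ R := by
    rw [← le_div_iff₀ ht]
    calc (2 : ℝ) ^ n = 2 ^ (n : ℝ) := (Real.rpow_natCast _ _).symm
      _ ≤ 2 ^ Real.logb 2 (R / t) := Real.rpow_le_rpow_of_exponent_le (by norm_num) hn1
      _ = R / t := Real.rpow_logb (by norm_num) (by norm_num) (by positivity)
  have hDn : θ ^ n ≤ θ⁻¹ * (t / R) ^ Real.logb 2 θ⁻¹ := by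
    calc θ ^ n = θ ^ (n : ℝ) := (Real.rpow_natCast _ _).symm
      _ ≤ θ ^ (Real.logb 2 (R / t) - 1) :=
          Real.rpow_le_rpow_of_exponent_ge hθ0 hθ1.le hn2
      _ = θ⁻¹ * θ ^ Real.logb 2 (R / t) := by
          rw [Real.rpow_sub hθ0, Real.rpow_one]; ring
      _ = θ⁻¹ * (t / R) ^ Real.logb 2 θ⁻¹ := by
          congr 1
          rw [Real.rpow_def_of_pos (by positivity), Real.rpow_def_of_pos (by positivity),
            Real.logb, Real.logb, Real.log_inv, ← inv_div R t, Real.log_inv]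
          ring_nf
  calc φ t ≤ θ ^ n * φ (2 ^ n * t) := hiter n
    _ ≤ θ ^ n * φ R := by gcongr; exact hmono hR
    _ ≤ _ := by gcongr; exact h0 R

/-! ### Measures on balls -/

section Balls

variable {d : ℕ}

theorem volume_real_ball [NeZero d] (x : EuclideanSpace ℝ (Fin d)) {r : ℝ} (hr : 0 < r) :
    volume.real (ball x r) = r ^ d * volume.real (ball (0 : EuclideanSpace ℝ (Fin d)) 1) := by
  rw [Measure.real, Measure.addHaar_ball _ _ hr.le, ENNReal.toReal_mul, ENNReal.toReal_ofReal
    (by positivity)]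
  simp [Measure.real]

theorem volume_real_ball_pos (x : EuclideanSpace ℝ (Fin d)) {r : ℝ} (hr : 0 < r) :
    0 < volume.real (ball x r) :=
  ENNReal.toReal_pos (measure_ball_pos _ _ hr).ne' measure_ball_lt_top.ne

/-- If `μ` and `ν` satisfy Hölder's inequality and the reverse Hölder inequality on balls with an
exponent `s > 1`, then `μ` is doubling. -/
theorem doubling_of_reverseHolder [NeZero d] {μ ν : Measure (EuclideanSpace ℝ (Fin d))}
    (hμ : ∀ x r, μ (ball x r) ≠ ∞) (hν : ∀ x r, ν (ball x r) ≠ ∞) {s C : ℝ} (hs : 1 < s)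
    (hH : ∀ A x r, MeasurableSet A → A ⊆ ball x r →
      μ.real A ≤ volume.real A ^ (1 - 1 / s) * ν.real A ^ (1 / s))
    (hRH : ∀ x r, 0 < r → ν.real (ball x r) ^ (1 / s) * volume.real (ball x r) ^ (1 - 1 / s) ≤
      C * μ.real (ball x r)) :
    ∃ D : ℝ, 1 ≤ D ∧ ∀ x r, 0 < r → μ.real (ball x (2 * r)) ≤ D * μ.real (ball x r) := by
  have hs' : 0 < 1 - 1 / s := by
    rw [sub_pos, div_lt_one (by linarith)]; exact hs
  -- As `η → 1` the annulus between radii `η * r` and `r` has a vanishing share of the volume.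
  -- Hölder followed by reverse Hölder then leaves it at most half of the `μ`-mass.
  obtain ⟨η, hη0, hη1, hη⟩ : ∃ η : ℝ, 0 < η ∧ η < 1 ∧ C * (1 - η ^ d) ^ (1 - 1 / s) ≤ 1 / 2 := by
    have hcont : Tendsto (fun η : ℝ => C * (1 - η ^ d) ^ (1 - 1 / s)) (𝓝[<] 1) (𝓝 0) := by
      have : ContinuousAt (fun η : ℝ => C * (1 - η ^ d) ^ (1 - 1 / s)) 1 := by
        refine continuousAt_const.mul (ContinuousAt.rpow_const ?_ (Or.inr hs'.le))
        fun_prop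
      have h2 := this.tendsto
      simp only [one_pow, sub_self, Real.zero_rpow hs'.ne', mul_zero] at h2
      exact h2.mono_left nhdsWithin_le_nhds
    have h1 := hcont.eventually (ge_mem_nhds (show (0 : ℝ) < 1 / 2 by norm_num))
    have h2 : ∀ᶠ η : ℝ in 𝓝[<] 1, η ∈ Ioo (0 : ℝ) 1 := Ioo_mem_nhdsLT (by norm_num)
    obtain ⟨η, h3, h4⟩ := (h1.and h2).exists
    exact ⟨η, h4.1, h4.2, h3⟩
  have hstep : ∀ x r, 0 < r → μ.real (ball x r) ≤ 2 * μ.real (ball x (η * r)) := by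
    intro x r hr
    have hsub : ball x (η * r) ⊆ ball x r := ball_subset_ball (by nlinarith)
    have hdiff : ∀ m : Measure (EuclideanSpace ℝ (Fin d)), m (ball x r) ≠ ∞ →
        m.real (ball x r \ ball x (η * r)) = m.real (ball x r) - m.real (ball x (η * r)) :=
      fun m hm => measureReal_sdiff hsub measurableSet_ball
        (ne_top_of_le_ne_top hm (measure_mono subset_rfl))
    set v := volume.real (ball x r) with hv
    have hvpos : 0 < v := volume_real_ball_pos x hr
    have hvol : volume.real (ball x r \ ball x (η * r)) = (1 - η ^ d) * v := by
      rw [hdiff _ measure_ball_lt_top.ne, hv, volume_real_ball x hr,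
        volume_real_ball x (by positivity)]
      ring
    have hηd : 0 ≤ 1 - η ^ d := sub_nonneg.2 (pow_le_one₀ hη0.le hη1.le)
    have h1 := hH (ball x r \ ball x (η * r)) x r (measurableSet_ball.diff measurableSet_ball)
      sdiff_subset
    rw [hvol, hdiff μ (hμ x r), Real.mul_rpow hηd hvpos.le] at h1
    have h2 : ν.real (ball x r \ ball x (η * r)) ^ (1 / s) ≤ ν.real (ball x r) ^ (1 / s) := by
      have : 0 ≤ 1 / s := by positivity
      gcongr
      · exact hν x r
      · exact sdiff_subset
    have h3 := hRH x r hr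
    have h4 : μ.real (ball x r) - μ.real (ball x (η * r)) ≤ 1 / 2 * μ.real (ball x r) := by
      calc _ ≤ _ := h1
        _ ≤ (1 - η ^ d) ^ (1 - 1 / s) * v ^ (1 - 1 / s) * ν.real (ball x r) ^ (1 / s) := by
            gcongr
        _ = (1 - η ^ d) ^ (1 - 1 / s) * (ν.real (ball x r) ^ (1 / s) * v ^ (1 - 1 / s)) := by ring
        _ ≤ (1 - η ^ d) ^ (1 - 1 / s) * (C * μ.real (ball x r)) := by gcongr
        _ = (C * (1 - η ^ d) ^ (1 - 1 / s)) * μ.real (ball x r) := by ring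
        _ ≤ _ := by gcongr
    linarith
  -- Each shrinking by `η` costs a factor 2, and `k` shrinkings take radius `2 * r` below `r`.
  obtain ⟨k, hk⟩ := exists_pow_lt_of_lt_one (show (0 : ℝ) < 1 / 2 by norm_num) hη1
  refine ⟨2 ^ k, one_le_pow₀ (by norm_num), fun x r hr => ?_⟩
  have hiter : ∀ n : ℕ, μ.real (ball x (2 * r)) ≤ 2 ^ n * μ.real (ball x (η ^ n * (2 * r))) := by
    intro n
    induction n with
    | zero => simp
    | succ n ih =>
      calc _ ≤ _ := ih
        _ ≤ 2 ^ n * (2 * μ.real (ball x (η * (η ^ n * (2 * r))))) := by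
            gcongr; exact hstep _ _ (by positivity)
        _ = _ := by ring_nf
  calc _ ≤ _ := hiter k
    _ ≤ 2 ^ k * μ.real (ball x r) := by
      gcongr
      · exact hμ x r
      · nlinarith

/-- A doubling measure is reverse doubling. -/
theorem reverse_doubling_of_doubling [NeZero d] {ν : Measure (EuclideanSpace ℝ (Fin d))}
    (hν : ∀ x r, ν (ball x r) ≠ ∞) {D : ℝ} (hD : 1 ≤ D)
    (hdbl : ∀ x r, 0 < r → ν.real (ball x (2 * r)) ≤ D * ν.real (ball x r)) :
    ∃ θ : ℝ, 0 < θ ∧ θ < 1 ∧ ∀ x r, 0 < r → ν.real (ball x r) ≤ θ * ν.real (ball x (2 * r)) := by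
  have key : ∀ x r, 0 < r →
      ν.real (ball x r) ≤ (1 - 1 / D ^ 3) * ν.real (ball x (2 * r)) := by
    intro x r hr
    -- A ball of radius `r / 2` at distance `3r / 2` fits in the shell between `B(x, r)` and `B(x,
    -- 2r)`. Three doublings of it cover `B(x, 2r)`, so it carries the proportion `1 / D ^ 3` of the
    -- mass.
    let e : EuclideanSpace ℝ (Fin d) := EuclideanSpace.single 0 (3 / 2 * r)
    have he : ‖e‖ = 3 / 2 * r := by
      simp only [e, PiLp.norm_single, Real.norm_eq_abs]
      exact abs_of_pos (by positivity)
    have hdist : dist (x + e) x = 3 / 2 * r := by simp [he]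
    have hdisj : Disjoint (ball x r) (ball (x + e) (r / 2)) := by
      apply ball_disjoint_ball
      rw [dist_comm, hdist]; linarith
    have hsub : ball x r ∪ ball (x + e) (r / 2) ⊆ ball x (2 * r) := by
      apply union_subset (ball_subset_ball (by linarith))
      apply ball_subset_ball'
      rw [hdist]; linarith
    have hsub2 : ball x (2 * r) ⊆ ball (x + e) (2 * (2 * (2 * (r / 2)))) := by
      apply ball_subset_ball'
      rw [dist_comm, hdist]; linarith
    have h1 : ν.real (ball x r) + ν.real (ball (x + e) (r / 2)) ≤ ν.real (ball x (2 * r)) := by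
      rw [← measureReal_union hdisj measurableSet_ball (hν _ _) (hν _ _)]
      exact measureReal_mono hsub (hν _ _)
    have h2 : ν.real (ball x (2 * r)) ≤ D ^ 3 * ν.real (ball (x + e) (r / 2)) := by
      calc _ ≤ ν.real (ball (x + e) (2 * (2 * (2 * (r / 2))))) := measureReal_mono hsub2 (hν _ _)
        _ ≤ D * (D * (D * ν.real (ball (x + e) (r / 2)))) := by
          refine (hdbl _ _ (by positivity)).trans ?_
          gcongr
          refine (hdbl _ _ (by positivity)).trans ?_
          gcongr
          exact hdbl _ _ (by positivity)
        _ = _ := by ring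
    have h3 : 1 / D ^ 3 * ν.real (ball x (2 * r)) ≤ ν.real (ball (x + e) (r / 2)) := by
      rw [one_div, inv_mul_le_iff₀ (by positivity)]; exact h2
    linarith
  have hD3 : 0 < 1 / D ^ 3 := by positivity
  have hD3' : 1 / D ^ 3 ≤ 1 := by
    rw [div_le_one (by positivity)]; exact one_le_pow₀ hD
  -- Halving `1 / D ^ 3` keeps `θ` positive even when `D = 1`.
  exact ⟨1 - 1 / D ^ 3 / 2, by linarith, by linarith, fun x r hr => (key x r hr).trans
    (mul_le_mul_of_nonneg_right (by linarith) measureReal_nonneg)⟩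

end Balls

/-! ### Growth of the normalized integrals of the potential -/

section Potential

variable {d : ℕ}

theorem integrableOn_ball {V : EuclideanSpace ℝ (Fin d) → ℝ} (hV : LocallyIntegrable V volume)
    (x : EuclideanSpace ℝ (Fin d)) (r : ℝ) : IntegrableOn V (ball x r) :=
  (hV.integrableOn_isCompact (isCompact_closedBall x r)).mono_set ball_subset_closedBall

theorem withDensity_real_ball {V : EuclideanSpace ℝ (Fin d) → ℝ} (hV0 : ∀ x, 0 ≤ V x)
    (hV : LocallyIntegrable V volume) (x : EuclideanSpace ℝ (Fin d)) (r : ℝ) :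
    (volume.withDensity fun y => ENNReal.ofReal (V y)).real (ball x r) = ∫ y in ball x r, V y := by
  rw [Measure.real, withDensity_apply _ measurableSet_ball,
    integral_eq_lintegral_of_nonneg_ae (Eventually.of_forall hV0)
      (integrableOn_ball hV x r).aestronglyMeasurable]

theorem lintegral_le_volume_rpow_mul {V : EuclideanSpace ℝ (Fin d) → ℝ≥0∞} {s : ℝ} (hs : 1 < s)
    (hV : AEMeasurable V volume) (A : Set (EuclideanSpace ℝ (Fin d))) :
    ∫⁻ y in A, V y ≤ volume A ^ (1 - 1 / s) * (∫⁻ y in A, V y ^ s) ^ (1 / s) := by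
  have h := ENNReal.lintegral_mul_le_Lp_mul_Lq (volume.restrict A)
    (Real.HolderConjugate.conjExponent hs) hV.restrict (aemeasurable_const (b := (1 : ℝ≥0∞)))
  have hc : 1 / s.conjExponent = 1 - 1 / s := by
    have := (Real.HolderConjugate.conjExponent hs).inv_add_inv_eq_one
    rw [one_div, one_div]; linarith
  simp only [Pi.mul_apply, mul_one, ENNReal.one_rpow, lintegral_const, one_mul,
    Measure.restrict_apply_univ, hc] at h
  rwa [mul_comm]

/-- Jensen on the normalized ball lowers the exponent from `s`, possibly infinite, to any positive
real `s₀ ≤ s`. It is applied with `s₀ = d / 2`. -/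
theorem ReverseHolder.lintegral_rpow_le {V : EuclideanSpace ℝ (Fin d) → ℝ}
    (hV0 : ∀ x, 0 ≤ V x) (hV : LocallyIntegrable V volume) {s : ℝ≥0∞} {s₀ : ℝ} (hs₀ : 0 < s₀)
    (hs : ENNReal.ofReal s₀ ≤ s) (h : ReverseHolder s V) :
    ∃ C : ℝ, 1 ≤ C ∧ ∀ (x : EuclideanSpace ℝ (Fin d)) (r : ℝ), 0 < r →
      ((volume (ball x r))⁻¹ * ∫⁻ y in ball x r, ENNReal.ofReal (V y) ^ s₀) ^ (1 / s₀) ≤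
        ENNReal.ofReal C * ((volume (ball x r))⁻¹ * ∫⁻ y in ball x r, ENNReal.ofReal (V y)) := by
  obtain ⟨C, hC, h⟩ := h
  refine ⟨max C 1, le_max_right _ _, fun x r hr => ?_⟩
  have hprob : IsProbabilityMeasure ((volume (ball x r))⁻¹ • volume.restrict (ball x r)) := by
    constructor
    simp only [Measure.smul_apply, Measure.restrict_apply_univ, smul_eq_mul]
    exact ENNReal.inv_mul_cancel (measure_ball_pos _ _ hr).ne' measure_ball_lt_top.ne
  have h1 := eLpNorm_le_eLpNorm_of_exponent_le hs
    ((hV.aestronglyMeasurable.mono_measure Measure.restrict_le_self).smul_measure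
      (μ := volume.restrict (ball x r)) (volume (ball x r))⁻¹)
  rw [eLpNorm_eq_lintegral_rpow_enorm_toReal (by simpa using hs₀) ENNReal.ofReal_ne_top,
    ENNReal.toReal_ofReal hs₀.le, lintegral_smul_measure, smul_eq_mul] at h1
  have h2 : ∀ y, ‖V y‖ₑ = ENNReal.ofReal (V y) := fun y => Real.enorm_of_nonneg (hV0 y)
  simp only [h2] at h1
  refine h1.trans ((h x r hr).trans ?_)
  gcongr
  exact le_max_left _ _

/-- Put `ψ(x, r) = r^{2-d} ∫_{B(x,r)} V`. Hölder and reverse Hölder at exponent `d/2` give `ψ ≈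
ν(B)^{2/d}` with `ν = V^{d/2} dx`. Thus both growth bounds reduce to doubling and reverse doubling
of `ν`, and monotonicity of `ν` on balls replaces the missing monotonicity of `ψ`. -/
theorem potential_growth (hd : 3 ≤ d) {V : EuclideanSpace ℝ (Fin d) → ℝ}
    (hV0 : ∀ x, 0 ≤ V x) (hV : LocallyIntegrable V volume) {s : ℝ≥0∞} (hs : (d : ℝ≥0∞) / 2 ≤ s)
    (hRH : ReverseHolder s V) :
    ∃ C N δ : ℝ, 1 ≤ C ∧ 0 < N ∧ 0 < δ ∧ ∀ (x : EuclideanSpace ℝ (Fin d)) (t R : ℝ), 0 < t → t ≤ R →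
      1 / R ^ (d - 2) * ∫ y in ball x R, V y ≤
        C * (R / t) ^ N * (1 / t ^ (d - 2) * ∫ y in ball x t, V y) ∧
      1 / t ^ (d - 2) * ∫ y in ball x t, V y ≤
        C * (t / R) ^ δ * (1 / R ^ (d - 2) * ∫ y in ball x R, V y) := by
  have : NeZero d := ⟨by omega⟩
  have hd' : (3 : ℝ) ≤ d := by exact_mod_cast hd
  set s₀ : ℝ := d / 2 with hs₀
  have hs₀1 : 1 < s₀ := by rw [hs₀]; linarith
  have hs₀0 : 0 < s₀ := by linarith
  have hexp : 0 < 1 / s₀ := by positivity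
  obtain ⟨C, hC, hCV⟩ := hRH.lintegral_rpow_le hV0 hV hs₀0 (by
    rw [hs₀, ENNReal.ofReal_div_of_pos (by norm_num)]; simpa using hs)
  set μ : Measure (EuclideanSpace ℝ (Fin d)) := volume.withDensity fun y => ENNReal.ofReal (V y)
  set ν : Measure (EuclideanSpace ℝ (Fin d)) :=
    volume.withDensity fun y => ENNReal.ofReal (V y) ^ s₀
  have hμint : ∀ x r, μ.real (ball x r) = ∫ y in ball x r, V y := withDensity_real_ball hV0 hV
  have hμ : ∀ x r, μ (ball x r) ≠ ∞ := by
    intro x r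
    rw [withDensity_apply _ measurableSet_ball]
    exact (integrableOn_ball hV x r).lintegral_lt_top.ne
  have hCV' : ∀ x r, 0 < r → ((volume (ball x r))⁻¹ * ν (ball x r)) ^ (1 / s₀) ≤
      ENNReal.ofReal C * ((volume (ball x r))⁻¹ * μ (ball x r)) := by
    intro x r hr
    rw [withDensity_apply _ measurableSet_ball, withDensity_apply _ measurableSet_ball]
    exact hCV x r hr
  have hν : ∀ x r, ν (ball x r) ≠ ∞ := by
    intro x r
    rcases le_or_gt r 0 with hr | hr
    · simp [ball_eq_empty.2 hr]
    intro htop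
    have h := hCV' x r hr
    have hinv : (volume (ball x r))⁻¹ ≠ 0 := ENNReal.inv_ne_zero.2 measure_ball_lt_top.ne
    rw [htop, ENNReal.mul_top hinv, ENNReal.top_rpow_of_pos hexp, top_le_iff] at h
    exact ENNReal.mul_ne_top ENNReal.ofReal_ne_top (ENNReal.mul_ne_top
      (ENNReal.inv_ne_top.2 (measure_ball_pos _ _ hr).ne') (hμ x r)) h
  have hH : ∀ A x r, MeasurableSet A → A ⊆ ball x r →
      μ.real A ≤ volume.real A ^ (1 - 1 / s₀) * ν.real A ^ (1 / s₀) := by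
    intro A x r hA hsub
    have h := lintegral_le_volume_rpow_mul hs₀1 hV.aestronglyMeasurable.aemeasurable.ennreal_ofReal A
    rw [← withDensity_apply _ hA, ← withDensity_apply _ hA] at h
    have hvA : volume A ≠ ∞ := ne_top_of_le_ne_top measure_ball_lt_top.ne (measure_mono hsub)
    have hνA : ν A ≠ ∞ := ne_top_of_le_ne_top (hν x r) (measure_mono hsub)
    have hs' : 0 ≤ 1 - 1 / s₀ := by
      rw [sub_nonneg, div_le_one hs₀0]; exact hs₀1.le
    have h2 := ENNReal.toReal_mono (ENNReal.mul_ne_top (ENNReal.rpow_ne_top_of_nonneg hs' hvA)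
      (ENNReal.rpow_ne_top_of_nonneg hexp.le hνA)) h
    rwa [ENNReal.toReal_mul, ← ENNReal.toReal_rpow, ← ENNReal.toReal_rpow] at h2
  have hR : ∀ x r, 0 < r → ν.real (ball x r) ^ (1 / s₀) * volume.real (ball x r) ^ (1 - 1 / s₀) ≤
      C * μ.real (ball x r) := by
    intro x r hr
    have h := ENNReal.toReal_mono (ENNReal.mul_ne_top ENNReal.ofReal_ne_top (ENNReal.mul_ne_top
      (ENNReal.inv_ne_top.2 (measure_ball_pos _ _ hr).ne') (hμ x r))) (hCV' x r hr)
    have hv := volume_real_ball_pos x hr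
    rw [← ENNReal.toReal_rpow, ENNReal.toReal_mul, ENNReal.toReal_mul, ENNReal.toReal_mul,
      ENNReal.toReal_inv, ENNReal.toReal_ofReal (by linarith)] at h
    change ((volume.real (ball x r))⁻¹ * ν.real (ball x r)) ^ (1 / s₀) ≤
      C * ((volume.real (ball x r))⁻¹ * μ.real (ball x r)) at h
    set v := volume.real (ball x r)
    rw [Real.mul_rpow (by positivity) measureReal_nonneg, Real.inv_rpow hv.le] at h
    rw [Real.rpow_sub hv, Real.rpow_one]
    calc _ = v * ((v ^ (1 / s₀))⁻¹ * ν.real (ball x r) ^ (1 / s₀)) := by ring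
      _ ≤ v * (C * (v⁻¹ * μ.real (ball x r))) := by gcongr
      _ = _ := by field_simp
  obtain ⟨D, hD, hdbl⟩ := doubling_of_reverseHolder hμ hν hs₀1 hH hR
  set c : ℝ := volume.real (ball (0 : EuclideanSpace ℝ (Fin d)) 1) ^ (1 - 1 / s₀)
  have hc : 0 < c := Real.rpow_pos_of_pos (volume_real_ball_pos 0 one_pos) _
  -- The choice `s₀ = d / 2` makes this power of the volume an exact multiple of `r ^ (d - 2)`, the
  -- normalization in `ψ`.
  have hvol : ∀ (x : EuclideanSpace ℝ (Fin d)) (r : ℝ), 0 < r →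
      volume.real (ball x r) ^ (1 - 1 / s₀) = r ^ (d - 2) * c := by
    intro x r hr
    rw [volume_real_ball x hr, Real.mul_rpow (by positivity) measureReal_nonneg,
      ← Real.rpow_natCast, ← Real.rpow_mul hr.le, ← Real.rpow_natCast r (d - 2)]
    congr 2
    rw [hs₀, Nat.cast_sub (by omega)]
    field_simp
    norm_num
  set ψ : EuclideanSpace ℝ (Fin d) → ℝ → ℝ := fun x r => 1 / r ^ (d - 2) * ∫ y in ball x r, V y
  have hψ1 : ∀ x r, 0 < r → ψ x r ≤ c * ν.real (ball x r) ^ (1 / s₀) := by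
    intro x r hr
    have h := hH (ball x r) x r measurableSet_ball subset_rfl
    rw [hvol x r hr] at h
    simp only [ψ]
    rw [← hμint, one_div, inv_mul_le_iff₀ (by positivity)]
    linarith
  have hψ2 : ∀ x r, 0 < r → c * ν.real (ball x r) ^ (1 / s₀) ≤ C * ψ x r := by
    intro x r hr
    have h := hR x r hr
    rw [hvol x r hr] at h
    simp only [ψ]
    rw [← hμint, mul_left_comm, one_div_mul_eq_div, le_div_iff₀ (by positivity)]
    linarith
  have hψdbl : ∀ x r, 0 < r → ψ x (2 * r) ≤ D * ψ x r := by
    intro x r hr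
    simp only [ψ]
    rw [← hμint, ← hμint]
    calc 1 / (2 * r) ^ (d - 2) * μ.real (ball x (2 * r))
        ≤ 1 / r ^ (d - 2) * (D * μ.real (ball x r)) := by
          gcongr
          · linarith
          · exact hdbl x r hr
      _ = _ := by ring
  -- Doubling of `μ` passes to `ψ` and then to `ν` through the comparison of `ψ` with `ν(B)^{1/s₀}`.
  have hνdbl : ∀ x r, 0 < r → ν.real (ball x (2 * r)) ≤ (C * D) ^ s₀ * ν.real (ball x r) := by
    intro x r hr
    have h1 : c * ν.real (ball x (2 * r)) ^ (1 / s₀) ≤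
        c * ((C * D) * ν.real (ball x r) ^ (1 / s₀)) := by
      calc _ ≤ C * ψ x (2 * r) := hψ2 x _ (by positivity)
        _ ≤ C * (D * ψ x r) := by gcongr; exact hψdbl x r hr
        _ ≤ C * (D * (c * ν.real (ball x r) ^ (1 / s₀))) := by gcongr; exact hψ1 x r hr
        _ = _ := by ring
    have h2 := Real.rpow_le_rpow (by positivity) (le_of_mul_le_mul_left h1 hc) hs₀0.le
    rwa [← Real.rpow_mul measureReal_nonneg, Real.mul_rpow (by positivity) (by positivity),
      ← Real.rpow_mul measureReal_nonneg, one_div_mul_cancel hs₀0.ne', Real.rpow_one,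
      Real.rpow_one] at h2
  have hCD : 1 ≤ (C * D) ^ s₀ := Real.one_le_rpow (by nlinarith) hs₀0.le
  obtain ⟨θ, hθ0, hθ1, hrev⟩ := reverse_doubling_of_doubling hν hCD hνdbl
  have hmono : ∀ x, Monotone fun r => ν.real (ball x r) := fun x a b hab =>
    measureReal_mono (ball_subset_ball hab) (hν x b)
  have hpow : ∀ {K u e a b : ℝ}, 1 ≤ K → 0 ≤ u → 0 ≤ a → 0 ≤ b → a ≤ K * u ^ e * b →
      a ^ (1 / s₀) ≤ K * u ^ (e / s₀) * b ^ (1 / s₀) := by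
    intro K u e a b hK hu ha hb hab
    have h := Real.rpow_le_rpow ha hab hexp.le
    rw [Real.mul_rpow (by positivity) hb, Real.mul_rpow (by positivity) (by positivity),
      ← Real.rpow_mul hu, mul_one_div] at h
    refine h.trans ?_
    gcongr
    have : 1 / s₀ ≤ 1 := by rw [div_le_one hs₀0]; exact hs₀1.le
    calc K ^ (1 / s₀) ≤ K ^ (1 : ℝ) := Real.rpow_le_rpow_of_exponent_le hK this
      _ = K := Real.rpow_one K
  set K : ℝ := max ((C * D) ^ s₀) θ⁻¹
  have hθi : 1 < θ⁻¹ := (one_lt_inv₀ hθ0).2 hθ1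
  have hK : 1 ≤ K := hCD.trans (le_max_left _ _)
  -- The logarithm is only known to be nonnegative; adding 1 makes the exponent positive.
  refine ⟨C * K, (Real.logb 2 ((C * D) ^ s₀) + 1) / s₀, Real.logb 2 θ⁻¹ / s₀, by nlinarith, ?_, ?_,
    fun x t R ht htR => ⟨?_, ?_⟩⟩
  · have := Real.logb_nonneg (b := 2) (by norm_num) hCD
    positivity
  · have := Real.logb_pos (b := 2) (by norm_num) hθi
    positivity
  · have hR0 : 0 < R := ht.trans_le htR
    have h1 := le_rpow_of_doubling hCD (fun _ => measureReal_nonneg) (hmono x) (hνdbl x) ht htR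
    have hRt : 1 ≤ R / t := (one_le_div ht).2 htR
    have h2 : ν.real (ball x R) ≤
        K * (R / t) ^ (Real.logb 2 ((C * D) ^ s₀) + 1) * ν.real (ball x t) := by
      refine h1.trans ?_
      gcongr ?_ * ?_ * _
      · exact le_max_left _ _
      · exact Real.rpow_le_rpow_of_exponent_le hRt (by linarith)
    have h3 := hpow hK (by positivity) measureReal_nonneg measureReal_nonneg h2
    calc ψ x R ≤ c * ν.real (ball x R) ^ (1 / s₀) := hψ1 x R hR0
      _ ≤ c * (K * (R / t) ^ ((Real.logb 2 ((C * D) ^ s₀) + 1) / s₀) *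
          ν.real (ball x t) ^ (1 / s₀)) := by gcongr
      _ = K * (R / t) ^ ((Real.logb 2 ((C * D) ^ s₀) + 1) / s₀) *
          (c * ν.real (ball x t) ^ (1 / s₀)) := by ring
      _ ≤ K * (R / t) ^ ((Real.logb 2 ((C * D) ^ s₀) + 1) / s₀) * (C * ψ x t) := by
          exact mul_le_mul_of_nonneg_left (hψ2 x t ht) (by positivity)
      _ = _ := by ring
  · have hR0 : 0 < R := ht.trans_le htR
    have h1 := le_rpow_of_reverse_doubling hθ0 hθ1 (fun _ => measureReal_nonneg) (hmono x)
      (hrev x) ht htR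
    have h2 : ν.real (ball x t) ≤ K * (t / R) ^ Real.logb 2 θ⁻¹ * ν.real (ball x R) := by
      refine h1.trans ?_
      gcongr
      exact le_max_right _ _
    have h3 := hpow hK (by positivity) measureReal_nonneg measureReal_nonneg h2
    calc ψ x t ≤ c * ν.real (ball x t) ^ (1 / s₀) := hψ1 x t ht
      _ ≤ c * (K * (t / R) ^ (Real.logb 2 θ⁻¹ / s₀) * ν.real (ball x R) ^ (1 / s₀)) := by gcongr
      _ = K * (t / R) ^ (Real.logb 2 θ⁻¹ / s₀) * (c * ν.real (ball x R) ^ (1 / s₀)) := by ring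
      _ ≤ K * (t / R) ^ (Real.logb 2 θ⁻¹ / s₀) * (C * ψ x R) :=
          mul_le_mul_of_nonneg_left (hψ2 x R hR0) (by positivity)
      _ = _ := by ring

end Potential

/-! ### Positivity and slow variation of the critical radius -/

section CriticalRadius

variable {d : ℕ}

theorem exists_setIntegral_ball_pos {V : EuclideanSpace ℝ (Fin d) → ℝ} (hV0 : ∀ x, 0 ≤ V x)
    (hV : LocallyIntegrable V volume) (hV_ne : ¬ V =ᵐ[volume] 0) (x : EuclideanSpace ℝ (Fin d)) :
    ∃ r : ℝ, 0 < r ∧ 0 < ∫ y in ball x r, V y := by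
  by_contra! hcon
  apply hV_ne
  have h : ∀ n : ℕ, ∀ᵐ y ∂volume.restrict (ball x (n + 1)), V y = 0 := by
    intro n
    have h0 : ∫ y in ball x (n + 1), V y = 0 :=
      le_antisymm (hcon _ (by positivity)) (integral_nonneg hV0)
    exact (integral_eq_zero_iff_of_nonneg hV0 (integrableOn_ball hV x _)).1 h0
  have hU : ⋃ n : ℕ, ball x ((n : ℝ) + 1) = univ := by
    refine eq_univ_of_forall fun y => mem_iUnion.2 ?_
    obtain ⟨n, hn⟩ := exists_nat_gt (dist y x)
    exact ⟨n, by rw [mem_ball]; linarith⟩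
  have h2 := (ae_restrict_iUnion_iff (μ := volume) (fun n : ℕ => ball x ((n : ℝ) + 1))
    (fun y => V y = 0)).2 h
  rwa [hU, Measure.restrict_univ] at h2

/-- The critical radius is positive, and `1 + r / ρ` at one point is dominated by a power of
`1 + r / ρ` at any point at distance at most a multiple of `r`. -/
theorem criticalRadius_growth (hd : 3 ≤ d) {V : EuclideanSpace ℝ (Fin d) → ℝ}
    (hV0 : ∀ x, 0 ≤ V x) (hV : LocallyIntegrable V volume) (hV_ne : ¬ V =ᵐ[volume] 0)
    {s : ℝ≥0∞} (hs : (d : ℝ≥0∞) / 2 ≤ s) (hRH : ReverseHolder s V) :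
    (∀ x, 0 < criticalRadius V x) ∧
    ∀ A : ℝ, 0 ≤ A → ∃ C N : ℝ, 1 ≤ C ∧ 0 < N ∧
      ∀ (x x' : EuclideanSpace ℝ (Fin d)) (r : ℝ), 0 < r → dist x' x ≤ A * r →
        1 + r / criticalRadius V x' ≤ C * (1 + r / criticalRadius V x) ^ N := by
  obtain ⟨C, N, δ, hC, hN, hδ, hgrow⟩ := potential_growth hd hV0 hV hs hRH
  set ψ : EuclideanSpace ℝ (Fin d) → ℝ → ℝ :=
    fun x r => 1 / r ^ (d - 2) * ∫ y in ball x r, V y with hψ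
  have hψ0 : ∀ x r, 0 < r → 0 ≤ ψ x r := fun x r hr =>
    mul_nonneg (by positivity) (integral_nonneg hV0)
  have hC0 : 0 < C := by linarith
  -- A real `sSup` is 0 on an unbounded set, so boundedness must be proved. It holds because `ψ x R`
  -- grows at least like `(R / t) ^ δ` once `ψ x t > 0`.
  have hbdd : ∀ x, BddAbove {r : ℝ | 0 < r ∧ ψ x r ≤ 1} := by
    intro x
    obtain ⟨t, ht, hpos⟩ := exists_setIntegral_ball_pos hV0 hV hV_ne x
    have hψt : 0 < ψ x t := mul_pos (by positivity) hpos
    refine ⟨max t (t * (C / ψ x t) ^ (1 / δ)), ?_⟩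
    rintro R ⟨hR, hψR⟩
    rcases le_total R t with h | h
    · exact h.trans (le_max_left _ _)
    · refine le_trans ?_ (le_max_right _ _)
      have h1 : ψ x t ≤ C * (t / R) ^ δ * 1 :=
        ((hgrow x t R ht h).2).trans (by gcongr)
      have h2 : (R / t) ^ δ ≤ C / ψ x t := by
        rw [le_div_iff₀ hψt]
        calc (R / t) ^ δ * ψ x t ≤ (R / t) ^ δ * (C * (t / R) ^ δ * 1) := by gcongr
          _ = C * ((R / t) * (t / R)) ^ δ := by
              rw [Real.mul_rpow (by positivity) (by positivity)]; ring
          _ = C := by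
              rw [div_mul_div_cancel₀ ht.ne', div_self hR.ne', Real.one_rpow, mul_one]
      have h3 := Real.rpow_le_rpow (by positivity) h2 (show 0 ≤ 1 / δ by positivity)
      rw [← Real.rpow_mul (by positivity), mul_one_div_cancel hδ.ne', Real.rpow_one,
        div_le_iff₀ ht] at h3
      linarith
  have hle : ∀ x t, 0 < t → ψ x t ≤ 1 → t ≤ criticalRadius V x := fun x t ht h =>
    le_csSup (hbdd x) ⟨ht, h⟩
  -- Shrinking the radius by `(C * K) ^ (1 / δ)` brings `ψ` from `K` down to at most 1, so the
  -- shrunken radius competes in the supremum.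
  have hlow : ∀ x m K, 0 < m → 1 ≤ K → ψ x m ≤ K →
      m / (C * K) ^ (1 / δ) ≤ criticalRadius V x := by
    intro x m K hm hK hψK
    have hCK : 1 ≤ C * K := by nlinarith
    have hp : 1 ≤ (C * K) ^ (1 / δ) := Real.one_le_rpow hCK (by positivity)
    have ht : 0 < m / (C * K) ^ (1 / δ) := by positivity
    refine hle x _ ht (((hgrow x _ m ht (div_le_self hm.le hp)).2).trans ?_)
    have h1 : (m / (C * K) ^ (1 / δ) / m) ^ δ = (C * K)⁻¹ := by
      rw [div_div_cancel_left' hm.ne', Real.inv_rpow (by positivity),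
        ← Real.rpow_mul (by positivity), one_div_mul_cancel hδ.ne', Real.rpow_one]
    rw [h1]
    calc C * (C * K)⁻¹ * ψ x m ≤ C * (C * K)⁻¹ * K := by gcongr
      _ = 1 := by field_simp
  have hpos : ∀ x, 0 < criticalRadius V x := by
    intro x
    refine lt_of_lt_of_le ?_ (hlow x 1 (max 1 (ψ x 1)) one_pos (le_max_left _ _) (le_max_right _ _))
    positivity
  -- Since `ψ` need not be monotone, below the critical radius it is bounded by `C` and not by 1.
  have hupp : ∀ x a, 0 < a → a < criticalRadius V x → ψ x a ≤ C := by
    intro x a ha hax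
    have hne : {r : ℝ | 0 < r ∧ ψ x r ≤ 1}.Nonempty := by
      by_contra! hempty
      have : criticalRadius V x = 0 := by
        rw [criticalRadius]
        exact (congrArg sSup hempty).trans Real.sSup_empty
      linarith
    obtain ⟨r, ⟨hr, hψr⟩, har⟩ := exists_lt_of_lt_csSup hne hax
    refine ((hgrow x a r ha har.le).2).trans ?_
    have h1 : (a / r) ^ δ ≤ 1 :=
      Real.rpow_le_one (by positivity) ((div_le_one hr).2 har.le) hδ.le
    have := hψ0 x r hr
    calc C * (a / r) ^ δ * ψ x r ≤ C * 1 * 1 := by gcongr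
      _ = C := by ring
  refine ⟨hpos, fun A hA => ?_⟩
  set K₀ : ℝ := (A + 1) ^ (d - 2) * (C * (A + 1) ^ N * 2 ^ N * C) with hK₀
  have hA1 : 1 ≤ (A + 1) ^ (d - 2) := one_le_pow₀ (by linarith)
  have hAN : 1 ≤ (A + 1) ^ N := Real.one_le_rpow (by linarith) hN.le
  have h2N : 1 ≤ (2 : ℝ) ^ N := Real.one_le_rpow (by norm_num) hN.le
  have hK₀1 : 1 ≤ K₀ := by
    have h1 : 1 ≤ C * (A + 1) ^ N := one_le_mul_of_one_le_of_one_le hC hAN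
    have h2 := one_le_mul_of_one_le_of_one_le h1 h2N
    exact one_le_mul_of_one_le_of_one_le hA1 (one_le_mul_of_one_le_of_one_le h2 hC)
  refine ⟨2 * (C * K₀) ^ (1 / δ), N * (1 / δ), ?_, by positivity, fun x x' r hr hdist => ?_⟩
  · have : 1 ≤ (C * K₀) ^ (1 / δ) := Real.one_le_rpow (by nlinarith) (by positivity)
    linarith
  set ρ := criticalRadius V x
  have hρ : 0 < ρ := hpos x
  set u : ℝ := 1 + r / ρ
  have hu : 1 ≤ u := by
    have : 0 < r / ρ := by positivity
    simp only [u]; linarith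
  -- The radius `m` dominates `r` and is large enough to start the growth estimate at `ρ / 2`, which
  -- lies strictly below `ρ` as `hupp` requires. Comparing `B(x', m)` with `B(x, (A + 1) * m)`
  -- bounds `ψ x' m` by `K₀ * u ^ N`, and `hlow` turns this into a lower bound for the critical
  -- radius at `x'`.
  set m := max r (ρ / 2)
  have hm : 0 < m := lt_max_of_lt_left hr
  have hmu : m / (ρ / 2) ≤ 2 * u := by
    rw [div_le_iff₀ (by positivity)]
    have : u * ρ = ρ + r := by simp only [u]; field_simp
    apply max_le <;> nlinarith
  have hm1 : ρ / 2 ≤ (A + 1) * m := by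
    have h1 : ρ / 2 ≤ m := le_max_right _ _
    nlinarith
  have hsub : ball x' m ⊆ ball x ((A + 1) * m) := by
    apply ball_subset_ball'
    have h1 : r ≤ m := le_max_left _ _
    nlinarith
  have h1 : ψ x' m ≤ (A + 1) ^ (d - 2) * ψ x ((A + 1) * m) := by
    simp only [hψ]
    rw [mul_pow, ← mul_assoc]
    have h2 : (A + 1) ^ (d - 2) * (1 / ((A + 1) ^ (d - 2) * m ^ (d - 2))) = 1 / m ^ (d - 2) := by
      field_simp
    rw [h2]
    exact mul_le_mul_of_nonneg_left (setIntegral_mono_set (integrableOn_ball hV x _)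
      (Eventually.of_forall hV0) hsub.eventuallyLE) (by positivity)
  have h2 : ψ x' m ≤ K₀ * u ^ N := by
    calc ψ x' m ≤ _ := h1
      _ ≤ (A + 1) ^ (d - 2) * (C * ((A + 1) * m / (ρ / 2)) ^ N * ψ x (ρ / 2)) := by
          gcongr
          exact (hgrow x (ρ / 2) ((A + 1) * m) (by positivity) hm1).1
      _ ≤ (A + 1) ^ (d - 2) * (C * ((A + 1) * (2 * u)) ^ N * C) := by
          have h3 := hupp x (ρ / 2) (by positivity) (show ρ / 2 < ρ by linarith)
          have h4 := hψ0 x (ρ / 2) (by positivity)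
          rw [mul_div_assoc]
          gcongr
      _ = K₀ * u ^ N := by
          rw [Real.mul_rpow (by positivity) (by positivity), Real.mul_rpow (by positivity)
            (by positivity)]
          ring
  have huN : 1 ≤ u ^ N := Real.one_le_rpow hu hN.le
  have h3 := hlow x' m (K₀ * u ^ N) hm (one_le_mul_of_one_le_of_one_le hK₀1 huN) h2
  have hρ' := hpos x'
  have hexp : (C * (K₀ * u ^ N)) ^ (1 / δ) = (C * K₀) ^ (1 / δ) * u ^ (N * (1 / δ)) := by
    rw [← mul_assoc, Real.mul_rpow (by positivity) (by positivity),
      ← Real.rpow_mul (by positivity)]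
  rw [hexp, div_le_iff₀ (by positivity)] at h3
  have h4 : r / criticalRadius V x' ≤ (C * K₀) ^ (1 / δ) * u ^ (N * (1 / δ)) := by
    rw [div_le_iff₀ hρ']
    have : r ≤ m := le_max_left _ _
    linarith
  have h5 : 1 ≤ (C * K₀) ^ (1 / δ) * u ^ (N * (1 / δ)) :=
    one_le_mul_of_one_le_of_one_le (Real.one_le_rpow (by nlinarith) (by positivity))
      (Real.one_le_rpow hu (by positivity))
  linarith

end CriticalRadius

/-! ### Local consequences of the weight condition -/

section Weights

variable {d : ℕ}

theorem isProbabilityMeasure_inv_smul_restrict {S : Set (EuclideanSpace ℝ (Fin d))}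
    (h0 : volume S ≠ 0) (ht : volume S ≠ ∞) :
    IsProbabilityMeasure ((volume S)⁻¹ • volume.restrict S) := by
  constructor
  simp only [Measure.smul_apply, Measure.restrict_apply_univ, smul_eq_mul]
  exact ENNReal.inv_mul_cancel h0 ht

theorem average_rpow_le {S : Set (EuclideanSpace ℝ (Fin d))}
    (h0 : volume S ≠ 0) (ht : volume S ≠ ∞) {p q : ℝ} (hp : 0 < p) (hpq : p ≤ q)
    {h : EuclideanSpace ℝ (Fin d) → ℝ≥0∞} (hm : AEMeasurable h volume) :
    ((volume S)⁻¹ * ∫⁻ x in S, h x ^ p) ^ (1 / p) ≤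
      ((volume S)⁻¹ * ∫⁻ x in S, h x ^ q) ^ (1 / q) := by
  have := isProbabilityMeasure_inv_smul_restrict h0 ht
  have h1 := eLpNorm'_le_eLpNorm'_of_exponent_le hp hpq ((volume S)⁻¹ • volume.restrict S)
    (hm.restrict.smul_measure (volume S)⁻¹).aestronglyMeasurable
  simpa only [eLpNorm', lintegral_smul_measure, smul_eq_mul, enorm_eq_self] using h1

open Classical in
/-- The factor of the local `A_{p,q}` quantity that measures `ω⁻¹`. -/
noncomputable def dualFactor (p : ℝ) (ω : EuclideanSpace ℝ (Fin d) → ℝ)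
    (S : Set (EuclideanSpace ℝ (Fin d))) : ℝ≥0∞ :=
  if p = 1 then (essInf (fun x => ENNReal.ofReal (ω x)) (volume.restrict S))⁻¹
  else ((volume S)⁻¹ * weightPow ω (-(p / (p - 1))) S) ^ (1 / (p / (p - 1)))

theorem apqLocal_eq (p q : ℝ) (ω : EuclideanSpace ℝ (Fin d) → ℝ)
    (S : Set (EuclideanSpace ℝ (Fin d))) :
    apqLocal p q ω S = ((volume S)⁻¹ * weightPow ω q S) ^ (1 / q) * dualFactor p ω S := rfl

/-- Hölder for `g = (g ω) · ω⁻¹` with exponents `p` and `p'`, or the essential supremum of `ω⁻¹`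
when `p = 1`. Positivity of `ω` almost everywhere is what makes this factorization valid in `[0,
∞]`. -/
theorem average_le_mul_dualFactor {S : Set (EuclideanSpace ℝ (Fin d))}
    {p : ℝ} (hp : 1 ≤ p)
    {ω : EuclideanSpace ℝ (Fin d) → ℝ} (hω : AEMeasurable ω volume)
    (hpos : ∀ᵐ x, 0 < ω x) {g : EuclideanSpace ℝ (Fin d) → ℝ≥0∞} (hg : AEMeasurable g volume) :
    (volume S)⁻¹ * ∫⁻ x in S, g x ≤
      ((volume S)⁻¹ * ∫⁻ x in S, g x ^ p * ENNReal.ofReal (ω x) ^ p) ^ (1 / p) *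
        dualFactor p ω S := by
  have hpos' : ∀ᵐ x ∂volume.restrict S, 0 < ω x := ae_restrict_of_ae hpos
  have hgω : AEMeasurable (fun x => g x * ENNReal.ofReal (ω x)) volume := hg.mul hω.ennreal_ofReal
  have hcancel : ∀ x, 0 < ω x →
      g x = g x * ENNReal.ofReal (ω x) * (ENNReal.ofReal (ω x))⁻¹ := by
    intro x hx
    rw [mul_assoc, ENNReal.mul_inv_cancel (by simpa using hx) ENNReal.ofReal_ne_top, mul_one]
  rcases hp.eq_or_lt with rfl | hp1
  · simp only [dualFactor, if_true, ENNReal.rpow_one, div_one, mul_assoc]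
    gcongr
    rw [← lintegral_mul_const'' _ hgω.restrict]
    apply lintegral_mono_ae
    filter_upwards [hpos', ae_essInf_le (f := fun x => ENNReal.ofReal (ω x))
      (μ := volume.restrict S)] with x hx hle
    rw [hcancel x hx]
    gcongr
    rw [← hcancel x hx]
  · have hne : p ≠ 1 := hp1.ne'
    rw [dualFactor, if_neg hne]
    have h := ENNReal.lintegral_mul_le_Lp_mul_Lq ((volume S)⁻¹ • volume.restrict S)
      (Real.HolderConjugate.conjExponent hp1) (hgω.restrict.smul_measure (volume S)⁻¹)
      (hω.ennreal_ofReal.inv.restrict.smul_measure (volume S)⁻¹)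
    simp only [lintegral_smul_measure, smul_eq_mul, Pi.mul_apply, Pi.inv_apply, ENNReal.inv_rpow,
      ← ENNReal.rpow_neg, ENNReal.mul_rpow_of_nonneg _ _ (by linarith : 0 ≤ p)] at h
    refine le_trans ?_ h
    gcongr 1
    apply (lintegral_congr_ae _).le
    filter_upwards [hpos'] with x hx
    exact hcancel x hx

/-- The standing facts on a weight and a set under which the `A_{p,q}` estimates hold. -/
structure WeightGood (q : ℝ) (ω : EuclideanSpace ℝ (Fin d) → ℝ)
    (S : Set (EuclideanSpace ℝ (Fin d))) : Prop where
  aemeasurable : AEMeasurable ω volume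
  pos : ∀ᵐ x, 0 < ω x
  volume_ne_zero : volume S ≠ 0
  volume_ne_top : volume S ≠ ∞
  weight_ne_top : weightPow ω q S ≠ ∞

namespace WeightGood

variable {p q : ℝ} {ω : EuclideanSpace ℝ (Fin d) → ℝ} {S : Set (EuclideanSpace ℝ (Fin d))}

theorem weightPow_ne_zero (h : WeightGood q ω S) (γ : ℝ) : weightPow ω γ S ≠ 0 := by
  intro h0
  rw [weightPow, lintegral_eq_zero_iff' (by
    exact (h.aemeasurable.ennreal_ofReal.pow_const γ).restrict)] at h0
  have hfalse : ∀ᵐ x ∂volume.restrict S, False := by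
    filter_upwards [h0, ae_restrict_of_ae h.pos] with x hx hpos
    exact (ENNReal.rpow_pos (by simpa using hpos) ENNReal.ofReal_ne_top).ne' hx
  rw [ae_iff] at hfalse
  exact h.volume_ne_zero (by simpa using hfalse)

theorem average_rpow_eq (h : WeightGood q ω S) (hq : 0 < q) (X : ℝ≥0∞) :
    ((volume S)⁻¹ * X) ^ (1 / q) =
      ((weightPow ω q S)⁻¹ * X) ^ (1 / q) * ((volume S)⁻¹ * weightPow ω q S) ^ (1 / q) := by
  rw [← ENNReal.mul_rpow_of_nonneg _ _ (by positivity)]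
  congr 1
  calc (volume S)⁻¹ * X = (volume S)⁻¹ * X * ((weightPow ω q S)⁻¹ * weightPow ω q S) := by
        rw [ENNReal.inv_mul_cancel (h.weightPow_ne_zero q) h.weight_ne_top, mul_one]
    _ = _ := by ring

/-- Hölder produces the weighted `L^p` mean of `g`, and Jensen raises `p` to `q`. The factor `(|S|⁻¹
ω^q(S))^{1/q}` gained on renormalizing by `ω^q(S)` completes the dual factor to the local `A_{p,q}`
quantity. -/
theorem average_le (h : WeightGood q ω S) (hp : 1 ≤ p) (hpq : p ≤ q)
    {g : EuclideanSpace ℝ (Fin d) → ℝ≥0∞} (hg : AEMeasurable g volume) :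
    (volume S)⁻¹ * ∫⁻ x in S, g x ≤
      ((weightPow ω q S)⁻¹ * ∫⁻ x in S, g x ^ q * ENNReal.ofReal (ω x) ^ q) ^ (1 / q) *
        apqLocal p q ω S := by
  have hp0 : 0 < p := by linarith
  have hq0 : 0 < q := by linarith
  rw [apqLocal_eq, ← mul_assoc, ← h.average_rpow_eq hq0]
  refine (average_le_mul_dualFactor hp h.aemeasurable h.pos hg).trans ?_
  gcongr
  have := average_rpow_le h.volume_ne_zero h.volume_ne_top hp0 hpq
    (hg.mul h.aemeasurable.ennreal_ofReal)
  simpa only [Pi.mul_apply, ENNReal.mul_rpow_of_nonneg _ _ hp0.le,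
    ENNReal.mul_rpow_of_nonneg _ _ hq0.le] using this

theorem weightPow_average_rpow_le (h : WeightGood q ω S) (hp : 0 < p) (hpq : p ≤ q) :
    ((volume S)⁻¹ * weightPow ω p S) ^ (1 / p) ≤ ((volume S)⁻¹ * weightPow ω q S) ^ (1 / q) :=
  average_rpow_le h.volume_ne_zero h.volume_ne_top hp hpq h.aemeasurable.ennreal_ofReal

theorem weightPow_ne_top (h : WeightGood q ω S) (hp : 0 < p) (hpq : p ≤ q) :
    weightPow ω p S ≠ ∞ := by
  intro htop
  have h1 := h.weightPow_average_rpow_le hp hpq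
  rw [htop, ENNReal.mul_top (ENNReal.inv_ne_zero.2 h.volume_ne_top),
    ENNReal.top_rpow_of_pos (by positivity), top_le_iff] at h1
  exact ENNReal.rpow_ne_top_of_nonneg (by have := hp.trans_le hpq; positivity)
    (ENNReal.mul_ne_top (ENNReal.inv_ne_top.2 h.volume_ne_zero) h.weight_ne_top) h1

theorem rpow_ne_zero_ne_top {a : ℝ≥0∞} (h0 : a ≠ 0) (ht : a ≠ ∞) (x : ℝ) :
    a ^ x ≠ 0 ∧ a ^ x ≠ ∞ :=
  ⟨(ENNReal.rpow_pos (pos_iff_ne_zero.2 h0) ht).ne', by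
    simp [ENNReal.rpow_eq_top_iff, h0, ht]⟩

/-- Hölder tested on `g = 1` says that `|S|^{1/p} / ω^p(S)^{1/p}` is at most the dual factor; the
remaining factors agree on both sides. -/
theorem normalized_le (h : WeightGood q ω S) (hp : 1 ≤ p) (hpq : p ≤ q) (X : ℝ≥0∞) :
    volume S ^ (1 / p - 1 / q) / weightPow ω p S ^ (1 / p) * X ^ (1 / q) ≤
      apqLocal p q ω S * ((weightPow ω q S)⁻¹ * X) ^ (1 / q) := by
  have hp0 : 0 < p := by linarith
  have hq0 : 0 < q := by linarith
  have hcore := average_le_mul_dualFactor (S := S) hp h.aemeasurable h.pos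
    (aemeasurable_const (b := (1 : ℝ≥0∞)))
  simp only [lintegral_one, Measure.restrict_apply_univ, ENNReal.one_rpow, one_mul] at hcore
  rw [ENNReal.inv_mul_cancel h.volume_ne_zero h.volume_ne_top] at hcore
  change 1 ≤ ((volume S)⁻¹ * weightPow ω p S) ^ (1 / p) * dualFactor p ω S at hcore
  rw [apqLocal_eq, mul_comm, mul_right_comm, mul_comm (((volume S)⁻¹ * weightPow ω q S) ^ (1 / q)),
    ← h.average_rpow_eq hq0, ENNReal.rpow_sub _ _ h.volume_ne_zero h.volume_ne_top]
  rw [ENNReal.mul_rpow_of_nonneg _ _ (by positivity), ENNReal.inv_rpow] at hcore ⊢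
  obtain ⟨ha0, hat⟩ := rpow_ne_zero_ne_top h.volume_ne_zero h.volume_ne_top (1 / p)
  obtain ⟨hc0, hct⟩ := rpow_ne_zero_ne_top (h.weightPow_ne_zero p) (h.weightPow_ne_top hp0 hpq)
    (1 / p)
  set a := volume S ^ (1 / p)
  set b := volume S ^ (1 / q)
  set c := weightPow ω p S ^ (1 / p)
  have hac : a / c ≤ dualFactor p ω S := by
    rw [ENNReal.div_le_iff hc0 hct]
    calc a = a * 1 := (mul_one _).symm
      _ ≤ a * (a⁻¹ * c * dualFactor p ω S) := by gcongr
      _ = (a * a⁻¹) * (dualFactor p ω S * c) := by ring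
      _ = _ := by rw [ENNReal.mul_inv_cancel ha0 hat, one_mul]
  calc X ^ (1 / q) * (a / b / c) = b⁻¹ * X ^ (1 / q) * (a / c) := by
        simp only [div_eq_mul_inv]; ring
    _ ≤ _ := by gcongr

/-- This direction is Jensen for `ω` between the exponents `p` and `q`, with no loss of a weight
constant. -/
theorem le_normalized (h : WeightGood q ω S) (hp : 0 < p) (hpq : p ≤ q) (X : ℝ≥0∞) :
    ((weightPow ω q S)⁻¹ * X) ^ (1 / q) ≤
      volume S ^ (1 / p - 1 / q) / weightPow ω p S ^ (1 / p) * X ^ (1 / q) := by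
  have hq0 : 0 < q := by linarith
  have h1 := h.weightPow_average_rpow_le hp hpq
  rw [ENNReal.rpow_sub _ _ h.volume_ne_zero h.volume_ne_top]
  rw [ENNReal.mul_rpow_of_nonneg _ _ (by positivity), ENNReal.inv_rpow] at h1 ⊢
  rw [ENNReal.mul_rpow_of_nonneg _ _ (by positivity : 0 ≤ 1 / q), ENNReal.inv_rpow] at h1
  obtain ⟨ha0, hat⟩ := rpow_ne_zero_ne_top h.volume_ne_zero h.volume_ne_top (1 / p)
  obtain ⟨hc0, hct⟩ := rpow_ne_zero_ne_top (h.weightPow_ne_zero p) (h.weightPow_ne_top hp hpq)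
    (1 / p)
  obtain ⟨he0, het⟩ := rpow_ne_zero_ne_top (h.weightPow_ne_zero q) h.weight_ne_top (1 / q)
  set a := volume S ^ (1 / p)
  set b := volume S ^ (1 / q)
  set c := weightPow ω p S ^ (1 / p)
  set e := weightPow ω q S ^ (1 / q)
  gcongr
  calc e⁻¹ = a * c⁻¹ * e⁻¹ * (a⁻¹ * c) := by
        rw [show a * c⁻¹ * e⁻¹ * (a⁻¹ * c) = (a * a⁻¹) * (c⁻¹ * c) * e⁻¹ by ring,
          ENNReal.mul_inv_cancel ha0 hat, ENNReal.inv_mul_cancel hc0 hct, one_mul, one_mul]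
    _ ≤ a * c⁻¹ * e⁻¹ * (b⁻¹ * e) := by gcongr
    _ = (a / b / c) * (e⁻¹ * e) := by simp only [div_eq_mul_inv]; ring
    _ = _ := by rw [ENNReal.inv_mul_cancel he0 het, mul_one]

/-- An `A_∞`-type property, obtained by testing `average_le` on the indicator of `A`. It supplies
the constant `K` of the John–Nirenberg argument, polynomial in the local `A_{p,q}` quantity. -/
theorem weightPow_le_of_volume_le (h : WeightGood q ω S) (hp : 1 ≤ p) (hpq : p ≤ q)
    {A : Set (EuclideanSpace ℝ (Fin d))} (hA : MeasurableSet A) (hAS : A ⊆ S)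
    (hvol : volume S ≤ 2 * volume A) :
    weightPow ω q S ≤ (2 * apqLocal p q ω S) ^ q * weightPow ω q A := by
  have hq0 : 0 < q := by linarith
  have h1 := h.average_le hp hpq (g := A.indicator 1) (aemeasurable_one.indicator hA)
  have h2 : ∫⁻ x in S, A.indicator 1 x = volume A := by
    rw [lintegral_indicator_one hA, Measure.restrict_apply hA, inter_eq_left.2 hAS]
  have h3 : ∫⁻ x in S, A.indicator 1 x ^ q * ENNReal.ofReal (ω x) ^ q = weightPow ω q A := by
    have : ∀ x, A.indicator (1 : EuclideanSpace ℝ (Fin d) → ℝ≥0∞) x ^ q *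
        ENNReal.ofReal (ω x) ^ q = A.indicator (fun x => ENNReal.ofReal (ω x) ^ q) x := by
      intro x
      by_cases hx : x ∈ A
      · simp [hx]
      · simp [hx, hq0]
    simp only [this]
    rw [lintegral_indicator hA, Measure.restrict_restrict hA, inter_eq_left.2 hAS]
    rfl
  rw [h2, h3] at h1
  have h4 : 1 ≤ 2 * ((volume S)⁻¹ * volume A) := by
    calc 1 = (volume S)⁻¹ * volume S :=
          (ENNReal.inv_mul_cancel h.volume_ne_zero h.volume_ne_top).symm
      _ ≤ (volume S)⁻¹ * (2 * volume A) := by gcongr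
      _ = _ := by ring
  have h5 : 1 ≤ ((weightPow ω q S)⁻¹ * weightPow ω q A) ^ (1 / q) * (2 * apqLocal p q ω S) := by
    calc 1 ≤ _ := h4
      _ ≤ 2 * (((weightPow ω q S)⁻¹ * weightPow ω q A) ^ (1 / q) * apqLocal p q ω S) := by gcongr
      _ = _ := by ring
  have h6 := ENNReal.rpow_le_rpow h5 hq0.le
  rw [ENNReal.one_rpow, ENNReal.mul_rpow_of_nonneg _ _ hq0.le, ← ENNReal.rpow_mul,
    one_div_mul_cancel hq0.ne', ENNReal.rpow_one] at h6
  calc weightPow ω q S = weightPow ω q S * 1 := (mul_one _).symm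
    _ ≤ weightPow ω q S * ((weightPow ω q S)⁻¹ * weightPow ω q A * (2 * apqLocal p q ω S) ^ q) := by
        gcongr
    _ = (weightPow ω q S * (weightPow ω q S)⁻¹) * ((2 * apqLocal p q ω S) ^ q * weightPow ω q A) := by
        ring
    _ = _ := by
        rw [ENNReal.mul_inv_cancel (h.weightPow_ne_zero q) h.weight_ne_top, one_mul]

end WeightGood

theorem weightPow_mono {ω : EuclideanSpace ℝ (Fin d) → ℝ} (γ : ℝ)
    {S T : Set (EuclideanSpace ℝ (Fin d))} (hST : S ⊆ T) : weightPow ω γ S ≤ weightPow ω γ T :=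
  lintegral_mono_set hST

/-- Each averaged factor loses at most `c`, because its outer exponent `1/q` or `1/p'` lies in `[0,
1]`; for `p = 1` the essential infimum is monotone. This transfers the condition from balls to
cubes. -/
theorem apqLocal_mono {p q : ℝ} (hp : 1 ≤ p) (hq : 1 ≤ q) (ω : EuclideanSpace ℝ (Fin d) → ℝ)
    {S T : Set (EuclideanSpace ℝ (Fin d))} (hST : S ⊆ T) {c : ℝ≥0∞} (hc : 1 ≤ c)
    (hct : c ≠ ∞) (hvol : volume T ≤ c * volume S) :
    apqLocal p q ω S ≤ c ^ 2 * apqLocal p q ω T := by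
  have hc0 : c ≠ 0 := (zero_lt_one.trans_le hc).ne'
  have hinv : (volume S)⁻¹ ≤ c * (volume T)⁻¹ := by
    rw [← ENNReal.inv_le_inv, ENNReal.mul_inv (Or.inl hc0) (Or.inl hct), inv_inv, inv_inv,
      ← ENNReal.div_eq_inv_mul]
    exact ENNReal.div_le_of_le_mul' hvol
  have hfac : ∀ e γ : ℝ, 0 ≤ e → e ≤ 1 → ((volume S)⁻¹ * weightPow ω γ S) ^ e ≤
      c * ((volume T)⁻¹ * weightPow ω γ T) ^ e := by
    intro e γ he he1
    calc ((volume S)⁻¹ * weightPow ω γ S) ^ e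
        ≤ (c * (volume T)⁻¹ * weightPow ω γ T) ^ e := by
          gcongr
          exact weightPow_mono γ hST
      _ = c ^ e * ((volume T)⁻¹ * weightPow ω γ T) ^ e := by
          rw [mul_assoc, ENNReal.mul_rpow_of_nonneg _ _ he]
      _ ≤ c ^ (1 : ℝ) * ((volume T)⁻¹ * weightPow ω γ T) ^ e := by
          gcongr
      _ = _ := by rw [ENNReal.rpow_one]
  have hq' : 1 / q ≤ 1 := by rw [div_le_one (by linarith)]; exact hq
  have hdual : dualFactor p ω S ≤ c * dualFactor p ω T := by
    rcases hp.eq_or_lt with rfl | hp1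
    · simp only [dualFactor, if_true]
      calc _ ≤ (essInf (fun x => ENNReal.ofReal (ω x)) (volume.restrict T))⁻¹ := by
            gcongr
            exact essInf_antitone_measure (Measure.restrict_mono hST le_rfl).absolutelyContinuous
        _ ≤ _ := le_mul_of_one_le_left' hc
    · rw [dualFactor, dualFactor, if_neg hp1.ne', if_neg hp1.ne']
      have h1 : 1 / (p / (p - 1)) = (p - 1) / p := by rw [one_div_div]
      apply hfac
      · rw [h1]; exact div_nonneg (by linarith) (by linarith)
      · rw [h1, div_le_one (by linarith)]; linarith
  rw [apqLocal_eq, apqLocal_eq]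
  calc _ ≤ c * ((volume T)⁻¹ * weightPow ω q T) ^ (1 / q) * (c * dualFactor p ω T) :=
        mul_le_mul' (hfac _ _ (by positivity) hq') hdual
    _ = _ := by ring

/-- A real-valued `ω` is finite, so negative powers of it never vanish. This rules out the product
`∞ · 0 = 0` hiding an infinite `ω^q(B)`. -/
theorem dualFactor_ne_zero {p : ℝ} (hp : 1 ≤ p) {ω : EuclideanSpace ℝ (Fin d) → ℝ}
    (hω : AEMeasurable ω volume) {S : Set (EuclideanSpace ℝ (Fin d))}
    (h0 : volume S ≠ 0) (ht : volume S ≠ ∞) : dualFactor p ω S ≠ 0 := by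
  have hne : (ae (volume.restrict S)).NeBot := by
    rw [ae_neBot]; simpa using h0
  rcases hp.eq_or_lt with rfl | hp1
  · simp only [dualFactor, if_true]
    rw [ENNReal.inv_ne_zero]
    intro htop
    obtain ⟨x, hx⟩ := (ae_essInf_le (f := fun x => ENNReal.ofReal (ω x))
      (μ := volume.restrict S)).exists
    rw [htop, top_le_iff] at hx
    exact ENNReal.ofReal_ne_top hx
  · rw [dualFactor, if_neg hp1.ne']
    intro hz
    have hc : 0 < p / (p - 1) := div_pos (by linarith) (by linarith)
    rw [ENNReal.rpow_eq_zero_iff_of_pos (by positivity), mul_eq_zero, ENNReal.inv_eq_zero,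
      weightPow, lintegral_eq_zero_iff' ((hω.ennreal_ofReal.pow_const _).restrict)] at hz
    rcases hz with hz | hz
    · exact ht hz
    · obtain ⟨x, hx⟩ := hz.exists
      simp only [Pi.zero_apply, ENNReal.rpow_eq_zero_iff] at hx
      rcases hx with ⟨_, hx⟩ | ⟨hx, _⟩
      · linarith
      · exact ENNReal.ofReal_ne_top hx

theorem ae_pos_of_dualFactor_ne_top {p : ℝ} (hp : 1 ≤ p) {ω : EuclideanSpace ℝ (Fin d) → ℝ}
    (hω : AEMeasurable ω volume) {S : Set (EuclideanSpace ℝ (Fin d))}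
    (ht : volume S ≠ ∞) (h : dualFactor p ω S ≠ ∞) : ∀ᵐ x ∂volume.restrict S, 0 < ω x := by
  rcases hp.eq_or_lt with rfl | hp1
  · simp only [dualFactor, if_true] at h
    rw [ENNReal.inv_ne_top] at h
    filter_upwards [ae_essInf_le (f := fun x => ENNReal.ofReal (ω x))
      (μ := volume.restrict S)] with x hx
    exact ENNReal.ofReal_pos.1 ((pos_iff_ne_zero.2 h).trans_le hx)
  · rw [dualFactor, if_neg hp1.ne'] at h
    have hc : 0 < p / (p - 1) := div_pos (by linarith) (by linarith)
    have h1 : weightPow ω (-(p / (p - 1))) S ≠ ∞ := by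
      intro htop
      rw [htop, ENNReal.mul_top (ENNReal.inv_ne_zero.2 ht),
        ENNReal.top_rpow_of_pos (by positivity)] at h
      exact h rfl
    filter_upwards [ae_lt_top' ((hω.ennreal_ofReal.pow_const _).restrict) h1] with x hx
    by_contra! hcon
    rw [ENNReal.ofReal_of_nonpos hcon, ENNReal.zero_rpow_of_neg (by linarith)] at hx
    exact hx.ne rfl

/-- By the convention `0 · ∞ = 0`, the condition says nothing on a ball where `ω^q` has no mass. A
nonzero weight has mass on every large enough ball about the origin; there the dual factor must be
finite, which forces `ω > 0` almost everywhere. -/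
theorem MemApqInfty.ae_pos {ρ : EuclideanSpace ℝ (Fin d) → ℝ} {p q : ℝ} (hp : 1 ≤ p) (hq : 0 < q)
    {ω : EuclideanSpace ℝ (Fin d) → ℝ} (h : MemApqInfty ρ p q ω) (hne : ¬ ω =ᵐ[volume] 0) :
    ∀ᵐ x, 0 < ω x := by
  obtain ⟨θ, -, ⟨hω0, hωloc⟩, C, -, hC⟩ := h
  have hωm := hωloc.aestronglyMeasurable.aemeasurable
  have hU : ∀ k : ℕ, ⋃ n : ℕ, ball (0 : EuclideanSpace ℝ (Fin d)) ((n : ℝ) + k + 1) = univ := by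
    intro k
    refine eq_univ_of_forall fun y => mem_iUnion.2 ?_
    obtain ⟨n, hn⟩ := exists_nat_gt (dist y 0)
    exact ⟨n, by rw [mem_ball]; have : (0 : ℝ) ≤ k := k.cast_nonneg; linarith⟩
  obtain ⟨k, hk⟩ : ∃ k : ℕ, weightPow ω q (ball 0 ((k : ℝ) + 1)) ≠ 0 := by
    by_contra! hcon
    apply hne
    have h1 : ∀ n : ℕ, ∀ᵐ y ∂volume.restrict (ball (0 : EuclideanSpace ℝ (Fin d)) (n + (0 : ℕ) + 1)),
        ω y = 0 := by
      intro n
      have h2 := hcon n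
      rw [weightPow, lintegral_eq_zero_iff' ((hωm.ennreal_ofReal.pow_const _).restrict)] at h2
      rw [Nat.cast_zero, add_zero]
      filter_upwards [h2] with x hx
      simp only [Pi.zero_apply, ENNReal.rpow_eq_zero_iff_of_pos hq, ENNReal.ofReal_eq_zero] at hx
      exact le_antisymm hx (hω0 x)
    have h2 := (ae_restrict_iUnion_iff (μ := volume) _ (fun y => ω y = 0)).2 h1
    rwa [hU, Measure.restrict_univ] at h2
  have h1 : ∀ n : ℕ, ∀ᵐ y ∂volume.restrict (ball (0 : EuclideanSpace ℝ (Fin d)) (n + k + 1)),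
      0 < ω y := by
    intro n
    have hr : (0 : ℝ) < n + k + 1 := by positivity
    apply ae_pos_of_dualFactor_ne_top hp hωm measure_ball_lt_top.ne
    intro htop
    have h2 := hC 0 (n + k + 1) hr
    have hw : weightPow ω q (ball 0 ((n : ℝ) + k + 1)) ≠ 0 := by
      intro hz
      apply hk
      rw [← nonpos_iff_eq_zero, ← hz]
      exact weightPow_mono q (ball_subset_ball (by linarith [(n.cast_nonneg : (0 : ℝ) ≤ n)]))
    rw [apqLocal_eq, htop, ENNReal.mul_top, top_le_iff] at h2
    · exact ENNReal.ofReal_ne_top h2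
    · intro hz
      rw [ENNReal.rpow_eq_zero_iff_of_pos (by positivity), mul_eq_zero, ENNReal.inv_eq_zero] at hz
      exact hz.elim measure_ball_lt_top.ne hw
  have h2 := (ae_restrict_iUnion_iff (μ := volume) _ (fun y => 0 < ω y)).2 h1
  rwa [hU, Measure.restrict_univ] at h2

theorem MemApqInfty.weightPow_ball_ne_top {ρ : EuclideanSpace ℝ (Fin d) → ℝ} {p q : ℝ}
    (hp : 1 ≤ p) (hq : 0 < q) {ω : EuclideanSpace ℝ (Fin d) → ℝ} (h : MemApqInfty ρ p q ω)
    (x : EuclideanSpace ℝ (Fin d)) {r : ℝ} (hr : 0 < r) : weightPow ω q (ball x r) ≠ ∞ := by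
  obtain ⟨θ, -, ⟨hω0, hωloc⟩, C, -, hC⟩ := h
  intro htop
  have h2 := hC x r hr
  rw [apqLocal_eq, htop, ENNReal.mul_top (ENNReal.inv_ne_zero.2 measure_ball_lt_top.ne),
    ENNReal.top_rpow_of_pos (by positivity), ENNReal.top_mul (dualFactor_ne_zero hp
      hωloc.aestronglyMeasurable.aemeasurable (measure_ball_pos _ _ hr).ne'
      measure_ball_lt_top.ne), top_le_iff] at h2
  exact ENNReal.ofReal_ne_top h2

theorem MemApqInfty.weightGood_ball {ρ : EuclideanSpace ℝ (Fin d) → ℝ} {p q : ℝ}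
    (hp : 1 ≤ p) (hq : 0 < q) {ω : EuclideanSpace ℝ (Fin d) → ℝ} (h : MemApqInfty ρ p q ω)
    (hne : ¬ ω =ᵐ[volume] 0)
    (x : EuclideanSpace ℝ (Fin d)) {r : ℝ} (hr : 0 < r) : WeightGood q ω (ball x r) where
  aemeasurable := by
    obtain ⟨θ, -, ⟨hω0, hωloc⟩, -⟩ := h
    exact hωloc.aestronglyMeasurable.aemeasurable
  pos := h.ae_pos hp hq hne
  volume_ne_zero := (measure_ball_pos _ _ hr).ne'
  volume_ne_top := measure_ball_lt_top.ne
  weight_ne_top := h.weightPow_ball_ne_top hp hq x hr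

end Weights

/-! ### Dyadic subcubes of a cube, as balls of the supremum norm -/

section Dyadic

variable {d : ℕ}

/-- The center of the dyadic cube with index `n` of generation `k` in the cube with center `c` and
half side length `R`. -/
noncomputable def dyadicCenter (c : Fin d → ℝ) (R : ℝ) (k : ℕ) (n : Fin d → ℤ) : Fin d → ℝ :=
  fun i => c i - R + 2 * R * ((n i : ℝ) + 1 / 2) / 2 ^ k

/-- The index of the dyadic cube of generation `k` containing `x`. -/
noncomputable def dyadicIndex (c : Fin d → ℝ) (R : ℝ) (k : ℕ) (x : Fin d → ℝ) : Fin d → ℤ :=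
  fun i => ⌊2 ^ k * ((x i - (c i - R)) / (2 * R))⌋

/-- The open dyadic cube of generation `k` with index `n`. -/
noncomputable def dyadicCell (c : Fin d → ℝ) (R : ℝ) (k : ℕ) (n : Fin d → ℤ) : Set (Fin d → ℝ) :=
  ball (dyadicCenter c R k n) (R / 2 ^ k)

variable {c : Fin d → ℝ} {R : ℝ}

theorem dyadicIndex_succ_div (k : ℕ) (x : Fin d → ℝ) (i : Fin d) :
    dyadicIndex c R (k + 1) x i / 2 = dyadicIndex c R k x i := by
  have h := Int.floor_div_natCast (2 ^ (k + 1) * ((x i - (c i - R)) / (2 * R))) 2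
  rw [Nat.cast_ofNat, Nat.cast_ofNat] at h
  rw [dyadicIndex, dyadicIndex, ← h]
  congr 1
  ring

theorem dyadicIndex_eq_of_le {j k : ℕ} (hjk : j ≤ k) {x y : Fin d → ℝ}
    (h : dyadicIndex c R k x = dyadicIndex c R k y) : dyadicIndex c R j x = dyadicIndex c R j y := by
  induction k, hjk using Nat.le_induction with
  | base => exact h
  | succ k _ ih =>
    apply ih
    funext i
    rw [← dyadicIndex_succ_div k x, ← dyadicIndex_succ_div k y, h]

theorem dyadicIndex_of_mem_cell (hR : 0 < R) {k : ℕ} {n : Fin d → ℤ} {x : Fin d → ℝ}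
    (hx : x ∈ dyadicCell c R k n) : dyadicIndex c R k x = n := by
  have hk : (0 : ℝ) < 2 ^ k := by positivity
  rw [dyadicCell, mem_ball, dist_pi_lt_iff (by positivity)] at hx
  funext i
  have h := hx i
  simp only [Real.dist_eq, dyadicCenter, abs_lt] at h
  obtain ⟨h1, h2⟩ := h
  have e : 2 ^ k * ((x i - (c i - R)) / (2 * R)) - (n i + 1 / 2) =
      2 ^ k / (2 * R) * (x i - (c i - R + 2 * R * ((n i : ℝ) + 1 / 2) / 2 ^ k)) := by
    field_simp
    ring
  have h3 : -(1 / 2) < 2 ^ k / (2 * R) * (x i - (c i - R + 2 * R * ((n i : ℝ) + 1 / 2) / 2 ^ k)) := by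
    calc -(1 / 2 : ℝ) = 2 ^ k / (2 * R) * -(R / 2 ^ k) := by field_simp
      _ < _ := by gcongr
  have h4 : 2 ^ k / (2 * R) * (x i - (c i - R + 2 * R * ((n i : ℝ) + 1 / 2) / 2 ^ k)) < 1 / 2 := by
    calc _ < 2 ^ k / (2 * R) * (R / 2 ^ k) := by gcongr
      _ = 1 / 2 := by field_simp
  rw [dyadicIndex, Int.floor_eq_iff]
  constructor <;> linarith

theorem mem_closedBall_dyadicCenter (hR : 0 < R) (k : ℕ) (x : Fin d → ℝ) :
    x ∈ closedBall (dyadicCenter c R k (dyadicIndex c R k x)) (R / 2 ^ k) := by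
  have hk : (0 : ℝ) < 2 ^ k := by positivity
  rw [mem_closedBall, dist_pi_le_iff (by positivity)]
  intro i
  simp only [Real.dist_eq, dyadicCenter, abs_le, dyadicIndex]
  set t := 2 ^ k * ((x i - (c i - R)) / (2 * R)) with ht
  have h1 := Int.floor_le t
  have h2 := (Int.lt_floor_add_one t).le
  have e : x i - (c i - R + 2 * R * ((⌊t⌋ : ℝ) + 1 / 2) / 2 ^ k) =
      2 * R / 2 ^ k * (t - ⌊t⌋ - 1 / 2) := by
    rw [ht]
    generalize (⌊2 ^ k * ((x i - (c i - R)) / (2 * R))⌋ : ℝ) = z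
    field_simp
    ring
  rw [e]
  constructor
  · calc -(R / 2 ^ k) = 2 * R / 2 ^ k * (-(1 / 2)) := by field_simp
      _ ≤ _ := by gcongr; linarith
  · calc _ ≤ 2 * R / 2 ^ k * (1 / 2) := by gcongr; linarith
      _ = _ := by field_simp

theorem dyadicCenter_zero : dyadicCenter c R 0 0 = c := by
  funext i
  simp [dyadicCenter]
  ring

theorem dyadicIndex_zero (hR : 0 < R) {x : Fin d → ℝ} (hx : x ∈ ball c R) :
    dyadicIndex c R 0 x = 0 := by
  apply dyadicIndex_of_mem_cell hR
  rwa [dyadicCell, dyadicCenter_zero, pow_zero, div_one]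

theorem dyadicCell_zero_eq (hR : 0 < R) {x : Fin d → ℝ} (hx : x ∈ ball c R) :
    dyadicCell c R 0 (dyadicIndex c R 0 x) = ball c R := by
  rw [dyadicIndex_zero hR hx, dyadicCell, dyadicCenter_zero, pow_zero, div_one]

theorem ball_ae_eq_closedBall_pi (x : Fin d → ℝ) {r : ℝ} (hr : 0 < r) :
    (ball x r : Set (Fin d → ℝ)) =ᵐ[volume] closedBall x r :=
  ae_eq_of_subset_of_measure_ge ball_subset_closedBall
    (by rw [Real.volume_pi_ball _ hr, Real.volume_pi_closedBall _ hr.le])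
    measurableSet_ball.nullMeasurableSet
    measure_closedBall_lt_top.ne

theorem volume_dyadicCell (hR : 0 < R) (k : ℕ) (n : Fin d → ℤ) :
    volume (dyadicCell c R k n) = ENNReal.ofReal ((2 * (R / 2 ^ k)) ^ d) := by
  rw [dyadicCell, Real.volume_pi_ball _ (by positivity), Fintype.card_fin]

theorem volume_dyadicCell_eq_mul_succ (hR : 0 < R) (k : ℕ) (n m : Fin d → ℤ) :
    volume (dyadicCell c R k n) = 2 ^ d * volume (dyadicCell c R (k + 1) m) := by
  rw [volume_dyadicCell hR, volume_dyadicCell hR]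
  have : (2 : ℝ≥0∞) ^ d = ENNReal.ofReal (2 ^ d) := by
    rw [ENNReal.ofReal_pow (by norm_num)]; norm_num
  rw [this, ← ENNReal.ofReal_mul (by positivity), ← mul_pow]
  congr 2
  rw [pow_succ]
  field_simp

theorem lintegral_dyadicCell (hR : 0 < R) (g : (Fin d → ℝ) → ℝ≥0∞) (k : ℕ) (n : Fin d → ℤ) :
    ∫⁻ y in closedBall (dyadicCenter c R k n) (R / 2 ^ k), g y = ∫⁻ y in dyadicCell c R k n, g y :=
  setLIntegral_congr (ball_ae_eq_closedBall_pi _ (by positivity)).symm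

theorem volume_closedBall_dyadicCenter (hR : 0 < R) (k : ℕ) (n : Fin d → ℤ) :
    volume (closedBall (dyadicCenter c R k n) (R / 2 ^ k)) = volume (dyadicCell c R k n) :=
  (measure_congr (ball_ae_eq_closedBall_pi _ (by positivity))).symm

theorem dyadicCell_subset_closedBall (hR : 0 < R) {j k : ℕ} (hjk : j ≤ k) (x : Fin d → ℝ) :
    dyadicCell c R k (dyadicIndex c R k x) ⊆
      closedBall (dyadicCenter c R j (dyadicIndex c R j x)) (R / 2 ^ j) := by
  intro y hy
  have h := dyadicIndex_eq_of_le hjk (dyadicIndex_of_mem_cell hR hy)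
  rw [← h]
  exact mem_closedBall_dyadicCenter hR j y

theorem ae_tendsto_dyadic_average (c : Fin d → ℝ) (hR : 0 < R) {g : (Fin d → ℝ) → ℝ≥0∞}
    (hg : AEMeasurable g volume) (hgt : ∫⁻ y, g y ≠ ∞) :
    ∀ᵐ y, Tendsto (fun k : ℕ => (∫⁻ z in dyadicCell c R k (dyadicIndex c R k y), g z) /
      volume (dyadicCell c R k (dyadicIndex c R k y))) atTop (𝓝 (g y)) := by
  -- In the supremum norm closed dyadic cubes are balls. They contain `y` without being centered at
  -- it, and the parameter 1 of the Vitali family allows this.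
  let v := IsUnifLocDoublingMeasure.vitaliFamily (volume : Measure (Fin d → ℝ)) 1
  filter_upwards [v.ae_tendsto_lintegral_div hg hgt] with y hy
  have hδ : Tendsto (fun k : ℕ => R / 2 ^ k) atTop (𝓝[>] 0) := by
    rw [tendsto_nhdsWithin_iff]
    refine ⟨?_, Eventually.of_forall fun k => by simp only [mem_Ioi]; positivity⟩
    have := (tendsto_pow_atTop_nhds_zero_of_lt_one (r := (1 / 2 : ℝ)) (by norm_num)
      (by norm_num)).const_mul R
    simpa [div_eq_mul_inv] using this
  have hmem : ∀ᶠ k : ℕ in atTop, y ∈ closedBall (dyadicCenter c R k (dyadicIndex c R k y))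
      (1 * (R / 2 ^ k)) := Eventually.of_forall fun k => by
    rw [one_mul]; exact mem_closedBall_dyadicCenter hR k y
  have h1 : Tendsto (fun k : ℕ => closedBall (dyadicCenter c R k (dyadicIndex c R k y)) (R / 2 ^ k))
      atTop (v.filterAt y) :=
    IsUnifLocDoublingMeasure.tendsto_closedBall_filterAt _ _ _ hδ hmem
  refine (hy.comp h1).congr fun k => ?_
  rw [Function.comp_apply, lintegral_dyadicCell hR, volume_closedBall_dyadicCenter hR]

/-- The Calderón–Zygmund decomposition of a cube at height `l`, for the supremum norm. -/
theorem calderon_zygmund_pi (c : Fin d → ℝ) (hR : 0 < R) {g : (Fin d → ℝ) → ℝ≥0∞}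
    (hg : AEMeasurable g volume) (hgt : ∫⁻ y in ball c R, g y ≠ ∞) {l : ℝ≥0∞}
    (hl : ∫⁻ y in ball c R, g y ≤ l * volume (ball c R)) :
    ∃ 𝒮 : Set ((Fin d → ℝ) × ℝ), 𝒮.Countable ∧ (∀ Q ∈ 𝒮, 0 < Q.2) ∧
      (∀ Q ∈ 𝒮, ball Q.1 Q.2 ⊆ ball c R) ∧
      𝒮.PairwiseDisjoint (fun Q => ball Q.1 Q.2) ∧
      (∀ Q ∈ 𝒮, l * volume (ball Q.1 Q.2) ≤ ∫⁻ y in ball Q.1 Q.2, g y) ∧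
      (∀ Q ∈ 𝒮, ∫⁻ y in ball Q.1 Q.2, g y ≤ 2 ^ d * l * volume (ball Q.1 Q.2)) ∧
      ∀ᵐ y, y ∈ ball c R → y ∉ ⋃ Q ∈ 𝒮, ball Q.1 Q.2 → g y ≤ l := by
  let P : ℕ → (Fin d → ℤ) → Prop := fun k n =>
    l * volume (dyadicCell c R k n) < ∫⁻ y in dyadicCell c R k n, g y
  -- Stopping cubes: the mean of `g` exceeds `l` and does so on no proper dyadic ancestor. Ancestors
  -- are read off from the index of a point, which also handles points on cell boundaries.
  let I : Set (ℕ × (Fin d → ℤ)) := {kn | P kn.1 kn.2 ∧ ∃ x ∈ ball c R, dyadicIndex c R kn.1 x = kn.2 ∧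
    ∀ j < kn.1, ¬ P j (dyadicIndex c R j x)}
  let Φ : ℕ × (Fin d → ℤ) → (Fin d → ℝ) × ℝ := fun kn => (dyadicCenter c R kn.1 kn.2, R / 2 ^ kn.1)
  have hP0 : ∀ x ∈ ball c R, ¬ P 0 (dyadicIndex c R 0 x) := by
    intro x hx
    simp only [P, dyadicCell_zero_eq hR hx, not_lt]
    exact hl
  have hdisj : ∀ kn ∈ I, ∀ kn' ∈ I, kn ≠ kn' →
      Disjoint (dyadicCell c R kn.1 kn.2) (dyadicCell c R kn'.1 kn'.2) := by
    have main : ∀ kn ∈ I, ∀ kn' ∈ I, kn.1 ≤ kn'.1 → kn ≠ kn' →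
        Disjoint (dyadicCell c R kn.1 kn.2) (dyadicCell c R kn'.1 kn'.2) := by
      rintro ⟨k, n⟩ ⟨hP, -⟩ ⟨k', n'⟩ ⟨-, x', -, hx', hj⟩ hle hne
      rw [Set.disjoint_left]
      intro y hy hy'
      have h1 := dyadicIndex_of_mem_cell hR hy
      have h2 := dyadicIndex_of_mem_cell hR hy'
      dsimp only at *
      rcases hle.eq_or_lt with rfl | hlt
      · exact hne (by rw [← h1, ← h2])
      · refine hj k hlt ?_
        rw [dyadicIndex_eq_of_le hle (hx'.trans h2.symm), h1]
        exact hP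
    intro kn hkn kn' hkn' hne
    rcases le_total kn.1 kn'.1 with h | h
    · exact main kn hkn kn' hkn' h hne
    · exact (main kn' hkn' kn hkn h hne.symm).symm
  refine ⟨Φ '' I, (Set.to_countable I).image Φ, ?_, ?_, ?_, ?_, ?_, ?_⟩
  · rintro _ ⟨kn, -, rfl⟩
    simp only [Φ]; positivity
  · rintro _ ⟨⟨k, n⟩, ⟨-, x, hx, hxn, -⟩, rfl⟩
    have h := dyadicCell_subset_closedBall hR (Nat.zero_le k) x (c := c)
    dsimp only at hxn
    rw [hxn] at h
    rw [dyadicIndex_zero hR hx, dyadicCenter_zero, pow_zero, div_one] at h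
    -- Nesting is known only up to closure; openness of the cell removes the boundary.
    have h2 := interior_maximal h isOpen_ball
    rwa [interior_closedBall _ hR.ne'] at h2
  · rintro _ ⟨kn, hkn, rfl⟩ _ ⟨kn', hkn', rfl⟩ hne
    exact hdisj kn hkn kn' hkn' (fun h => hne (by rw [h]))
  · rintro _ ⟨kn, ⟨hP, -⟩, rfl⟩
    exact hP.le
  · rintro _ ⟨⟨k, n⟩, ⟨hP, x, hx, hxn, hj⟩, rfl⟩
    dsimp only at hP hxn hj
    rcases k with _ | k
    · exact absurd hP (hxn ▸ hP0 x hx)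
    · have h1 := hj k (Nat.lt_succ_self k)
      simp only [P, not_lt] at h1
      have hsub := dyadicCell_subset_closedBall hR (Nat.le_succ k) x (c := c)
      rw [Nat.succ_eq_add_one, hxn] at hsub
      change ∫⁻ y in dyadicCell c R (k + 1) n, g y ≤ 2 ^ d * l * volume (dyadicCell c R (k + 1) n)
      calc _ ≤ _ := lintegral_mono_set hsub
        _ = _ := lintegral_dyadicCell hR g _ _
        _ ≤ _ := h1
        _ = _ := by rw [volume_dyadicCell_eq_mul_succ hR k _ n]; ring
  · have hgm : AEMeasurable ((ball c R).indicator g) volume := hg.indicator measurableSet_ball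
    have hgi : ∫⁻ y, (ball c R).indicator g y ≠ ∞ := by
      rwa [lintegral_indicator measurableSet_ball]
    -- Countably many cell boundaries form a null set, so almost every point lies in its open cell
    -- at all generations. Off the selected cubes all these cells have mean at most `l`, and
    -- differentiation gives `g y ≤ l`.
    have hbdry : ∀ᵐ y : Fin d → ℝ, ∀ (k : ℕ) (n : Fin d → ℤ),
        y ∈ closedBall (dyadicCenter c R k n) (R / 2 ^ k) → y ∈ dyadicCell c R k n := by
      rw [ae_all_iff]; intro k
      rw [ae_all_iff]; intro n
      exact (ball_ae_eq_closedBall_pi (dyadicCenter c R k n) (by positivity)).symm.le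
    filter_upwards [ae_tendsto_dyadic_average c hR hgm hgi,
      hbdry] with y hy hyb hyQ hyS
    have hmem : ∀ k, y ∈ dyadicCell c R k (dyadicIndex c R k y) := fun k =>
      hyb k _ (mem_closedBall_dyadicCenter hR k y)
    have hnP : ∀ k, ¬ P k (dyadicIndex c R k y) := by
      intro k
      induction k using Nat.strong_induction_on with
      | _ k ih =>
        intro hP
        have hI : (k, dyadicIndex c R k y) ∈ I := ⟨hP, y, hyQ, rfl, ih⟩
        exact hyS (mem_iUnion₂.2 ⟨_, mem_image_of_mem Φ hI, hmem k⟩)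
    have hlim := hy
    rw [indicator_of_mem hyQ] at hlim
    refine le_of_tendsto hlim (Eventually.of_forall fun k => ?_)
    apply ENNReal.div_le_of_le_mul
    calc _ ≤ ∫⁻ z in dyadicCell c R k (dyadicIndex c R k y), g z := by
          gcongr
          exact indicator_le_self _ _ _
      _ ≤ _ := not_lt.1 (hnP k)

end Dyadic

/-! ### Transfer of the decomposition from the supremum norm to Euclidean space -/

section Cubes

variable {d : ℕ}

theorem cube_eq_preimage (x : EuclideanSpace ℝ (Fin d)) {r : ℝ} (hr : 0 < r) :
    cube x r = WithLp.ofLp ⁻¹' ball (WithLp.ofLp x) (r / 2) := by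
  ext y
  rw [mem_preimage, mem_ball, dist_pi_lt_iff (by positivity)]
  rfl

theorem measurableSet_cube (x : EuclideanSpace ℝ (Fin d)) (r : ℝ) : MeasurableSet (cube x r) := by
  have : cube x r = ⋂ i, {y | |y i - x i| < r / 2} := by ext; simp [cube]
  rw [this]
  refine MeasurableSet.iInter fun i => measurableSet_lt ?_ measurable_const
  fun_prop

theorem setLIntegral_cube (g : EuclideanSpace ℝ (Fin d) → ℝ≥0∞) (x : EuclideanSpace ℝ (Fin d))
    {r : ℝ} (hr : 0 < r) :
    ∫⁻ y in cube x r, g y = ∫⁻ z in ball (WithLp.ofLp x) (r / 2), g (WithLp.toLp 2 z) := by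
  rw [cube_eq_preimage x hr]
  exact (PiLp.volume_preserving_ofLp (Fin d)).setLIntegral_comp_preimage_emb
    (MeasurableEquiv.toLp 2 (Fin d → ℝ)).symm.measurableEmbedding
    (fun z => g (WithLp.toLp 2 z)) _

theorem volume_cube_eq_ball (x : EuclideanSpace ℝ (Fin d)) {r : ℝ} (hr : 0 < r) :
    volume (cube x r) = volume (ball (WithLp.ofLp x) (r / 2)) := by
  rw [cube_eq_preimage x hr]
  exact (PiLp.volume_preserving_ofLp (Fin d)).measure_preimage measurableSet_ball.nullMeasurableSet

theorem volume_cube (x : EuclideanSpace ℝ (Fin d)) {r : ℝ} (hr : 0 < r) :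
    volume (cube x r) = ENNReal.ofReal (r ^ d) := by
  rw [volume_cube_eq_ball x hr, Real.volume_pi_ball _ (by positivity), Fintype.card_fin]
  congr 2
  ring

theorem volume_cube_ne_zero (x : EuclideanSpace ℝ (Fin d)) {r : ℝ} (hr : 0 < r) :
    volume (cube x r) ≠ 0 := by
  rw [volume_cube x hr]
  exact (ENNReal.ofReal_pos.2 (by positivity)).ne'

theorem volume_cube_ne_top (x : EuclideanSpace ℝ (Fin d)) {r : ℝ} (hr : 0 < r) :
    volume (cube x r) ≠ ∞ := by
  rw [volume_cube x hr]
  exact ENNReal.ofReal_ne_top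

theorem calderon_zygmund (x₀ : EuclideanSpace ℝ (Fin d)) {r : ℝ} (hr : 0 < r)
    {g : EuclideanSpace ℝ (Fin d) → ℝ≥0∞} (hg : AEMeasurable g volume)
    (hgt : ∫⁻ y in cube x₀ r, g y ≠ ∞) {l : ℝ≥0∞}
    (hl : ∫⁻ y in cube x₀ r, g y ≤ l * volume (cube x₀ r)) :
    ∃ 𝒮 : Set (EuclideanSpace ℝ (Fin d) × ℝ), 𝒮.Countable ∧ (∀ Q ∈ 𝒮, 0 < Q.2) ∧
      (∀ Q ∈ 𝒮, cube Q.1 Q.2 ⊆ cube x₀ r) ∧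
      𝒮.PairwiseDisjoint (fun Q => cube Q.1 Q.2) ∧
      (∀ Q ∈ 𝒮, l * volume (cube Q.1 Q.2) ≤ ∫⁻ y in cube Q.1 Q.2, g y) ∧
      (∀ Q ∈ 𝒮, ∫⁻ y in cube Q.1 Q.2, g y ≤ 2 ^ d * l * volume (cube Q.1 Q.2)) ∧
      ∀ᵐ y, y ∈ cube x₀ r → y ∉ ⋃ Q ∈ 𝒮, cube Q.1 Q.2 → g y ≤ l := by
  rw [setLIntegral_cube g x₀ hr] at hgt hl
  rw [volume_cube_eq_ball x₀ hr] at hl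
  have hgm : AEMeasurable (fun z : Fin d → ℝ => g (WithLp.toLp 2 z)) volume :=
    hg.comp_quasiMeasurePreserving (PiLp.volume_preserving_toLp (Fin d)).quasiMeasurePreserving
  obtain ⟨𝒮, h1, h2, h3, h4, h5, h6, h7⟩ :=
    calderon_zygmund_pi (WithLp.ofLp x₀) (half_pos hr) hgm hgt hl
  -- Supremum-norm balls carry a radius, cubes a side length.
  let Φ : (Fin d → ℝ) × ℝ → EuclideanSpace ℝ (Fin d) × ℝ := fun Q => (WithLp.toLp 2 Q.1, 2 * Q.2)
  have hΦ : ∀ Q ∈ 𝒮, cube (Φ Q).1 (Φ Q).2 =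
      (WithLp.ofLp ⁻¹' ball Q.1 Q.2 : Set (EuclideanSpace ℝ (Fin d))) := by
    intro Q hQ
    have := h2 Q hQ
    rw [cube_eq_preimage _ (by simp only [Φ]; positivity)]
    simp [Φ]
  have hr2 : ∀ Q ∈ 𝒮, 0 < (Φ Q).2 := fun Q hQ => by have := h2 Q hQ; simp only [Φ]; positivity
  have hv : ∀ Q ∈ 𝒮, volume (cube (Φ Q).1 (Φ Q).2) = volume (ball Q.1 Q.2) := by
    intro Q hQ
    rw [volume_cube_eq_ball _ (hr2 Q hQ)]
    simp [Φ]
  have hi : ∀ Q ∈ 𝒮, ∫⁻ y in cube (Φ Q).1 (Φ Q).2, g y =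
      ∫⁻ z in ball Q.1 Q.2, g (WithLp.toLp 2 z) := by
    intro Q hQ
    rw [setLIntegral_cube g _ (hr2 Q hQ)]
    simp [Φ]
  refine ⟨Φ '' 𝒮, h1.image Φ, ?_, ?_, ?_, ?_, ?_, ?_⟩
  · rintro _ ⟨Q, hQ, rfl⟩
    exact hr2 Q hQ
  · rintro _ ⟨Q, hQ, rfl⟩
    rw [hΦ Q hQ, cube_eq_preimage x₀ hr]
    exact preimage_mono (h3 Q hQ)
  · rintro _ ⟨Q, hQ, rfl⟩ _ ⟨Q', hQ', rfl⟩ hne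
    simp only [Function.onFun]
    rw [hΦ Q hQ, hΦ Q' hQ']
    exact (h4 hQ hQ' (fun h => hne (by rw [h]))).preimage _
  · rintro _ ⟨Q, hQ, rfl⟩
    rw [hv Q hQ, hi Q hQ]
    exact h5 Q hQ
  · rintro _ ⟨Q, hQ, rfl⟩
    rw [hv Q hQ, hi Q hQ]
    exact h6 Q hQ
  · have h8 := (PiLp.volume_preserving_ofLp (Fin d)).quasiMeasurePreserving.ae h7
    filter_upwards [h8] with y hy hyQ hyS
    refine hy (by rwa [cube_eq_preimage x₀ hr] at hyQ) fun hmem => hyS ?_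
    obtain ⟨Q, hQ, hmem⟩ := mem_iUnion₂.1 hmem
    exact mem_iUnion₂.2 ⟨Φ Q, mem_image_of_mem Φ hQ, by rw [hΦ Q hQ]; exact hmem⟩

end Cubes

/-! ### Elementary properties of the lower oscillation -/

section LowerOsc

variable {d : ℕ} {f : EuclideanSpace ℝ (Fin d) → ℝ}

theorem aemeasurable_lowerOsc (hf : AEMeasurable f volume) (S : Set (EuclideanSpace ℝ (Fin d))) :
    AEMeasurable (lowerOsc f S) volume := by
  have hmono : Monotone fun t : ℝ =>
      ((t : EReal) - essInf (fun y => (f y : EReal)) (volume.restrict S)).toENNReal := by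
    intro a b hab
    exact EReal.toENNReal_le_toENNReal (EReal.sub_le_sub (by exact_mod_cast hab) le_rfl)
  exact hmono.measurable.comp_aemeasurable hf

theorem lowerOsc_mono {S T : Set (EuclideanSpace ℝ (Fin d))} (hST : S ⊆ T)
    (x : EuclideanSpace ℝ (Fin d)) : lowerOsc f S x ≤ lowerOsc f T x :=
  EReal.toENNReal_le_toENNReal (EReal.sub_le_sub le_rfl
    (essInf_antitone_measure (Measure.restrict_mono hST le_rfl).absolutelyContinuous))

theorem essInf_coe_ne_top {S : Set (EuclideanSpace ℝ (Fin d))} (hS : volume S ≠ 0) :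
    essInf (fun y => (f y : EReal)) (volume.restrict S) ≠ ⊤ := by
  have hne : (ae (volume.restrict S)).NeBot := by
    rw [ae_neBot]; simpa using hS
  intro htop
  obtain ⟨x, hx⟩ := (ae_essInf_le (f := fun x => (f x : EReal)) (μ := volume.restrict S)).exists
  rw [htop, top_le_iff] at hx
  exact EReal.coe_ne_top _ hx

theorem lowerOsc_of_essInf_eq_coe {S : Set (EuclideanSpace ℝ (Fin d))} {a : ℝ}
    (h : essInf (fun y => (f y : EReal)) (volume.restrict S) = a) (x : EuclideanSpace ℝ (Fin d)) :
    lowerOsc f S x = ENNReal.ofReal (f x - a) := by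
  rw [lowerOsc, h, ← EReal.coe_sub, EReal.toENNReal_of_ne_top (EReal.coe_ne_top _), EReal.toReal_coe]

theorem lowerOsc_of_essInf_eq_bot {S : Set (EuclideanSpace ℝ (Fin d))}
    (h : essInf (fun y => (f y : EReal)) (volume.restrict S) = ⊥) (x : EuclideanSpace ℝ (Fin d)) :
    lowerOsc f S x = ∞ := by
  rw [lowerOsc, h, EReal.sub_bot (EReal.coe_ne_bot _), EReal.toENNReal_top]

/-- Passing from a set `Q` to a set `S`, the lower oscillation drops by at most its mean. -/
theorem lowerOsc_le_average_add (Q : Set (EuclideanSpace ℝ (Fin d)))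
    {S : Set (EuclideanSpace ℝ (Fin d))} (h0 : volume S ≠ 0) (ht : volume S ≠ ∞)
    (x : EuclideanSpace ℝ (Fin d)) :
    lowerOsc f Q x ≤ (volume S)⁻¹ * (∫⁻ y in S, lowerOsc f Q y) + lowerOsc f S x := by
  have hconst : ∀ c : ℝ≥0∞, (volume S)⁻¹ * ∫⁻ _ in S, c = c := by
    intro c
    rw [setLIntegral_const, mul_comm c, ← mul_assoc, ENNReal.inv_mul_cancel h0 ht, one_mul]
  have hS := essInf_coe_ne_top (f := f) h0
  induction hb : essInf (fun y => (f y : EReal)) (volume.restrict S) with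
  | top => exact absurd hb hS
  | bot => rw [lowerOsc_of_essInf_eq_bot hb]; simp
  | coe b =>
    induction ha : essInf (fun y => (f y : EReal)) (volume.restrict Q) with
    | top =>
      have : lowerOsc f Q x = 0 := by
        rw [lowerOsc, ha, EReal.sub_top, EReal.toENNReal_bot]
      rw [this]
      exact zero_le
    | bot =>
      simp only [lowerOsc_of_essInf_eq_bot ha]
      rw [hconst, top_add]
    | coe a =>
      simp only [lowerOsc_of_essInf_eq_coe ha, lowerOsc_of_essInf_eq_coe hb]
      -- On `S` one has `f ≥ b` almost everywhere, so the gap between the two infima is at most the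
      -- mean of `f - a` over `S`.
      have h1 : ENNReal.ofReal (b - a) ≤ (volume S)⁻¹ * ∫⁻ y in S, ENNReal.ofReal (f y - a) := by
        rw [← hconst (ENNReal.ofReal (b - a))]
        gcongr 1
        apply lintegral_mono_ae
        filter_upwards [ae_essInf_le (f := fun x => (f x : EReal)) (μ := volume.restrict S)] with y hy
        rw [hb, EReal.coe_le_coe_iff] at hy
        gcongr
      calc ENNReal.ofReal (f x - a) = ENNReal.ofReal ((b - a) + (f x - b)) := by ring_nf
        _ ≤ ENNReal.ofReal (b - a) + ENNReal.ofReal (f x - b) := ENNReal.ofReal_add_le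
        _ ≤ _ := by gcongr

/-- A finite integral over a set of positive measure excludes the essential infimum `-∞`, and `f` is
then an integrable nonnegative function plus a constant. Local integrability thus follows from the
oscillation bounds. -/
theorem integrableOn_of_lintegral_lowerOsc_ne_top (hf : AEMeasurable f volume)
    {S : Set (EuclideanSpace ℝ (Fin d))} (h0 : volume S ≠ 0) (ht : volume S ≠ ∞)
    (h : ∫⁻ y in S, lowerOsc f S y ≠ ∞) : IntegrableOn f S volume := by
  have hS := essInf_coe_ne_top (f := f) h0
  induction hb : essInf (fun y => (f y : EReal)) (volume.restrict S) with
  | top => exact absurd hb hS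
  | bot =>
    simp only [lowerOsc_of_essInf_eq_bot hb] at h
    rw [setLIntegral_const, ENNReal.top_mul h0] at h
    exact absurd rfl h
  | coe b =>
    simp only [lowerOsc_of_essInf_eq_coe hb] at h
    have h1 : IntegrableOn (fun y => f y - b) S volume := by
      refine ⟨(hf.sub_const b).aestronglyMeasurable.restrict, ?_⟩
      rw [hasFiniteIntegral_iff_ofReal]
      · exact lt_top_iff_ne_top.2 h
      · filter_upwards [ae_essInf_le (f := fun x => (f x : EReal)) (μ := volume.restrict S)] with y hy
        rw [hb, EReal.coe_le_coe_iff] at hy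
        simpa using hy
    have h2 : IntegrableOn (fun _ => b) S volume := integrableOn_const ht
    exact Integrable.congr (h1.add h2) (ae_of_all _ fun y => by simp)

end LowerOsc

/-! ### Weighted John–Nirenberg inequality -/

section JohnNirenberg

variable {d : ℕ} {f : EuclideanSpace ℝ (Fin d) → ℝ}

/-- Chebyshev: the disjoint bad cubes carry mean at least `2L` while the mean over `Q` is at most
`L`, so they fill at most half of `Q`. -/
theorem volume_le_two_mul_volume_sdiff {g : EuclideanSpace ℝ (Fin d) → ℝ≥0∞}
    {Q : Set (EuclideanSpace ℝ (Fin d))} (hQt : volume Q ≠ ∞) {L : ℝ≥0∞} (hL0 : L ≠ 0) (hLt : L ≠ ∞)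
    (hL : ∫⁻ y in Q, g y ≤ L * volume Q)
    {𝒮 : Set (EuclideanSpace ℝ (Fin d) × ℝ)} (hc : 𝒮.Countable)
    (hsub : ∀ P ∈ 𝒮, cube P.1 P.2 ⊆ Q) (hd : 𝒮.PairwiseDisjoint (fun P => cube P.1 P.2))
    (hlow : ∀ P ∈ 𝒮, 2 * L * volume (cube P.1 P.2) ≤ ∫⁻ y in cube P.1 P.2, g y) :
    volume Q ≤ 2 * volume (Q \ ⋃ P ∈ 𝒮, cube P.1 P.2) := by
  set U := ⋃ P ∈ 𝒮, cube P.1 P.2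
  have hUm : MeasurableSet U := MeasurableSet.biUnion hc fun P _ => measurableSet_cube _ _
  have hUQ : U ⊆ Q := iUnion₂_subset hsub
  have h1 : 2 * L * volume U ≤ L * volume Q := by
    calc 2 * L * volume U = ∑' P : 𝒮, 2 * L * volume (cube P.1.1 P.1.2) := by
          rw [measure_biUnion hc hd fun P _ => measurableSet_cube _ _, ENNReal.tsum_mul_left]
      _ ≤ ∑' P : 𝒮, ∫⁻ y in cube P.1.1 P.1.2, g y := ENNReal.tsum_le_tsum fun P => hlow P.1 P.2
      _ = ∫⁻ y in U, g y := (lintegral_biUnion hc (fun P _ => measurableSet_cube _ _) hd g).symm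
      _ ≤ ∫⁻ y in Q, g y := lintegral_mono_set hUQ
      _ ≤ _ := hL
  have h2 : 2 * volume U ≤ volume Q := by
    rw [mul_comm 2 L, mul_assoc] at h1
    exact (ENNReal.mul_le_mul_iff_right hL0 hLt).1 h1
  have hUt : volume U ≠ ∞ := ne_top_of_le_ne_top hQt (measure_mono hUQ)
  have h3 : volume Q = volume (Q \ U) + volume U := by
    rw [← measure_sdiff_add_inter (μ := volume) (s := Q) hUm, inter_eq_right.2 hUQ]
  have h4 : volume Q + volume Q ≤ 2 * volume (Q \ U) + volume Q := by
    calc volume Q + volume Q = 2 * volume (Q \ U) + 2 * volume U := by rw [← two_mul, ← mul_add, ← h3]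
      _ ≤ _ := by gcongr
  exact (ENNReal.add_le_add_iff_right hQt).1 h4

/-- One step of the John–Nirenberg iteration: `a` bounds the truncated weighted means of the lower
oscillation on the subcubes of `Q`. -/
theorem lintegral_min_lowerOsc_step (hf : AEMeasurable f volume)
    {m : Measure (EuclideanSpace ℝ (Fin d))} (hm : m ≪ volume) {x : EuclideanSpace ℝ (Fin d)} {r : ℝ}
    (hr : 0 < r) (hmt : m (cube x r) ≠ ∞) {q K L : ℝ} (hq : 1 ≤ q) (hK : 1 ≤ K) (hL : 0 < L)
    (hmK : ∀ A, MeasurableSet A → A ⊆ cube x r → volume (cube x r) ≤ 2 * volume A →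
      m (cube x r) ≤ ENNReal.ofReal K * m A)
    (hosc : ∫⁻ y in cube x r, lowerOsc f (cube x r) y ≤ ENNReal.ofReal L * volume (cube x r))
    {M a : ℝ≥0∞}
    (ha : ∀ x' r', 0 < r' → cube x' r' ⊆ cube x r →
      ∫⁻ y in cube x' r', min (lowerOsc f (cube x' r') y) M ^ q ∂m ≤ a ^ q * m (cube x' r')) :
    (∫⁻ y in cube x r, min (lowerOsc f (cube x r) y) M ^ q ∂m) ^ (1 / q) ≤
      (ENNReal.ofReal (2 ^ (d + 1) * L) + a * ENNReal.ofReal (1 - 1 / (q * K))) *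
        m (cube x r) ^ (1 / q) := by
  have hq0 : 0 < q := by linarith
  set Q := cube x r
  set g := lowerOsc f Q with hg
  have hgm : AEMeasurable g volume := aemeasurable_lowerOsc hf Q
  have hQt := volume_cube_ne_top x hr
  have hL0 : ENNReal.ofReal L ≠ 0 := (ENNReal.ofReal_pos.2 hL).ne'
  have hgt : ∫⁻ y in Q, g y ≠ ∞ :=
    ne_top_of_le_ne_top (ENNReal.mul_ne_top ENNReal.ofReal_ne_top hQt) hosc
  -- The height is twice the mean bound, so that at least half of `Q` stays outside the selected
  -- cubes.
  obtain ⟨𝒮, hc, hpos, hsub, hdisj, hlow, hupp, hout⟩ := calderon_zygmund x hr hgm hgt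
    (l := 2 * ENNReal.ofReal L) (hosc.trans (by
      gcongr; exact le_mul_of_one_le_left' (by norm_num)))
  have hvol := volume_le_two_mul_volume_sdiff hQt hL0 ENNReal.ofReal_ne_top hosc hc hsub hdisj hlow
  set U := ⋃ P ∈ 𝒮, cube P.1 P.2 with hU
  have hUm : MeasurableSet U := MeasurableSet.biUnion hc fun P _ => measurableSet_cube _ _
  have hUQ : U ⊆ Q := iUnion₂_subset hsub
  have hQm : MeasurableSet Q := measurableSet_cube x r
  set Λ : ℝ≥0∞ := ENNReal.ofReal (2 ^ (d + 1) * L) with hΛ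
  have hΛ2 : Λ = 2 ^ d * (2 * ENNReal.ofReal L) := by
    rw [hΛ, ENNReal.ofReal_mul (by positivity), ENNReal.ofReal_pow (by norm_num)]
    norm_num
    ring
  have hΛ1 : 2 * ENNReal.ofReal L ≤ Λ := by
    rw [hΛ2]
    exact le_mul_of_one_le_left' (one_le_pow₀ (by norm_num))
  -- the weighted measure of the bad set
  have hmU : m U ≤ ENNReal.ofReal (1 - 1 / K) * m Q := by
    have hUt : m U ≠ ∞ := ne_top_of_le_ne_top hmt (measure_mono hUQ)
    have hDt : m (Q \ U) ≠ ∞ := ne_top_of_le_ne_top hmt (measure_mono sdiff_subset)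
    have h1 := hmK (Q \ U) (hQm.diff hUm) sdiff_subset hvol
    have h2 : m Q = m (Q \ U) + m U := by
      rw [← measure_sdiff_add_inter (μ := m) (s := Q) hUm, inter_eq_right.2 hUQ]
    have h3 := ENNReal.toReal_mono (ENNReal.mul_ne_top ENNReal.ofReal_ne_top hDt) h1
    rw [ENNReal.toReal_mul, ENNReal.toReal_ofReal (by linarith)] at h3
    have h4 := congrArg ENNReal.toReal h2
    rw [ENNReal.toReal_add hDt hUt] at h4
    have hK1 : 1 / K ≤ 1 := by rw [div_le_one (by linarith)]; exact hK
    rw [← ENNReal.toReal_le_toReal hUt (ENNReal.mul_ne_top ENNReal.ofReal_ne_top hmt),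
      ENNReal.toReal_mul, ENNReal.toReal_ofReal (by linarith)]
    have h5 : 1 / K * (m Q).toReal ≤ (m (Q \ U)).toReal := by
      rw [one_div, inv_mul_le_iff₀ (by linarith)]; exact h3
    linarith
  -- The excess over `Λ`. It can be restricted to the bad set, since elsewhere `g ≤ 2L ≤ Λ`.
  set G : EuclideanSpace ℝ (Fin d) → ℝ≥0∞ := U.indicator fun y => min (g y) M - Λ with hG
  have hGm : AEMeasurable G m :=
    (((hgm.mono_ac hm).min aemeasurable_const).sub_const Λ).indicator hUm
  have hle : ∀ᵐ y ∂m.restrict Q, min (g y) M ≤ Λ + G y := by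
    rw [ae_restrict_iff' hQm]
    filter_upwards [hm.ae_le hout] with y hy hyQ
    by_cases hyU : y ∈ U
    · rw [hG, indicator_of_mem hyU]
      exact le_add_tsub
    · exact (min_le_left _ _).trans ((hy hyQ hyU).trans (hΛ1.trans le_self_add))
  -- On a bad cube `P` the mean of `g` is at most `2 ^ d * 2L = Λ`. By `lowerOsc_le_average_add`,
  -- the excess is then at most the lower oscillation relative to `P` itself, to which the bound `a`
  -- applies.
  have hGP : ∀ P ∈ 𝒮, ∀ y ∈ cube P.1 P.2, G y ≤ min (lowerOsc f (cube P.1 P.2) y) M := by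
    intro P hP y hy
    have hyU : y ∈ U := mem_iUnion₂.2 ⟨P, hP, hy⟩
    have h0 := volume_cube_ne_zero P.1 (hpos P hP)
    have ht := volume_cube_ne_top P.1 (hpos P hP)
    rw [hG, indicator_of_mem hyU, tsub_le_iff_left, ← min_add_add_left]
    refine le_min ((min_le_left _ _).trans ?_) ((min_le_right _ _).trans le_add_self)
    refine (lowerOsc_le_average_add Q h0 ht y).trans ?_
    gcongr
    rw [hΛ2, ← ENNReal.div_eq_inv_mul]
    exact ENNReal.div_le_of_le_mul (hupp P hP)
  have hGint : ∫⁻ y in Q, G y ^ q ∂m ≤ a ^ q * m U := by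
    have h1 : ∀ y, G y ^ q = U.indicator (fun y => G y ^ q) y := by
      intro y
      by_cases hyU : y ∈ U
      · rw [indicator_of_mem hyU]
      · rw [indicator_of_notMem hyU, hG, indicator_of_notMem hyU, ENNReal.zero_rpow_of_pos hq0]
    calc ∫⁻ y in Q, G y ^ q ∂m = ∫⁻ y in Q, U.indicator (fun y => G y ^ q) y ∂m :=
          lintegral_congr fun y => h1 y
      _ ≤ ∫⁻ y, U.indicator (fun y => G y ^ q) y ∂m := setLIntegral_le_lintegral _ _
      _ = ∫⁻ y in U, G y ^ q ∂m := lintegral_indicator hUm _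
      _ = ∑' P : 𝒮, ∫⁻ y in cube P.1.1 P.1.2, G y ^ q ∂m :=
          lintegral_biUnion hc (fun P _ => measurableSet_cube _ _) hdisj _
      _ ≤ ∑' P : 𝒮, a ^ q * m (cube P.1.1 P.1.2) := by
          refine ENNReal.tsum_le_tsum fun P => ?_
          refine le_trans ?_ (ha P.1.1 P.1.2 (hpos P.1 P.2) (hsub P.1 P.2))
          refine setLIntegral_mono' (measurableSet_cube _ _) fun y hy => ?_
          gcongr
          exact hGP P.1 P.2 y hy
      _ = a ^ q * m U := by
          rw [ENNReal.tsum_mul_left, hU, measure_biUnion hc hdisj fun P _ => measurableSet_cube _ _]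
  -- Bernoulli's inequality; it makes the absorbed constant linear in `q * K`.
  have hτ : ENNReal.ofReal (1 - 1 / K) ^ (1 / q) ≤ ENNReal.ofReal (1 - 1 / (q * K)) := by
    have hK1 : 1 / K ≤ 1 := by rw [div_le_one (by linarith)]; exact hK
    rw [ENNReal.ofReal_rpow_of_nonneg (by linarith) (by positivity)]
    apply ENNReal.ofReal_le_ofReal
    have h := rpow_one_add_le_one_add_mul_self (s := -(1 / K)) (by linarith) (p := 1 / q)
      (by positivity) (by rw [div_le_one hq0]; exact hq)
    calc (1 - 1 / K) ^ (1 / q) = (1 + -(1 / K)) ^ (1 / q) := by rw [sub_eq_add_neg]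
      _ ≤ _ := h
      _ = _ := by field_simp; ring
  calc (∫⁻ y in Q, min (g y) M ^ q ∂m) ^ (1 / q)
      ≤ (∫⁻ y in Q, (Λ + G y) ^ q ∂m) ^ (1 / q) := by
        gcongr 1
        refine lintegral_mono_ae ?_
        filter_upwards [hle] with y hy
        gcongr
    _ ≤ (∫⁻ y in Q, Λ ^ q ∂m) ^ (1 / q) + (∫⁻ y in Q, G y ^ q ∂m) ^ (1 / q) :=
        ENNReal.lintegral_Lp_add_le aemeasurable_const hGm.restrict hq
    _ ≤ Λ * m Q ^ (1 / q) + (a ^ q * (ENNReal.ofReal (1 - 1 / K) * m Q)) ^ (1 / q) := by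
        gcongr ?_ + ?_
        · rw [setLIntegral_const, ENNReal.mul_rpow_of_nonneg _ _ (by positivity),
            ← ENNReal.rpow_mul, mul_one_div_cancel hq0.ne', ENNReal.rpow_one]
        · gcongr 1
          exact hGint.trans (by gcongr)
    _ = Λ * m Q ^ (1 / q) + a * ENNReal.ofReal (1 - 1 / K) ^ (1 / q) * m Q ^ (1 / q) := by
        rw [ENNReal.mul_rpow_of_nonneg _ _ (by positivity),
          ENNReal.mul_rpow_of_nonneg _ _ (by positivity), ← ENNReal.rpow_mul,
          mul_one_div_cancel hq0.ne', ENNReal.rpow_one]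
        ring
    _ ≤ Λ * m Q ^ (1 / q) + a * ENNReal.ofReal (1 - 1 / (q * K)) * m Q ^ (1 / q) := by gcongr
    _ = _ := by ring

/-- A weighted John–Nirenberg inequality for the lower oscillation. -/
theorem lintegral_lowerOsc_rpow_le (hf : AEMeasurable f volume)
    {m : Measure (EuclideanSpace ℝ (Fin d))} (hm : m ≪ volume) {x₀ : EuclideanSpace ℝ (Fin d)}
    {r₀ : ℝ} (hr₀ : 0 < r₀) (hmt : m (cube x₀ r₀) ≠ ∞) {q K L : ℝ} (hq : 1 ≤ q) (hK : 1 ≤ K)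
    (hL : 0 < L)
    (hmK : ∀ x r, 0 < r → cube x r ⊆ cube x₀ r₀ → ∀ A, MeasurableSet A → A ⊆ cube x r →
      volume (cube x r) ≤ 2 * volume A → m (cube x r) ≤ ENNReal.ofReal K * m A)
    (hosc : ∀ x r, 0 < r → cube x r ⊆ cube x₀ r₀ →
      ∫⁻ y in cube x r, lowerOsc f (cube x r) y ≤ ENNReal.ofReal L * volume (cube x r)) :
    ∫⁻ y in cube x₀ r₀, lowerOsc f (cube x₀ r₀) y ^ q ∂m ≤
      ENNReal.ofReal (2 ^ (d + 1) * L * (q * K)) ^ q * m (cube x₀ r₀) := by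
  have hq0 : 0 < q := by linarith
  have hqK : 0 < q * K := by positivity
  have hqK1 : 1 ≤ q * K := one_le_mul_of_one_le_of_one_le hq hK
  -- Truncation at `M` makes the supremum `a` of the weighted `L^q` means finite, so that `a ≤ Λ + a
  -- * (1 - 1 / (q * K))` can be solved for `a`. The result does not depend on `M`.
  have trunc : ∀ M : ℕ, ∫⁻ y in cube x₀ r₀, min (lowerOsc f (cube x₀ r₀) y) M ^ q ∂m ≤
      ENNReal.ofReal (2 ^ (d + 1) * L * (q * K)) ^ q * m (cube x₀ r₀) := by
    intro M
    let F : EuclideanSpace ℝ (Fin d) → ℝ → ℝ≥0∞ := fun x r =>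
      ((m (cube x r))⁻¹ * ∫⁻ y in cube x r, min (lowerOsc f (cube x r) y) (M : ℝ≥0∞) ^ q ∂m) ^ (1 / q)
    let a : ℝ≥0∞ := ⨆ (x : EuclideanSpace ℝ (Fin d)) (r : ℝ) (_ : 0 < r)
      (_ : cube x r ⊆ cube x₀ r₀), F x r
    have hmt' : ∀ x r, cube x r ⊆ cube x₀ r₀ → m (cube x r) ≠ ∞ := fun x r h =>
      ne_top_of_le_ne_top hmt (measure_mono h)
    have hF : ∀ x r, cube x r ⊆ cube x₀ r₀ →
        ∫⁻ y in cube x r, min (lowerOsc f (cube x r) y) (M : ℝ≥0∞) ^ q ∂m =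
          F x r ^ q * m (cube x r) := by
      intro x r h
      by_cases h0 : m (cube x r) = 0
      · rw [h0, mul_zero, setLIntegral_measure_zero _ _ h0]
      · simp only [F]
        rw [← ENNReal.rpow_mul, one_div_mul_cancel hq0.ne', ENNReal.rpow_one, mul_right_comm,
          ENNReal.inv_mul_cancel h0 (hmt' x r h), one_mul]
    have ha : ∀ x r, 0 < r → cube x r ⊆ cube x₀ r₀ →
        ∫⁻ y in cube x r, min (lowerOsc f (cube x r) y) (M : ℝ≥0∞) ^ q ∂m ≤
          a ^ q * m (cube x r) := by
      intro x r hr h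
      rw [hF x r h]
      gcongr
      exact le_iSup₂_of_le x r (le_iSup₂_of_le hr h le_rfl)
    have haM : a ≤ M := by
      refine iSup₂_le fun x r => iSup₂_le fun hr h => ?_
      have h1 : (m (cube x r))⁻¹ * ∫⁻ y in cube x r, min (lowerOsc f (cube x r) y) (M : ℝ≥0∞) ^ q ∂m ≤
          (M : ℝ≥0∞) ^ q := by
        calc _ ≤ (m (cube x r))⁻¹ * ∫⁻ _ in cube x r, (M : ℝ≥0∞) ^ q ∂m := by
              gcongr; exact min_le_right _ _
          _ = (M : ℝ≥0∞) ^ q * ((m (cube x r))⁻¹ * m (cube x r)) := by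
              rw [setLIntegral_const]; ring
          _ ≤ (M : ℝ≥0∞) ^ q * 1 := by gcongr; exact ENNReal.inv_mul_le_one _
          _ = _ := mul_one _
      calc F x r ≤ ((M : ℝ≥0∞) ^ q) ^ (1 / q) := by simp only [F]; gcongr
        _ = M := by rw [← ENNReal.rpow_mul, mul_one_div_cancel hq0.ne', ENNReal.rpow_one]
    have hat : a ≠ ∞ := ne_top_of_le_ne_top (ENNReal.natCast_ne_top M) haM
    have hstep : a ≤ ENNReal.ofReal (2 ^ (d + 1) * L) + a * ENNReal.ofReal (1 - 1 / (q * K)) := by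
      refine iSup₂_le fun x r => iSup₂_le fun hr h => ?_
      have h1 := lintegral_min_lowerOsc_step hf hm hr (hmt' x r h) hq hK hL (hmK x r hr h)
        (hosc x r hr h) (M := M) (a := a) fun x' r' hr' h' => ha x' r' hr' (h'.trans h)
      simp only [F]
      rw [ENNReal.mul_rpow_of_nonneg _ _ (by positivity), ENNReal.inv_rpow]
      calc _ ≤ (m (cube x r) ^ (1 / q))⁻¹ * ((ENNReal.ofReal (2 ^ (d + 1) * L) +
              a * ENNReal.ofReal (1 - 1 / (q * K))) * m (cube x r) ^ (1 / q)) := by gcongr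
        _ = (ENNReal.ofReal (2 ^ (d + 1) * L) + a * ENNReal.ofReal (1 - 1 / (q * K))) *
              ((m (cube x r) ^ (1 / q))⁻¹ * m (cube x r) ^ (1 / q)) := by ring
        _ ≤ _ * 1 := by gcongr; exact ENNReal.inv_mul_le_one _
        _ = _ := mul_one _
    have hafin : a ≤ ENNReal.ofReal (2 ^ (d + 1) * L * (q * K)) := by
      have hle1 : 1 / (q * K) ≤ 1 := by rw [div_le_one hqK]; exact hqK1
      have h1 := ENNReal.toReal_mono (ENNReal.add_ne_top.2 ⟨ENNReal.ofReal_ne_top,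
        ENNReal.mul_ne_top hat ENNReal.ofReal_ne_top⟩) hstep
      rw [ENNReal.toReal_add ENNReal.ofReal_ne_top (ENNReal.mul_ne_top hat ENNReal.ofReal_ne_top),
        ENNReal.toReal_mul, ENNReal.toReal_ofReal (by positivity),
        ENNReal.toReal_ofReal (by linarith)] at h1
      rw [← ENNReal.ofReal_toReal hat]
      apply ENNReal.ofReal_le_ofReal
      rw [← div_le_iff₀ hqK, div_eq_mul_one_div]
      linarith
    calc _ ≤ a ^ q * m (cube x₀ r₀) := ha x₀ r₀ hr₀ subset_rfl
      _ ≤ _ := by gcongr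
  have hlim : Tendsto (fun M : ℕ => ∫⁻ y in cube x₀ r₀,
      min (lowerOsc f (cube x₀ r₀) y) (M : ℝ≥0∞) ^ q ∂m) atTop
      (𝓝 (∫⁻ y in cube x₀ r₀, lowerOsc f (cube x₀ r₀) y ^ q ∂m)) := by
    apply lintegral_tendsto_of_tendsto_of_monotone
    · intro M
      exact ((((aemeasurable_lowerOsc hf _).mono_ac hm).min aemeasurable_const).pow_const q).restrict
    · refine ae_of_all _ fun y i j hij => ?_
      dsimp only
      gcongr
    · refine ae_of_all _ fun y => ?_
      have h1 : Tendsto (fun M : ℕ => min (lowerOsc f (cube x₀ r₀) y) (M : ℝ≥0∞)) atTop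
          (𝓝 (min (lowerOsc f (cube x₀ r₀) y) ∞)) :=
        tendsto_const_nhds.min ENNReal.tendsto_nat_nhds_top
      rw [min_top_right] at h1
      exact (ENNReal.continuous_rpow_const.tendsto _).comp h1
  exact le_of_tendsto' hlim trunc

end JohnNirenberg

/-! ### Pointwise bounds for the lower oscillation when `β > 0` -/

section Campanato

variable {d : ℕ} {f : EuclideanSpace ℝ (Fin d) → ℝ}

theorem lowerOsc_le_enorm_sub_add {S : Set (EuclideanSpace ℝ (Fin d))} (h0 : volume S ≠ 0)
    (x y : EuclideanSpace ℝ (Fin d)) :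
    lowerOsc f S x ≤ ‖f y - f x‖ₑ + lowerOsc f S y := by
  have hS := essInf_coe_ne_top (f := f) h0
  induction hb : essInf (fun y => (f y : EReal)) (volume.restrict S) with
  | top => exact absurd hb hS
  | bot => rw [lowerOsc_of_essInf_eq_bot hb y, add_top]; exact le_top
  | coe b =>
    rw [lowerOsc_of_essInf_eq_coe hb, lowerOsc_of_essInf_eq_coe hb]
    calc ENNReal.ofReal (f x - b) ≤ ENNReal.ofReal (|f y - f x| + (f y - b)) := by
          apply ENNReal.ofReal_le_ofReal
          linarith [neg_abs_le (f y - f x)]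
      _ ≤ ENNReal.ofReal |f y - f x| + ENNReal.ofReal (f y - b) := ENNReal.ofReal_add_le
      _ = _ := by rw [← Real.enorm_eq_ofReal_abs]

/-- This closes the telescoping sum over shrinking balls: at a Lebesgue point the first term tends
to zero, and the second does so when the means are summable. -/
theorem lowerOsc_le_average_enorm_sub_add (hf : AEMeasurable f volume)
    {S : Set (EuclideanSpace ℝ (Fin d))} (h0 : volume S ≠ 0) (ht : volume S ≠ ∞)
    (x : EuclideanSpace ℝ (Fin d)) :
    lowerOsc f S x ≤ (∫⁻ y in S, ‖f y - f x‖ₑ) / volume S +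
      (volume S)⁻¹ * ∫⁻ y in S, lowerOsc f S y := by
  have h1 : lowerOsc f S x * volume S ≤
      (∫⁻ y in S, ‖f y - f x‖ₑ) + ∫⁻ y in S, lowerOsc f S y := by
    rw [← lintegral_add_left' (hf.sub_const _).enorm.restrict, ← setLIntegral_const]
    exact lintegral_mono fun y => lowerOsc_le_enorm_sub_add h0 x y
  rw [ENNReal.div_eq_inv_mul, ← mul_add]
  calc lowerOsc f S x = (volume S)⁻¹ * (lowerOsc f S x * volume S) := by
        rw [mul_comm (lowerOsc f S x), ← mul_assoc, ENNReal.inv_mul_cancel h0 ht, one_mul]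
    _ ≤ _ := by gcongr

theorem volume_ball_two_mul [NeZero d] (x : EuclideanSpace ℝ (Fin d)) {r : ℝ} (hr : 0 < r) :
    volume (ball x (2 * r)) = 2 ^ d * volume (ball x r) := by
  rw [Measure.addHaar_ball _ _ (by positivity : 0 ≤ 2 * r), Measure.addHaar_ball _ _ hr.le,
    finrank_euclideanSpace, Fintype.card_fin, mul_pow, ENNReal.ofReal_mul (by positivity),
    ENNReal.ofReal_pow (by norm_num : (0 : ℝ) ≤ 2), mul_assoc]
  norm_num

theorem ae_tendsto_ball_average_enorm_sub [NeZero d] (hf : LocallyIntegrable f volume) :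
    ∀ᵐ x, ∀ R : ℝ, 0 < R → Tendsto (fun n : ℕ => (∫⁻ y in ball x (R / 2 ^ n), ‖f y - f x‖ₑ) /
      volume (ball x (R / 2 ^ n))) atTop (𝓝 0) := by
  let v := IsUnifLocDoublingMeasure.vitaliFamily (volume : Measure (EuclideanSpace ℝ (Fin d))) 1
  filter_upwards [v.ae_tendsto_lintegral_enorm_sub_div hf] with x hx R hR
  have hδ : Tendsto (fun k : ℕ => R / 2 ^ k) atTop (𝓝[>] 0) := by
    rw [tendsto_nhdsWithin_iff]
    refine ⟨?_, Eventually.of_forall fun k => by simp only [mem_Ioi]; positivity⟩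
    have := (tendsto_pow_atTop_nhds_zero_of_lt_one (r := (1 / 2 : ℝ)) (by norm_num)
      (by norm_num)).const_mul R
    simpa [div_eq_mul_inv] using this
  have h1 : Tendsto (fun k : ℕ => closedBall x (R / 2 ^ k)) atTop (v.filterAt x) :=
    IsUnifLocDoublingMeasure.tendsto_closedBall_filterAt _ _ _ hδ
      (Eventually.of_forall fun k => mem_closedBall_self (by positivity))
  refine (hx.comp h1).congr fun k => ?_
  have hae : (ball x (R / 2 ^ k) : Set (EuclideanSpace ℝ (Fin d))) =ᵐ[volume]
      closedBall x (R / 2 ^ k) :=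
    ae_eq_of_subset_of_measure_ge ball_subset_closedBall
      (Measure.addHaar_closedBall_eq_addHaar_ball volume x _).le
      measurableSet_ball.nullMeasurableSet measure_closedBall_lt_top.ne
  rw [Function.comp_apply, setLIntegral_congr hae, measure_congr hae]

/-- At a Lebesgue point, the lower oscillation over a ball is controlled by the sum of its means
over the concentric dyadic shrinkings of the ball. -/
theorem ae_lowerOsc_le_tsum [NeZero d] (hf : LocallyIntegrable f volume) :
    ∀ᵐ x, ∀ R : ℝ, 0 < R → lowerOsc f (ball x R) x ≤ 2 ^ d * ∑' k : ℕ,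
      (volume (ball x (R / 2 ^ k)))⁻¹ *
        ∫⁻ y in ball x (R / 2 ^ k), lowerOsc f (ball x (R / 2 ^ k)) y := by
  filter_upwards [ae_tendsto_ball_average_enorm_sub hf] with x hx R hR
  set B : ℕ → Set (EuclideanSpace ℝ (Fin d)) := fun k => ball x (R / 2 ^ k) with hB
  set e : ℕ → ℝ≥0∞ := fun k => (volume (B k))⁻¹ * ∫⁻ y in B k, lowerOsc f (B k) y with he
  have h0 : ∀ k, volume (B k) ≠ 0 := fun k => (measure_ball_pos _ _ (by positivity)).ne'
  have ht : ∀ k, volume (B k) ≠ ∞ := fun k => measure_ball_lt_top.ne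
  have hvol : ∀ k, volume (B k) = 2 ^ d * volume (B (k + 1)) := by
    intro k
    simp only [hB]
    rw [← volume_ball_two_mul x (by positivity)]
    congr 2
    rw [pow_succ]
    field_simp
  have hsub : ∀ k, B (k + 1) ⊆ B k := by
    intro k
    apply ball_subset_ball
    exact div_le_div_of_nonneg_left hR.le (by positivity)
      (pow_le_pow_right₀ (by norm_num) (Nat.le_succ k))
  -- The next ball carries the proportion `2 ^ (-d)` of the volume, so the mean over it of the
  -- oscillation relative to `B k` is at most `2 ^ d * e k`.
  have hstep : ∀ k, lowerOsc f (B k) x ≤ 2 ^ d * e k + lowerOsc f (B (k + 1)) x := by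
    intro k
    refine (lowerOsc_le_average_add (B k) (h0 (k + 1)) (ht (k + 1)) x).trans ?_
    refine add_le_add ?_ le_rfl
    change _ ≤ 2 ^ d * ((volume (B k))⁻¹ * ∫⁻ y in B k, lowerOsc f (B k) y)
    rw [hvol k, ENNReal.mul_inv (Or.inl (by simp)) (Or.inl (by simp)), ← mul_assoc, ← mul_assoc,
      ENNReal.mul_inv_cancel (by simp) (by simp), one_mul]
    gcongr
    exact hsub k
  have hiter : ∀ n, lowerOsc f (B 0) x ≤ 2 ^ d * ∑ k ∈ Finset.range n, e k + lowerOsc f (B n) x := by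
    intro n
    induction n with
    | zero => simp
    | succ n ih =>
      refine ih.trans ?_
      rw [Finset.sum_range_succ, mul_add, add_assoc]
      gcongr
      exact hstep n
  have hB0 : B 0 = ball x R := by simp [hB]
  rw [← hB0]
  by_cases hsum : ∑' k, e k = ∞
  · rw [hsum, ENNReal.mul_top (by simp)]
    exact le_top
  have hlim : Tendsto (fun n => 2 ^ d * ∑' k, e k +
      ((∫⁻ y in B n, ‖f y - f x‖ₑ) / volume (B n) + e n)) atTop (𝓝 (2 ^ d * ∑' k, e k + (0 + 0))) :=
    tendsto_const_nhds.add ((hx R hR).add (ENNReal.tendsto_atTop_zero_of_tsum_ne_top hsum))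
  rw [add_zero, add_zero] at hlim
  refine ge_of_tendsto' hlim fun n => (hiter n).trans ?_
  gcongr
  · exact ENNReal.sum_le_tsum _
  · exact lowerOsc_le_average_enorm_sub_add hf.aestronglyMeasurable.aemeasurable (h0 n) (ht n) x

theorem volume_ball_rpow [NeZero d] (x : EuclideanSpace ℝ (Fin d)) {r β : ℝ} (hr : 0 < r)
    (hβ : 0 ≤ β) :
    volume (ball x r) ^ (β / d) =
      ENNReal.ofReal r ^ β * volume (ball (0 : EuclideanSpace ℝ (Fin d)) 1) ^ (β / d) := by
  have hd : (d : ℝ) ≠ 0 := Nat.cast_ne_zero.2 (NeZero.ne d)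
  rw [Measure.addHaar_ball _ _ hr.le, ENNReal.mul_rpow_of_nonneg _ _ (by positivity),
    finrank_euclideanSpace, Fintype.card_fin, ENNReal.ofReal_pow hr.le, ← ENNReal.rpow_natCast,
    ← ENNReal.rpow_mul, mul_div_cancel₀ _ hd]

/-- A bound of the mean lower oscillation by a positive power of the radius on small balls
is a pointwise bound. -/
theorem ae_lowerOsc_le_of_average_le [NeZero d] (hf : LocallyIntegrable f volume) {β : ℝ}
    (hβ : 0 < β) :
    ∃ C : ℝ, 0 < C ∧ ∀ᵐ x, ∀ (r : ℝ) (H : ℝ≥0∞), 0 < r →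
      (∀ t, 0 < t → t ≤ 2 * r →
        (volume (ball x t))⁻¹ * ∫⁻ y in ball x t, lowerOsc f (ball x t) y ≤
          volume (ball x t) ^ (β / d) * H) →
      lowerOsc f (ball x (2 * r)) x ≤ ENNReal.ofReal C * volume (ball x r) ^ (β / d) * H := by
  set τ : ℝ := (2 ^ β)⁻¹
  have h2β : 1 < (2 : ℝ) ^ β := Real.one_lt_rpow (by norm_num) hβ
  have hτ0 : 0 < τ := by positivity
  have hτ1 : τ < 1 := inv_lt_one_of_one_lt₀ h2β
  -- The factor `2 ^ d` is the telescoping loss, `2 ^ β` comes from starting at radius `2 * r`, and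
  -- `(1 - τ)⁻¹` sums the geometric series of ratio `2 ^ (-β)`.
  refine ⟨2 ^ d * 2 ^ β * (1 - τ)⁻¹, by have := sub_pos.2 hτ1; positivity, ?_⟩
  filter_upwards [ae_lowerOsc_le_tsum hf] with x hx r H hr hH
  refine (hx (2 * r) (by positivity)).trans ?_
  have hk : ∀ k : ℕ, volume (ball x (2 * r / 2 ^ k)) ^ (β / d) =
      ENNReal.ofReal (2 ^ β) * volume (ball x r) ^ (β / d) * ENNReal.ofReal τ ^ k := by
    intro k
    rw [volume_ball_rpow x (by positivity) hβ.le, volume_ball_rpow x hr hβ.le,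
      ← ENNReal.ofReal_pow hτ0.le, ENNReal.ofReal_rpow_of_pos (by positivity),
      ENNReal.ofReal_rpow_of_pos hr, ← mul_assoc, mul_right_comm,
      ← ENNReal.ofReal_mul (by positivity), ← ENNReal.ofReal_mul (by positivity)]
    congr 2
    rw [Real.div_rpow (by positivity) (by positivity), Real.mul_rpow (by norm_num) hr.le,
      div_eq_mul_inv]
    congr 1
    simp only [τ]
    rw [inv_pow, ← Real.rpow_natCast, ← Real.rpow_natCast, ← Real.rpow_mul (by norm_num),
      ← Real.rpow_mul (by norm_num), mul_comm]
  calc _ ≤ 2 ^ d * ∑' k : ℕ,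
        ENNReal.ofReal (2 ^ β) * volume (ball x r) ^ (β / d) * H * ENNReal.ofReal τ ^ k := by
        refine mul_le_mul' le_rfl (ENNReal.tsum_le_tsum fun k => ?_)
        refine (hH (2 * r / 2 ^ k) (by positivity) (div_le_self (by positivity)
          (one_le_pow₀ (by norm_num)))).trans ?_
        rw [hk, mul_right_comm]
    _ = _ := by
        rw [ENNReal.tsum_mul_left, ENNReal.tsum_geometric, ENNReal.ofReal_mul (by positivity),
          ENNReal.ofReal_mul (by positivity), ENNReal.ofReal_inv_of_pos (sub_pos.2 hτ1),
          ENNReal.ofReal_sub _ hτ0.le, ENNReal.ofReal_one, ENNReal.ofReal_pow (by norm_num)]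
        norm_num
        ring

end Campanato

/-! ### Calculus of polynomially bounded quantities -/

section PolyBounded

variable {d : ℕ} {ρ : EuclideanSpace ℝ (Fin d) → ℝ} {κ : ℝ≥0∞}
  {Φ Ψ : EuclideanSpace ℝ (Fin d) → ℝ → ℝ≥0∞}

theorem one_le_one_add_div (hρ : ∀ x, 0 < ρ x) (x : EuclideanSpace ℝ (Fin d)) {r : ℝ} (hr : 0 < r) :
    1 ≤ 1 + r / ρ x := by
  have := div_pos hr (hρ x)
  linarith

theorem PolyBounded.exists_real (hρ : ∀ x, 0 < ρ x) (h : PolyBounded ρ 1 Φ) :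
    ∃ C N : ℝ, 1 ≤ C ∧ 0 < N ∧ ∀ x r, 0 < r → Φ x r ≤ ENNReal.ofReal (C * (1 + r / ρ x) ^ N) := by
  obtain ⟨C, hC, N, hN, h⟩ := h
  refine ⟨max C 1, N, le_max_right _ _, hN, fun x r hr => (h x r hr).trans ?_⟩
  rw [mul_one, ← ENNReal.ofReal_mul hC.le]
  have := one_le_one_add_div hρ x hr
  gcongr
  exact le_max_left _ _

theorem PolyBounded.of_real {C N : ℝ} (hC : 0 < C) (hN : 0 < N)
    (h : ∀ x r, 0 < r → Φ x r ≤ ENNReal.ofReal (C * (1 + r / ρ x) ^ N)) : PolyBounded ρ 1 Φ :=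
  ⟨C, hC, N, hN, fun x r hr => by rw [mul_one, ← ENNReal.ofReal_mul hC.le]; exact h x r hr⟩

theorem polyBounded_iff_one (h0 : κ ≠ 0) (ht : κ ≠ ∞) :
    PolyBounded ρ κ Φ ↔ PolyBounded ρ 1 Φ := by
  have hκ : 0 < κ.toReal := ENNReal.toReal_pos h0 ht
  constructor
  · rintro ⟨C, hC, N, hN, h⟩
    refine ⟨C * κ.toReal, by positivity, N, hN, fun x r hr => ?_⟩
    rw [ENNReal.ofReal_mul hC.le, ENNReal.ofReal_toReal ht, mul_one]
    exact h x r hr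
  · rintro ⟨C, hC, N, hN, h⟩
    refine ⟨C / κ.toReal, by positivity, N, hN, fun x r hr => ?_⟩
    rw [ENNReal.ofReal_div_of_pos hκ, ENNReal.ofReal_toReal ht, ENNReal.div_mul_cancel h0 ht]
    simpa using h x r hr

theorem PolyBounded.mono (h : PolyBounded ρ 1 Ψ) (hle : ∀ x r, 0 < r → Φ x r ≤ Ψ x r) :
    PolyBounded ρ 1 Φ := by
  obtain ⟨C, hC, N, hN, h⟩ := h
  exact ⟨C, hC, N, hN, fun x r hr => (hle x r hr).trans (h x r hr)⟩

theorem polyBounded_congr (h : ∀ x r, 0 < r → Φ x r = Ψ x r) :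
    PolyBounded ρ 1 Φ ↔ PolyBounded ρ 1 Ψ :=
  ⟨fun H => H.mono fun x r hr => (h x r hr).ge, fun H => H.mono fun x r hr => (h x r hr).le⟩

theorem PolyBounded.mul (hρ : ∀ x, 0 < ρ x) (h : PolyBounded ρ 1 Φ) (h' : PolyBounded ρ 1 Ψ) :
    PolyBounded ρ 1 fun x r => Φ x r * Ψ x r := by
  obtain ⟨C, N, hC, hN, h⟩ := h.exists_real hρ
  obtain ⟨C', N', hC', hN', h'⟩ := h'.exists_real hρ
  refine PolyBounded.of_real (C := C * C') (N := N + N') (by positivity) (by positivity)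
    fun x r hr => (mul_le_mul' (h x r hr) (h' x r hr)).trans ?_
  have := one_le_one_add_div hρ x hr
  rw [← ENNReal.ofReal_mul (by positivity), Real.rpow_add (by linarith)]
  apply le_of_eq
  congr 1
  ring

/-- The critical radius function is positive and `1 + r / ρ` changes at most polynomially between
points at distance comparable with `r`. -/
def SlowlyVarying (ρ : EuclideanSpace ℝ (Fin d) → ℝ) : Prop :=
  (∀ x, 0 < ρ x) ∧
    ∀ A : ℝ, 0 ≤ A → ∃ C N : ℝ, 1 ≤ C ∧ 0 < N ∧
      ∀ (x x' : EuclideanSpace ℝ (Fin d)) (r : ℝ), 0 < r → dist x' x ≤ A * r →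
        1 + r / ρ x' ≤ C * (1 + r / ρ x) ^ N

/-- Freezes the constant: at every center within `A * r` and every radius up to `B * r`, the bound
is governed by `1 + r / ρ x` alone. This lets arguments inside a fixed cube or ball use fixed
constants. -/
theorem PolyBounded.uniform (hρ : SlowlyVarying ρ) (h : PolyBounded ρ 1 Φ) {A B : ℝ} (hA : 0 ≤ A)
    (hB : 1 ≤ B) :
    ∃ C N : ℝ, 1 ≤ C ∧ 0 < N ∧ ∀ x r, 0 < r → ∀ x' t, 0 < t → t ≤ B * r → dist x' x ≤ A * r →
      Φ x' t ≤ ENNReal.ofReal (C * (1 + r / ρ x) ^ N) := by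
  obtain ⟨C, N, hC, hN, h⟩ := h.exists_real hρ.1
  obtain ⟨C', N', hC', hN', h'⟩ := hρ.2 A hA
  have h1 : 1 ≤ (B * C') ^ N := Real.one_le_rpow (one_le_mul_of_one_le_of_one_le hB hC') hN.le
  refine ⟨C * (B * C') ^ N, N' * N, one_le_mul_of_one_le_of_one_le hC h1, by positivity,
    fun x r hr x' t ht htr hdist => (h x' t ht).trans (ENNReal.ofReal_le_ofReal ?_)⟩
  have hx := one_le_one_add_div hρ.1 x hr
  have hx' := one_le_one_add_div hρ.1 x' ht
  have hpos := hρ.1 x'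
  have h2 : 1 + t / ρ x' ≤ B * (C' * (1 + r / ρ x) ^ N') := by
    calc 1 + t / ρ x' ≤ B + B * r / ρ x' := by gcongr
      _ = B * (1 + r / ρ x') := by ring
      _ ≤ _ := by gcongr; exact h' x x' r hr hdist
  calc C * (1 + t / ρ x') ^ N ≤ C * (B * (C' * (1 + r / ρ x) ^ N')) ^ N := by gcongr
    _ = _ := by
      rw [← mul_assoc B, Real.mul_rpow (by positivity) (by positivity),
        ← Real.rpow_mul (by linarith), mul_assoc]

end PolyBounded

/-! ### The equivalences for cubes and for balls -/

section Equivalences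

variable {d : ℕ} {ρ : EuclideanSpace ℝ (Fin d) → ℝ} {p q : ℝ} {ω f : EuclideanSpace ℝ (Fin d) → ℝ}

theorem cube_subset_ball [NeZero d] (x : EuclideanSpace ℝ (Fin d)) {r : ℝ} (hr : 0 < r) :
    cube x r ⊆ ball x (d * r) := by
  intro y hy
  have hd : (1 : ℝ) ≤ d := by exact_mod_cast NeZero.one_le
  rw [mem_ball, EuclideanSpace.dist_eq, Real.sqrt_lt' (by positivity)]
  calc ∑ i, dist (y i) (x i) ^ 2 ≤ ∑ _i : Fin d, (r / 2) ^ 2 := by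
        gcongr with i
        exact (hy i).le
    _ = d * (r / 2) ^ 2 := by simp
    _ < (d * r) ^ 2 := by nlinarith [mul_pos hr hr, mul_le_mul_of_nonneg_right hd (sq_nonneg (d * r))]

theorem ball_subset_cube (x : EuclideanSpace ℝ (Fin d)) (r : ℝ) : ball x (r / 2) ⊆ cube x r := by
  intro y hy i
  rw [mem_ball, dist_eq_norm] at hy
  exact (PiLp.norm_apply_le (y - x) i).trans_lt hy

theorem le_and_dist_le_of_cube_subset [NeZero d] {x x' : EuclideanSpace ℝ (Fin d)} {r r' : ℝ}
    (hr : 0 < r) (hr' : 0 < r') (h : cube x' r' ⊆ cube x r) : r' ≤ r ∧ dist x' x ≤ d * r := by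
  constructor
  · have h1 := measure_mono (μ := volume) h
    rw [volume_cube x hr, volume_cube x' hr', ENNReal.ofReal_le_ofReal_iff (by positivity)] at h1
    exact (pow_le_pow_iff_left₀ hr'.le hr.le (NeZero.ne d)).1 h1
  · have h1 : x' ∈ cube x' r' := fun i => by simpa using hr'
    exact (mem_ball.1 (cube_subset_ball x hr (h h1))).le

theorem polyBounded_apqLocal_ball (hω : MemApqInfty ρ p q ω) :
    PolyBounded ρ 1 fun x r => apqLocal p q ω (ball x r) := by
  obtain ⟨θ, hθ, -, C, hC, h⟩ := hω
  exact PolyBounded.of_real hC hθ h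

theorem volume_ball_le_mul_volume_cube [NeZero d] :
    ∃ c : ℝ, 1 ≤ c ∧ ∀ (x : EuclideanSpace ℝ (Fin d)) (r : ℝ), 0 < r →
      volume (ball x (d * r)) ≤ ENNReal.ofReal c * volume (cube x r) := by
  set v := volume.real (ball (0 : EuclideanSpace ℝ (Fin d)) 1)
  refine ⟨max 1 (d ^ d * v), le_max_left _ _, fun x r hr => ?_⟩
  have hd : (0 : ℝ) < d := by exact_mod_cast Nat.pos_of_neZero d
  rw [volume_cube x hr, ← ENNReal.ofReal_toReal (measure_ball_lt_top (x := x) (r := d * r)).ne,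
    ← ENNReal.ofReal_mul (by positivity)]
  apply ENNReal.ofReal_le_ofReal
  calc volume.real (ball x (d * r)) = (d ^ d * v) * r ^ d := by
        rw [volume_real_ball x (by positivity), mul_pow]; ring
    _ ≤ _ := by gcongr; exact le_max_right _ _

theorem polyBounded_apqLocal_cube [NeZero d] (hρ : SlowlyVarying ρ) (hp : 1 ≤ p) (hq : 1 ≤ q)
    (hω : MemApqInfty ρ p q ω) : PolyBounded ρ 1 fun x r => apqLocal p q ω (cube x r) := by
  obtain ⟨c, hc, hvol⟩ := volume_ball_le_mul_volume_cube (d := d)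
  have hd : (1 : ℝ) ≤ d := by exact_mod_cast NeZero.one_le
  obtain ⟨C, N, hC, hN, h⟩ := (polyBounded_apqLocal_ball hω).uniform hρ le_rfl hd
  refine PolyBounded.of_real (C := c ^ 2 * C) (N := N) (by positivity) hN fun x r hr => ?_
  have h1 := apqLocal_mono hp hq ω (cube_subset_ball x hr) (c := ENNReal.ofReal c) (by simpa using hc)
    ENNReal.ofReal_ne_top (hvol x r hr)
  refine h1.trans ?_
  rw [mul_assoc, ENNReal.ofReal_mul (by positivity), ENNReal.ofReal_pow (by positivity)]
  gcongr
  exact h x r hr x (d * r) (by positivity) le_rfl (by simp)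

theorem weightGood_cube [NeZero d] (hp : 1 ≤ p) (hq : 0 < q) (hω : MemApqInfty ρ p q ω)
    (hne : ¬ ω =ᵐ[volume] 0) (x : EuclideanSpace ℝ (Fin d)) {r : ℝ} (hr : 0 < r) :
    WeightGood q ω (cube x r) := by
  have hd : (0 : ℝ) < d := by exact_mod_cast Nat.pos_of_neZero d
  have h := hω.weightGood_ball hp hq hne x (mul_pos hd hr)
  exact ⟨h.aemeasurable, h.pos, volume_cube_ne_zero x hr, volume_cube_ne_top x hr,
    ne_top_of_le_ne_top h.weight_ne_top (weightPow_mono q (cube_subset_ball x hr))⟩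

/-- The local quantity on one ball is already positive. Nonvanishing is needed to divide by `κ` in
`polyBounded_iff_one`. -/
theorem apqConstInfty_ne_zero (hρ : ∀ x, 0 < ρ x) (hp : 1 ≤ p) (hq : 0 < q)
    (hω : MemApqInfty ρ p q ω) (hne : ¬ ω =ᵐ[volume] 0) : apqConstInfty ρ p q ω ≠ 0 := by
  have h := hω.weightGood_ball hp hq hne 0 one_pos
  intro h0
  rw [apqConstInfty, apqConst, ENNReal.iSup_eq_zero] at h0
  have h1 := h0 0
  rw [ENNReal.iSup_eq_zero] at h1
  have h2 := h1 1
  rw [ENNReal.iSup_eq_zero] at h2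
  have h3 := h2 one_pos
  have hu := one_le_one_add_div hρ 0 one_pos
  rw [mul_eq_zero, ENNReal.ofReal_eq_zero, apqLocal_eq, mul_eq_zero,
    ENNReal.rpow_eq_zero_iff_of_pos (by positivity), mul_eq_zero, ENNReal.inv_eq_zero] at h3
  rcases h3 with h3 | (h3 | h3) | h3
  · exact absurd h3 (not_le.2 (Real.rpow_pos_of_pos (by linarith) _))
  · exact h.volume_ne_top h3
  · exact h.weightPow_ne_zero q h3
  · exact dualFactor_ne_zero hp h.aemeasurable h.volume_ne_zero h.volume_ne_top h3

section Family

variable {S : EuclideanSpace ℝ (Fin d) → ℝ → Set (EuclideanSpace ℝ (Fin d))}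
  {A : EuclideanSpace ℝ (Fin d) → ℝ → ℝ≥0∞}

/-- The spare factor `A` is 1 in the BLO case and `|B|^{-β/d}` in the Campanato case. -/
theorem polyBounded_weighted_iff_normalized (hρ : ∀ x, 0 < ρ x) (hp : 1 ≤ p) (hpq : p ≤ q)
    (hgood : ∀ x r, 0 < r → WeightGood q ω (S x r))
    (hapq : PolyBounded ρ 1 fun x r => apqLocal p q ω (S x r))
    (X : EuclideanSpace ℝ (Fin d) → ℝ → ℝ≥0∞) :
    PolyBounded ρ 1 (fun x r => A x r * ((weightPow ω q (S x r))⁻¹ * X x r) ^ (1 / q)) ↔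
      PolyBounded ρ 1 (fun x r => A x r *
        (volume (S x r) ^ (1 / p - 1 / q) / weightPow ω p (S x r) ^ (1 / p) * X x r ^ (1 / q))) := by
  constructor
  · intro h
    refine (hapq.mul hρ h).mono fun x r hr => ?_
    rw [mul_left_comm (apqLocal p q ω (S x r))]
    exact mul_le_mul' le_rfl ((hgood x r hr).normalized_le hp hpq _)
  · intro h
    refine h.mono fun x r hr => ?_
    exact mul_le_mul' le_rfl ((hgood x r hr).le_normalized (by linarith) hpq _)

theorem PolyBounded.average_of_weighted (hρ : ∀ x, 0 < ρ x) (hp : 1 ≤ p) (hpq : p ≤ q)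
    (hf : AEMeasurable f volume) (hgood : ∀ x r, 0 < r → WeightGood q ω (S x r))
    (hapq : PolyBounded ρ 1 fun x r => apqLocal p q ω (S x r))
    (h : PolyBounded ρ 1 fun x r => A x r * ((weightPow ω q (S x r))⁻¹ *
      ∫⁻ y in S x r, lowerOsc f (S x r) y ^ q * ENNReal.ofReal (ω y) ^ q) ^ (1 / q)) :
    PolyBounded ρ 1 fun x r => A x r * ((volume (S x r))⁻¹ * ∫⁻ y in S x r, lowerOsc f (S x r) y) := by
  refine (h.mul hρ hapq).mono fun x r hr => ?_
  rw [mul_assoc]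
  exact mul_le_mul' le_rfl ((hgood x r hr).average_le hp hpq (aemeasurable_lowerOsc hf _))

end Family

theorem memBLOInfty_iff (hρ : ∀ x, 0 < ρ x) (hf : AEMeasurable f volume) :
    MemBLOInfty ρ f ↔ PolyBounded ρ 1 fun x r =>
      (volume (cube x r))⁻¹ * ∫⁻ y in cube x r, lowerOsc f (cube x r) y := by
  constructor
  · rintro ⟨θ, hθ, -, C, hC, h⟩
    exact PolyBounded.of_real hC hθ h
  · intro H
    obtain ⟨C, N, hC, hN, h⟩ := H.exists_real hρ
    refine ⟨N, hN, fun x => ⟨cube x 1, Filter.mem_of_superset (ball_mem_nhds x (by norm_num))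
      (ball_subset_cube x 1), ?_⟩, C, by linarith, h⟩
    refine integrableOn_of_lintegral_lowerOsc_ne_top hf (volume_cube_ne_zero x one_pos)
      (volume_cube_ne_top x one_pos) fun htop => ?_
    have h1 := h x 1 one_pos
    rw [htop, ENNReal.mul_top (ENNReal.inv_ne_zero.2 (volume_cube_ne_top x one_pos)), top_le_iff] at h1
    exact ENNReal.ofReal_ne_top h1

theorem memCampanatoStarInfty_iff {β : ℝ} (hρ : ∀ x, 0 < ρ x) :
    MemCampanatoStarInfty ρ β f ↔ LocallyIntegrable f volume ∧ PolyBounded ρ 1 fun x r =>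
      (volume (ball x r) ^ (β / d))⁻¹ *
        ((volume (ball x r))⁻¹ * ∫⁻ y in ball x r, lowerOsc f (ball x r) y) := by
  have heq : ∀ (x : EuclideanSpace ℝ (Fin d)) (r : ℝ), 0 < r → ∀ X : ℝ≥0∞,
      (volume (ball x r) ^ (1 + β / d))⁻¹ * X =
        (volume (ball x r) ^ (β / d))⁻¹ * ((volume (ball x r))⁻¹ * X) := by
    intro x r hr X
    have h0 : volume (ball x r) ≠ 0 := (measure_ball_pos _ _ hr).ne'
    have ht : volume (ball x r) ≠ ∞ := measure_ball_lt_top.ne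
    rw [ENNReal.rpow_add _ _ h0 ht, ENNReal.rpow_one, ENNReal.mul_inv (Or.inl h0) (Or.inl ht)]
    ring
  constructor
  · rintro ⟨θ, hθ, hloc, C, hC, h⟩
    exact ⟨hloc, PolyBounded.of_real hC hθ fun x r hr => (heq x r hr _).symm.trans_le (h x r hr)⟩
  · rintro ⟨hloc, H⟩
    obtain ⟨C, N, hC, hN, h⟩ := H.exists_real hρ
    exact ⟨N, hN, hloc, C, by linarith, fun x r hr => (heq x r hr _).trans_le (h x r hr)⟩

theorem locallyIntegrable_of_polyBounded_ball {β : ℝ} (hβ : 0 ≤ β) (hρ : ∀ x, 0 < ρ x)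
    (hf : AEMeasurable f volume) (H : PolyBounded ρ 1 fun x r => (volume (ball x r) ^ (β / d))⁻¹ *
        ((volume (ball x r))⁻¹ * ∫⁻ y in ball x r, lowerOsc f (ball x r) y)) :
    LocallyIntegrable f volume := by
  obtain ⟨C, N, hC, hN, h⟩ := H.exists_real hρ
  intro x
  refine ⟨ball x 1, ball_mem_nhds x one_pos, ?_⟩
  have ht : volume (ball x 1) ≠ ∞ := measure_ball_lt_top.ne
  refine integrableOn_of_lintegral_lowerOsc_ne_top hf (measure_ball_pos _ _ one_pos).ne' ht
    fun htop => ?_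
  have h1 := h x 1 one_pos
  rw [htop, ENNReal.mul_top (ENNReal.inv_ne_zero.2 ht), ENNReal.mul_top (ENNReal.inv_ne_zero.2
    (ENNReal.rpow_ne_top_of_nonneg (by positivity) ht)), top_le_iff] at h1
  exact ENNReal.ofReal_ne_top h1

/-- John–Nirenberg inside each cube, with the oscillation and weight constants frozen by
`PolyBounded.uniform`. Its bound is a product of powers of these constants, hence polynomial in `1 +
r / ρ`. -/
theorem polyBounded_weighted_cube [NeZero d] (hρ : SlowlyVarying ρ) (hp : 1 ≤ p) (hpq : p ≤ q)
    (hω : MemApqInfty ρ p q ω) (hne : ¬ ω =ᵐ[volume] 0) (hf : AEMeasurable f volume)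
    (h : PolyBounded ρ 1 fun x r =>
      (volume (cube x r))⁻¹ * ∫⁻ y in cube x r, lowerOsc f (cube x r) y) :
    PolyBounded ρ 1 fun x r => ((weightPow ω q (cube x r))⁻¹ *
      ∫⁻ y in cube x r, lowerOsc f (cube x r) y ^ q * ENNReal.ofReal (ω y) ^ q) ^ (1 / q) := by
  have hq : 1 ≤ q := hp.trans hpq
  have hq0 : 0 < q := by linarith
  have hgood := fun x r (hr : 0 < r) => weightGood_cube (d := d) hp hq0 hω hne x hr
  obtain ⟨C₁, N₁, hC₁, hN₁, h₁⟩ := h.uniform hρ (Nat.cast_nonneg d) le_rfl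
  obtain ⟨C₂, N₂, hC₂, hN₂, h₂⟩ :=
    (polyBounded_apqLocal_cube hρ hp hq hω).uniform hρ (Nat.cast_nonneg d) le_rfl
  have hωm := (hgood 0 1 one_pos).aemeasurable
  have hwm : AEMeasurable (fun y => ENNReal.ofReal (ω y) ^ q) volume :=
    hωm.ennreal_ofReal.pow_const q
  set m : Measure (EuclideanSpace ℝ (Fin d)) :=
    volume.withDensity fun y => ENNReal.ofReal (ω y) ^ q with hm
  have hmac : m ≪ volume := withDensity_absolutelyContinuous _ _
  have hmA : ∀ A, MeasurableSet A → m A = weightPow ω q A := fun A hA => withDensity_apply _ hA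
  refine PolyBounded.of_real (C := 2 ^ (d + 1) * C₁ * (q * (2 * C₂) ^ q)) (N := N₁ + N₂ * q)
    (by positivity) (by positivity) fun x₀ r₀ hr₀ => ?_
  set u := 1 + r₀ / ρ x₀
  have hu : 1 ≤ u := one_le_one_add_div hρ.1 x₀ hr₀
  have huN : 1 ≤ u ^ N₂ := Real.one_le_rpow hu hN₂.le
  have hK : 1 ≤ 2 * (C₂ * u ^ N₂) := by
    have := one_le_mul_of_one_le_of_one_le hC₂ huN
    linarith
  have hQm := measurableSet_cube x₀ r₀
  -- Here `L` bounds the oscillation on all subcubes of the fixed cube, and `K` is the `q`-th power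
  -- of twice the frozen weight constant, as given by `weightPow_le_of_volume_le`.
  have hJN := lintegral_lowerOsc_rpow_le hf hmac hr₀
    (by rw [hmA _ hQm]; exact (hgood x₀ r₀ hr₀).weight_ne_top) hq
    (K := (2 * (C₂ * u ^ N₂)) ^ q) (Real.one_le_rpow hK hq0.le)
    (L := C₁ * u ^ N₁) (by positivity)
    (by
      intro x r hr hsub A hA hAsub hvol
      obtain ⟨hrr, hdist⟩ := le_and_dist_le_of_cube_subset hr₀ hr hsub
      rw [hmA _ (measurableSet_cube x r), hmA A hA]
      refine ((hgood x r hr).weightPow_le_of_volume_le hp hpq hA hAsub hvol).trans ?_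
      rw [← ENNReal.ofReal_rpow_of_pos (by positivity), ENNReal.ofReal_mul (by norm_num),
        ENNReal.ofReal_ofNat]
      gcongr
      exact h₂ x₀ r₀ hr₀ x r hr (by rwa [one_mul]) hdist)
    (by
      intro x r hr hsub
      obtain ⟨hrr, hdist⟩ := le_and_dist_le_of_cube_subset hr₀ hr hsub
      have h3 := h₁ x₀ r₀ hr₀ x r hr (by rwa [one_mul]) hdist
      rwa [← ENNReal.div_eq_inv_mul, ENNReal.div_le_iff (volume_cube_ne_zero x hr)
        (volume_cube_ne_top x hr)] at h3)
  have hint : ∫⁻ y in cube x₀ r₀, lowerOsc f (cube x₀ r₀) y ^ q ∂m =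
      ∫⁻ y in cube x₀ r₀, lowerOsc f (cube x₀ r₀) y ^ q * ENNReal.ofReal (ω y) ^ q := by
    rw [hm, restrict_withDensity hQm, lintegral_withDensity_eq_lintegral_mul₀ hwm.restrict
      ((aemeasurable_lowerOsc hf _).pow_const q).restrict]
    simp only [Pi.mul_apply, mul_comm]
  rw [hint, hmA _ hQm] at hJN
  have hg := hgood x₀ r₀ hr₀
  calc _ ≤ ((weightPow ω q (cube x₀ r₀))⁻¹ * (ENNReal.ofReal (2 ^ (d + 1) * (C₁ * u ^ N₁) *
        (q * (2 * (C₂ * u ^ N₂)) ^ q)) ^ q * weightPow ω q (cube x₀ r₀))) ^ (1 / q) := by gcongr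
    _ = ENNReal.ofReal (2 ^ (d + 1) * (C₁ * u ^ N₁) * (q * (2 * (C₂ * u ^ N₂)) ^ q)) := by
        rw [mul_left_comm, ENNReal.inv_mul_cancel (hg.weightPow_ne_zero q) hg.weight_ne_top, mul_one,
          ← ENNReal.rpow_mul, mul_one_div_cancel hq0.ne', ENNReal.rpow_one]
    _ = _ := by
        congr 1
        rw [← mul_assoc 2 C₂, Real.mul_rpow (by positivity) (by positivity), Real.rpow_add (by linarith),
          Real.rpow_mul (by linarith)]
        ring

/-- The oscillation is bounded almost everywhere on the ball, so the weight enters only through its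
total mass, which cancels against the normalization. -/
theorem polyBounded_weighted_ball [NeZero d] (hρ : SlowlyVarying ρ) {β : ℝ} (hβ : 0 < β)
    (hq : 0 < q) (hgood : ∀ x r, 0 < r → WeightGood q ω (ball x r))
    (hf : LocallyIntegrable f volume)
    (h : PolyBounded ρ 1 fun x r => (volume (ball x r) ^ (β / d))⁻¹ *
        ((volume (ball x r))⁻¹ * ∫⁻ y in ball x r, lowerOsc f (ball x r) y)) :
    PolyBounded ρ 1 fun x r => (volume (ball x r) ^ (β / d))⁻¹ * ((weightPow ω q (ball x r))⁻¹ *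
      ∫⁻ y in ball x r, lowerOsc f (ball x r) y ^ q * ENNReal.ofReal (ω y) ^ q) ^ (1 / q) := by
  obtain ⟨C, N, hC, hN, h⟩ := h.uniform hρ zero_le_one one_le_two
  obtain ⟨C', hC', hpt⟩ := ae_lowerOsc_le_of_average_le hf hβ
  have hv : ∀ (x : EuclideanSpace ℝ (Fin d)) (r : ℝ), 0 < r →
      volume (ball x r) ^ (β / d) ≠ 0 ∧ volume (ball x r) ^ (β / d) ≠ ∞ := fun x r hr =>
    WeightGood.rpow_ne_zero_ne_top (measure_ball_pos _ _ hr).ne' measure_ball_lt_top.ne _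
  refine PolyBounded.of_real (C := C' * C) (N := N) (by positivity) hN fun x₀ r₀ hr₀ => ?_
  set H := ENNReal.ofReal (C * (1 + r₀ / ρ x₀) ^ N)
  set b := volume (ball x₀ r₀) ^ (β / d)
  obtain ⟨hb0, hbt⟩ := hv x₀ r₀ hr₀
  have hae : ∀ᵐ x ∂volume.restrict (ball x₀ r₀),
      lowerOsc f (ball x₀ r₀) x ≤ ENNReal.ofReal C' * b * H := by
    rw [ae_restrict_iff' measurableSet_ball]
    filter_upwards [hpt] with x hx hxB
    -- The pointwise estimate concerns balls centered at `x`, so the given ball is first enlarged to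
    -- one of those.
    have hsub : ball x₀ r₀ ⊆ ball x (2 * r₀) := by
      apply ball_subset_ball'
      rw [dist_comm, two_mul]
      linarith [mem_ball.1 hxB]
    have hvol : volume (ball x r₀) = volume (ball x₀ r₀) := by
      rw [Measure.addHaar_ball_center, Measure.addHaar_ball_center volume x₀]
    refine (lowerOsc_mono hsub x).trans ?_
    have h1 := hx r₀ H hr₀ fun t ht htr => ?_
    · rwa [hvol] at h1
    · have h2 := h x₀ r₀ hr₀ x t ht htr (by rw [one_mul]; exact (mem_ball.1 hxB).le)
      obtain ⟨h0, ht'⟩ := hv x t ht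
      rw [← ENNReal.div_eq_inv_mul, ENNReal.div_le_iff h0 ht'] at h2
      rwa [mul_comm (volume (ball x t) ^ (β / d))]
  have hg := hgood x₀ r₀ hr₀
  have hint : ∫⁻ y in ball x₀ r₀, lowerOsc f (ball x₀ r₀) y ^ q * ENNReal.ofReal (ω y) ^ q ≤
      (ENNReal.ofReal C' * b * H) ^ q * weightPow ω q (ball x₀ r₀) := by
    rw [weightPow, ← lintegral_const_mul'' _ ((hg.aemeasurable.ennreal_ofReal.pow_const q).restrict)]
    apply lintegral_mono_ae
    filter_upwards [hae] with y hy
    gcongr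
  calc _ ≤ b⁻¹ * ((weightPow ω q (ball x₀ r₀))⁻¹ * ((ENNReal.ofReal C' * b * H) ^ q *
        weightPow ω q (ball x₀ r₀))) ^ (1 / q) := by gcongr
    _ = b⁻¹ * (ENNReal.ofReal C' * b * H) := by
        rw [mul_left_comm (weightPow ω q (ball x₀ r₀))⁻¹, ENNReal.inv_mul_cancel
          (hg.weightPow_ne_zero q) hg.weight_ne_top, mul_one, ← ENNReal.rpow_mul,
          mul_one_div_cancel hq.ne', ENNReal.rpow_one]
    _ = (b⁻¹ * b) * (ENNReal.ofReal C' * H) := by ring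
    _ = _ := by
        rw [ENNReal.inv_mul_cancel hb0 hbt, one_mul, mul_assoc, ENNReal.ofReal_mul hC'.le]

end Equivalences

theorem mainTheorem9 (d : ℕ) (hd : 3 ≤ d)
    (V : EuclideanSpace ℝ (Fin d) → ℝ) (hV_nonneg : ∀ x, 0 ≤ V x)
    (hV_loc : LocallyIntegrable V volume) (hV_ne : ¬ V =ᵐ[volume] 0)
    (s : ℝ≥0∞) (hs : (d : ℝ≥0∞) / 2 ≤ s) (hV : ReverseHolder s V)
    (p q : ℝ) (hp : 1 ≤ p) (hpq : p < q)
    (ω : EuclideanSpace ℝ (Fin d) → ℝ) (hω : MemApqInfty (criticalRadius V) p q ω)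
    (hω_ne : ¬ ω =ᵐ[volume] 0)
    (κ : ℝ≥0∞) (hκ : κ = 1 ∨ κ = apqConstInfty (criticalRadius V) p q ω) (hκ_fin : κ ≠ ∞)
    (f : EuclideanSpace ℝ (Fin d) → ℝ) (hf : AEMeasurable f volume) :
    ((MemBLOInfty (criticalRadius V) f ↔
        PolyBounded (criticalRadius V) κ fun x₀ r =>
          ((weightPow ω q (cube x₀ r))⁻¹ *
            ∫⁻ x in cube x₀ r,
              lowerOsc f (cube x₀ r) x ^ q * ENNReal.ofReal (ω x) ^ q) ^ (1 / q)) ∧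
      (MemBLOInfty (criticalRadius V) f ↔
        PolyBounded (criticalRadius V) κ fun x₀ r =>
          volume (cube x₀ r) ^ (1 / p - 1 / q) / weightPow ω p (cube x₀ r) ^ (1 / p) *
            (∫⁻ x in cube x₀ r,
              lowerOsc f (cube x₀ r) x ^ q * ENNReal.ofReal (ω x) ^ q) ^ (1 / q))) ∧
    ∀ β : ℝ, 0 < β → β < 1 →
      ((MemCampanatoStarInfty (criticalRadius V) β f ↔
        PolyBounded (criticalRadius V) κ fun x₀ r =>
          (volume (ball x₀ r) ^ (β / d))⁻¹ *
            ((weightPow ω q (ball x₀ r))⁻¹ *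
              ∫⁻ x in ball x₀ r,
                lowerOsc f (ball x₀ r) x ^ q * ENNReal.ofReal (ω x) ^ q) ^ (1 / q)) ∧
      (MemCampanatoStarInfty (criticalRadius V) β f ↔
        PolyBounded (criticalRadius V) κ fun x₀ r =>
          volume (ball x₀ r) ^ (1 / p - 1 / q - β / d) / weightPow ω p (ball x₀ r) ^ (1 / p) *
            (∫⁻ x in ball x₀ r,
              lowerOsc f (ball x₀ r) x ^ q * ENNReal.ofReal (ω x) ^ q) ^ (1 / q))) := by
  have : NeZero d := ⟨by omega⟩
  have hρ : SlowlyVarying (criticalRadius V) :=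
    criticalRadius_growth hd hV_nonneg hV_loc hV_ne hs hV
  have hq : 0 < q := by linarith
  have hκ0 : κ ≠ 0 := by
    rcases hκ with rfl | rfl
    · exact one_ne_zero
    · exact apqConstInfty_ne_zero hρ.1 hp hq hω hω_ne
  -- Both choices of `κ` are absorbed into the constant, leaving a single statement with `κ = 1`.
  simp only [polyBounded_iff_one hκ0 hκ_fin]
  have hcube := fun x r (hr : 0 < r) => weightGood_cube (d := d) hp hq hω hω_ne x hr
  have hball := fun x r (hr : 0 < r) => hω.weightGood_ball (d := d) hp hq hω_ne x hr
  have hapq_cube := polyBounded_apqLocal_cube hρ hp (hp.trans hpq.le) hω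
  have hapq_ball := polyBounded_apqLocal_ball hω
  refine ⟨?_, fun β hβ _ => ?_⟩
  · have hb : MemBLOInfty (criticalRadius V) f ↔ PolyBounded (criticalRadius V) 1 fun x₀ r =>
        ((weightPow ω q (cube x₀ r))⁻¹ * ∫⁻ x in cube x₀ r,
          lowerOsc f (cube x₀ r) x ^ q * ENNReal.ofReal (ω x) ^ q) ^ (1 / q) := by
      rw [memBLOInfty_iff hρ.1 hf]
      refine ⟨polyBounded_weighted_cube hρ hp hpq.le hω hω_ne hf, fun h => ?_⟩
      have h1 := PolyBounded.average_of_weighted (A := fun _ _ => 1) hρ.1 hp hpq.le hf hcube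
        hapq_cube (by simpa only [one_mul] using h)
      simpa only [one_mul] using h1
    have hc := polyBounded_weighted_iff_normalized (A := fun _ _ => 1) hρ.1 hp hpq.le hcube hapq_cube
      fun x₀ r => ∫⁻ x in cube x₀ r, lowerOsc f (cube x₀ r) x ^ q * ENNReal.ofReal (ω x) ^ q
    simp only [one_mul] at hc
    exact ⟨hb, hb.trans hc⟩
  · have hb : MemCampanatoStarInfty (criticalRadius V) β f ↔
        PolyBounded (criticalRadius V) 1 fun x₀ r => (volume (ball x₀ r) ^ (β / d))⁻¹ *
          ((weightPow ω q (ball x₀ r))⁻¹ * ∫⁻ x in ball x₀ r,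
            lowerOsc f (ball x₀ r) x ^ q * ENNReal.ofReal (ω x) ^ q) ^ (1 / q) := by
      rw [memCampanatoStarInfty_iff hρ.1]
      refine ⟨fun h => polyBounded_weighted_ball hρ hβ hq hball h.1 h.2, fun h => ?_⟩
      have h1 := PolyBounded.average_of_weighted hρ.1 hp hpq.le hf hball hapq_ball h
      -- Local integrability is not assumed in the weighted conditions; it is recovered from the
      -- unweighted oscillation bound on unit balls.
      exact ⟨locallyIntegrable_of_polyBounded_ball hβ.le hρ.1 hf h1, h1⟩
    have hc := polyBounded_weighted_iff_normalized
      (A := fun x₀ r => (volume (ball x₀ r) ^ (β / d))⁻¹) hρ.1 hp hpq.le hball hapq_ball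
      fun x₀ r => ∫⁻ x in ball x₀ r, lowerOsc f (ball x₀ r) x ^ q * ENNReal.ofReal (ω x) ^ q
    refine ⟨hb, hb.trans (hc.trans (polyBounded_congr fun x r hr => ?_))⟩
    rw [ENNReal.rpow_sub (1 / p - 1 / q) (β / d) (measure_ball_pos volume x hr).ne'
      measure_ball_lt_top.ne]
    simp only [div_eq_mul_inv]
    ring
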